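/- Let $p$ be a prime, $k$ an algebraically closed field of characteristic $p$, $\mathcal{O}$ a finite extension of the Witt ring $W(k)$ (a discrete valuation ring), with absolute value normalized by $|p|=p^{-1}$, let $\sigma$ be an automorphism of $\mathcal{O}$ lifting the absolute Frobenius of $k$, and let $\mathcal{O}_0$ be the subring of $\mathcal{O}$ fixed by $\sigma$. Let $\Gamma^{\mathrm{imm}}_{\mathrm{an,con}}$ be the ring of generalized power series $x=\sum_{n\in\mathbb{Q}}x_nt^n$ with $x_n\in\mathcal{O}[\frac1p]$ such that (i) for each $r\in\mathbb{R}$ the set $\{n: |x_n|>p^{r}\}$ is well-ordered; (ii) for each $j\in\mathbb{Q}$ the $|x_n|$ with $n<j$ are bounded; (iii) there is $c>0$ with $|x_n|<p^{cn}$ for all sufficiently negative $n$; (iv) for each $d>0$, $|x_n|<p^{dn}$ for all sufficiently positive $n$; the product is $(xy)_n=\sum_{i}x_iy_{n-i}$ and the Frobenius is $\sum x_nt^n\mapsto\sum x_n^{\sigma}t^{pn}$. Let $\Gamma^{\mathrm{imm}}$ be the ring of series $\sum_{n\in\mathbb{Q}} x_nt^n$ with $x_n\in\mathcal{O}$ such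 that $\{n:|x_n|>p^{-r}\}$ is well-ordered for each $r>0$; its residue field is $K^{\mathrm{imm}}=k((t^{\mathbb{Q}}))$. Let $K^{\mathrm{alg}}$ be the algebraic closure of $K=k((t))$ in $K^{\mathrm{imm}}$, and let $\Gamma^{\mathrm{alg}}\subset\Gamma^{\mathrm{imm}}$ be the $p$-adically complete subring with residue field $K^{\mathrm{alg}}$, that is, the $p$-adic closure of the subring generated by $\mathcal{O}$ and by the Teichmüller lifts of the elements of $K^{\mathrm{alg}}$. Let $\Gamma^{\mathrm{alg}}_{\mathrm{con}}$ be the ring of the $x\in\Gamma^{\mathrm{alg}}$ that satisfy (iii). Finally, let $\Gamma^{\mathrm{alg}}_{\mathrm{an,con}}$ be the subring of the $x\in\Gamma^{\mathrm{imm}}_{\mathrm{an,con}}$ such that for each $j\in\mathbb{Q}$ there is $y\in\Gamma^{\mathrm{alg}}_{\mathrm{con}}[\frac1p]$ with $x_i=y_i$ for all $i<j$; the Frobenius preserves it. Let $R=\Gamma^{\mathrm{alg}}_{\mathrm{an,con}}$ or $R=\Gamma^{\mathrm{imm}}_{\mathrm{an,con}}$. An $F$-crystal over $R$ is a finite free $R$-module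 $M$ with an additive map $F:M\to M$ that is semilinear with respect to the Frobenius of $R$ and whose linearization is an isomorphism. **Lemma.** Let $\pi\in\mathcal{O}_0$ be a uniformizer of $\mathcal{O}$, let $m\ge 2$ be an integer and let $c\in R$. Let $M$ be an $F$-crystal over $R$ with a basis $\mathbf{v},\mathbf{w}$ such that $$F\mathbf{v}=\pi^m\mathbf{v},\qquad F\mathbf{w}=\mathbf{w}+c\,\mathbf{v}.$$ Then there is a nonzero $\mathbf{x}\in M$ with $F\mathbf{x}=\pi^{m-1}\mathbf{x}$. -/

import Mathlib

/-- The conditions on the coefficients of a generalized power series `∑ x_n t^n` (`n ∈ ℚ`) over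
a field `L` with an ultrametric absolute value to belong to the ring `Γ^imm_{an,con}`:

* for each real `r`, the set of the `n` with `|x_n| > p^r` is well-ordered;
* the coefficients are bounded on each initial segment of `ℚ`;
* there is `c > 0` such that `|x_n| < p^(c n)` for `n` sufficiently negative;
* for each `d > 0`, `|x_n| < p^(d n)` for `n` sufficiently positive.

Without the second condition the sums that define the product of two series may diverge. -/
structure IsAnCon (p : ℕ) {L : Type*} [NormedField L] (x : ℚ → L) : Prop where
  wo : ∀ r : ℝ, {n : ℚ | (p : ℝ) ^ r < ‖x n‖}.IsWF
  bdd : ∀ j : ℚ, ∃ C : ℝ, ∀ n < j, ‖x n‖ ≤ C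
  neg : ∃ c : ℝ, 0 < c ∧ ∀ᶠ n : ℚ in Filter.atBot, ‖x n‖ < (p : ℝ) ^ (c * n)
  pos : ∀ d : ℝ, 0 < d → ∀ᶠ n : ℚ in Filter.atTop, ‖x n‖ < (p : ℝ) ^ (d * n)

namespace IsAnCon

section
variable {p : ℕ} [hp : Fact p.Prime] {L : Type*} [NormedField L] {x y z : ℚ → L}

theorem one_lt : (1 : ℝ) < p := by exact_mod_cast hp.out.one_lt
theorem p_pos : (0 : ℝ) < p := zero_lt_one.trans one_lt

theorem bound (hx : IsAnCon p x) : ∃ c : ℝ, 0 < c ∧ ∀ d : ℝ, 0 < d → d ≤ c →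
    ∃ C : ℝ, 0 < C ∧ ∀ n : ℚ, ‖x n‖ ≤ C * (p : ℝ) ^ (d * n) := by
  obtain ⟨c, hc, h⟩ := hx.neg
  refine ⟨c, hc, fun d hd hdc => ?_⟩
  obtain ⟨N, hN⟩ := Filter.eventually_atBot.1 h
  obtain ⟨T, hT⟩ := Filter.eventually_atTop.1 (hx.pos d hd)
  obtain ⟨C, hC⟩ := hx.bdd T
  have p1 : (1 : ℝ) < p := one_lt
  have p0 : (0 : ℝ) < p := p_pos
  set N' : ℚ := min N 0
  set C' : ℝ := max 1 (C / (p : ℝ) ^ (d * N'))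
  have hC1 : (1 : ℝ) ≤ C' := le_max_left _ _
  refine ⟨C', by linarith, fun n => ?_⟩
  have hpos : (0 : ℝ) < (p : ℝ) ^ (d * n) := Real.rpow_pos_of_pos p0 _
  rcases le_or_gt T n with h1 | h1
  · nlinarith [hT n h1]
  rcases le_or_gt n N' with h2 | h2
  · have h3 := hN n (h2.trans (min_le_left _ _))
    have h4 : (n : ℝ) ≤ 0 := by exact_mod_cast h2.trans (min_le_right _ _)
    have h5 : (p : ℝ) ^ (c * n) ≤ (p : ℝ) ^ (d * n) :=
      Real.rpow_le_rpow_of_exponent_le p1.le (by nlinarith)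
    nlinarith
  · have h3 := hC n h1
    have h6 : (0 : ℝ) < (p : ℝ) ^ (d * N') := Real.rpow_pos_of_pos p0 _
    have h5 : (p : ℝ) ^ (d * N') ≤ (p : ℝ) ^ (d * n) :=
      Real.rpow_le_rpow_of_exponent_le p1.le (by
        have : (N' : ℝ) ≤ n := by exact_mod_cast h2.le
        nlinarith)
    have h7 : C ≤ C' * (p : ℝ) ^ (d * N') := by
      rw [← div_le_iff₀ h6]; exact le_max_right _ _
    nlinarith

theorem exists_common (hx : IsAnCon p x) (hy : IsAnCon p y) : ∃ c : ℝ, 0 < c ∧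
    ∀ d : ℝ, 0 < d → d ≤ c → (∃ C : ℝ, 0 < C ∧ ∀ n : ℚ, ‖x n‖ ≤ C * (p : ℝ) ^ (d * n)) ∧
      (∃ C : ℝ, 0 < C ∧ ∀ n : ℚ, ‖y n‖ ≤ C * (p : ℝ) ^ (d * n)) := by
  obtain ⟨c, hc, h⟩ := hx.bound
  obtain ⟨c', hc', h'⟩ := hy.bound
  exact ⟨min c c', lt_min hc hc', fun d hd hdc =>
    ⟨h d hd (hdc.trans (min_le_left _ _)), h' d hd (hdc.trans (min_le_right _ _))⟩⟩

theorem isPWO_of_bound (wo : ∀ r : ℝ, {n : ℚ | (p : ℝ) ^ r < ‖x n‖}.IsWF) {c d C ε : ℝ}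
    (hdc : d < c) (hd : 0 < d) (hC : 0 < C)
    (h : ∀ n : ℚ, ‖x n‖ ≤ C * (p : ℝ) ^ (c * n)) (hε : 0 < ε) :
    {n : ℚ | ε * (p : ℝ) ^ (d * n) ≤ ‖x n‖}.IsPWO := by
  have p1 : (1 : ℝ) < p := one_lt
  have p0 : (0 : ℝ) < p := p_pos
  set n0 : ℝ := Real.logb p (ε / C) / (c - d)
  set r : ℝ := Real.logb p (ε * (p : ℝ) ^ (d * n0)) - 1
  have hpos : 0 < ε * (p : ℝ) ^ (d * n0) := mul_pos hε (Real.rpow_pos_of_pos p0 _)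
  refine (wo r).isPWO.mono fun n hn => ?_
  have hn : ε * (p : ℝ) ^ (d * n) ≤ ‖x n‖ := hn
  have h1 := hn.trans (h n)
  have h2 : ε / C ≤ (p : ℝ) ^ ((c - d) * n) := by
    rw [sub_mul, Real.rpow_sub p0, div_le_div_iff₀ hC (Real.rpow_pos_of_pos p0 _)]
    linarith
  have h3 : n0 ≤ n := by
    rw [div_le_iff₀ (by linarith), Real.logb_le_iff_le_rpow p1 (div_pos hε hC), mul_comm]
    exact h2
  have h4 : (p : ℝ) ^ r < ε * (p : ℝ) ^ (d * n0) := by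
    rw [← Real.lt_logb_iff_rpow_lt p1 hpos]; simp [r]
  refine h4.trans_le (le_trans ?_ hn)
  exact mul_le_mul_of_nonneg_left
    (Real.rpow_le_rpow_of_exponent_le p1.le (by nlinarith)) hε.le

theorem isPWO (hx : IsAnCon p x) : ∃ c : ℝ, 0 < c ∧ ∀ d : ℝ, 0 < d → d ≤ c → ∀ ε : ℝ, 0 < ε →
    {n : ℚ | ε * (p : ℝ) ^ (d * n) ≤ ‖x n‖}.IsPWO := by
  obtain ⟨c, hc, h⟩ := hx.bound
  refine ⟨c / 2, by linarith, fun d hd hdc ε hε => ?_⟩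
  obtain ⟨C, hC, hb⟩ := h c hc le_rfl
  exact isPWO_of_bound hx.wo (by linarith) hd hC hb hε

theorem isWF_of_Iic {S : Set ℚ} (h : ∀ a, (S ∩ Set.Iic a).IsWF) : S.IsWF := by
  rw [Set.isWF_iff_no_descending_seq]
  intro f hf hS
  refine Set.isWF_iff_no_descending_seq.1 (h (f 0)) f hf fun n => ⟨hS n, ?_⟩
  exact hf.antitone (Nat.zero_le n)

theorem of_bound {c d : ℝ} (hc : 0 < c) (hd : 0 < d)
    (h1 : ∀ d : ℝ, 0 < d → d ≤ c → ∃ C : ℝ, 0 < C ∧ ∀ n : ℚ, ‖x n‖ ≤ C * (p : ℝ) ^ (d * n))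
    (h2 : ∀ ε : ℝ, 0 < ε → {n : ℚ | ε * (p : ℝ) ^ (d * n) ≤ ‖x n‖}.IsPWO) : IsAnCon p x := by
  have p1 : (1 : ℝ) < p := one_lt
  have p0 : (0 : ℝ) < p := p_pos
  have key : ∀ a b C : ℝ, a < b → 0 < C → ∀ᶠ n : ℚ in Filter.atTop,
      C * (p : ℝ) ^ (a * n) < (p : ℝ) ^ (b * n) := by
    intro a b C hab hC
    obtain ⟨N, hN⟩ := exists_rat_gt (Real.logb p C / (b - a))
    filter_upwards [Filter.eventually_ge_atTop N] with n hn
    have hn' : (N : ℝ) ≤ n := by exact_mod_cast hn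
    have h3 := hN.trans_le hn'
    rw [div_lt_iff₀ (by linarith), Real.logb_lt_iff_lt_rpow p1 hC] at h3
    calc C * (p : ℝ) ^ (a * n) < (p : ℝ) ^ (n * (b - a)) * (p : ℝ) ^ (a * n) :=
          mul_lt_mul_of_pos_right h3 (Real.rpow_pos_of_pos p0 _)
      _ = (p : ℝ) ^ (b * n) := by rw [← Real.rpow_add p0]; congr 1; ring
  refine ⟨fun r => isWF_of_Iic fun a => ?_, fun j => ?_, ?_, fun e he => ?_⟩
  · refine ((h2 ((p : ℝ) ^ (r - d * a)) (Real.rpow_pos_of_pos p0 _)).mono ?_).isWF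
    rintro n ⟨hn, hna⟩
    have hn : (p : ℝ) ^ r < ‖x n‖ := hn
    have hna : (n : ℝ) ≤ a := by exact_mod_cast hna
    refine le_trans ?_ hn.le
    rw [← Real.rpow_add p0]
    exact Real.rpow_le_rpow_of_exponent_le p1.le (by nlinarith)
  · obtain ⟨C, hC, h⟩ := h1 c hc le_rfl
    refine ⟨C * (p : ℝ) ^ (c * j), fun n hn => (h n).trans ?_⟩
    have hn : (n : ℝ) ≤ j := by exact_mod_cast hn.le
    exact mul_le_mul_of_nonneg_left
      (Real.rpow_le_rpow_of_exponent_le p1.le (by nlinarith)) hC.le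
  · obtain ⟨C, hC, h⟩ := h1 c hc le_rfl
    refine ⟨c / 2, by linarith, ?_⟩
    have h3 := key (-c) (-(c / 2)) C (by linarith) hC
    have h4 := Filter.tendsto_neg_atBot_atTop.eventually h3
    filter_upwards [h4] with n hn
    refine (h n).trans_lt ?_
    simpa using hn
  · obtain ⟨C, hC, h⟩ := h1 (min c (e / 2)) (lt_min hc (by linarith)) (min_le_left _ _)
    filter_upwards [key _ e C ((min_le_right c (e / 2)).trans_lt (by linarith)) hC] with n hn
    exact (h n).trans_lt hn

end


section
variable {p : ℕ} {L : Type*} [NormedField L] {x : ℚ → L}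

theorem neg' (hx : IsAnCon p x) : IsAnCon p (-x) :=
  ⟨by simpa using hx.wo, by simpa using hx.bdd, by simpa using hx.neg, by simpa using hx.pos⟩

end

section
variable {p : ℕ} [hp : Fact p.Prime] {L : Type*} [NormedField L] {x y z : ℚ → L}

theorem exists_two (hx : IsAnCon p x) (hy : IsAnCon p y) : ∃ c : ℝ, 0 < c ∧ ∀ d : ℝ, 0 < d →
    d ≤ c → ∃ C : ℝ, 0 < C ∧ (∀ n : ℚ, ‖x n‖ ≤ C * (p : ℝ) ^ (d * n)) ∧
      (∀ n : ℚ, ‖y n‖ ≤ C * (p : ℝ) ^ (d * n)) ∧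
      (∀ ε : ℝ, 0 < ε → {n : ℚ | ε * (p : ℝ) ^ (d * n) ≤ ‖x n‖}.IsPWO) ∧
      (∀ ε : ℝ, 0 < ε → {n : ℚ | ε * (p : ℝ) ^ (d * n) ≤ ‖y n‖}.IsPWO) := by
  obtain ⟨c1, hc1, h1⟩ := hx.bound
  obtain ⟨c2, hc2, h2⟩ := hy.bound
  obtain ⟨c3, hc3, h3⟩ := hx.isPWO
  obtain ⟨c4, hc4, h4⟩ := hy.isPWO
  refine ⟨min (min c1 c2) (min c3 c4), by positivity, fun d hd hdc => ?_⟩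
  obtain ⟨⟨e1, e2⟩, e3, e4⟩ : (d ≤ c1 ∧ d ≤ c2) ∧ d ≤ c3 ∧ d ≤ c4 := by simpa using hdc
  obtain ⟨C, hC, hb⟩ := h1 d hd e1
  obtain ⟨C', hC', hb'⟩ := h2 d hd e2
  have hw : ∀ n : ℚ, (0 : ℝ) < (p : ℝ) ^ (d * n) := fun n => Real.rpow_pos_of_pos p_pos _
  exact ⟨max C C', lt_max_of_lt_left hC,
    fun n => (hb n).trans (mul_le_mul_of_nonneg_right (le_max_left _ _) (hw n).le),
    fun n => (hb' n).trans (mul_le_mul_of_nonneg_right (le_max_right _ _) (hw n).le),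
    h3 d hd e3, h4 d hd e4⟩

theorem weight_add (d : ℝ) (i j : ℚ) :
    (p : ℝ) ^ (d * ((i + j : ℚ) : ℝ)) = (p : ℝ) ^ (d * i) * (p : ℝ) ^ (d * j) := by
  rw [← Real.rpow_add p_pos]; push_cast; congr 1; ring

theorem weight_sub (d : ℝ) (n i : ℚ) :
    (p : ℝ) ^ (d * n) = (p : ℝ) ^ (d * i) * (p : ℝ) ^ (d * ((n - i : ℚ) : ℝ)) := by
  rw [← weight_add, add_sub_cancel]

theorem weight_pos (d : ℝ) (i : ℚ) : (0 : ℝ) < (p : ℝ) ^ (d * i) := Real.rpow_pos_of_pos p_pos _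

theorem large_factor {A B u v ε : ℝ} {a b : L} (hA : 0 < A) (hB : 0 < B) (hu : 0 < u) (hv : 0 < v)
    (hx : ‖a‖ ≤ A * u) (hy : ‖b‖ ≤ B * v) (h : ε * (u * v) ≤ ‖a * b‖) :
    ε / B * u ≤ ‖a‖ ∧ ε / A * v ≤ ‖b‖ := by
  rw [norm_mul] at h
  have h1 := h.trans (mul_le_mul_of_nonneg_left hy (norm_nonneg _))
  have h2 := h.trans (mul_le_mul_of_nonneg_right hx (norm_nonneg _))
  constructor
  · rw [div_mul_eq_mul_div, div_le_iff₀ hB]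
    refine le_of_mul_le_mul_right ?_ hv
    linarith
  · rw [div_mul_eq_mul_div, div_le_iff₀ hA]
    refine le_of_mul_le_mul_right ?_ hu
    linarith

theorem finite_large (hx : IsAnCon p x) (hy : IsAnCon p y) (n : ℚ) {ε : ℝ} (hε : 0 < ε) :
    {i : ℚ | ε ≤ ‖x i * y (n - i)‖}.Finite := by
  obtain ⟨c, hc, h⟩ := exists_two hx hy
  obtain ⟨C, hC, b1, b2, w1, w2⟩ := h c hc le_rfl
  have hw : (0 : ℝ) < (p : ℝ) ^ (c * n) := weight_pos c n
  set ε' : ℝ := ε / (p : ℝ) ^ (c * n)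
  have hε' : 0 < ε' / C := by positivity
  refine ((Set.AddAntidiagonal.finite_of_isPWO (w1 _ hε') (w2 _ hε') n).image Prod.fst).subset ?_
  intro i hi
  have hi : ε ≤ ‖x i * y (n - i)‖ := hi
  have := large_factor (ε := ε') hC hC (weight_pos c i) (weight_pos c (n - i)) (b1 i) (b2 (n - i)) (by
    rw [← weight_sub]; simpa [ε', div_mul_cancel₀ _ hw.ne'] using hi)
  exact ⟨(i, n - i), ⟨this.1, this.2, by simp⟩, rfl⟩

theorem finite_large₃ (hx : IsAnCon p x) (hy : IsAnCon p y) (hz : IsAnCon p z) (n : ℚ) {ε : ℝ}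
    (hε : 0 < ε) :
    {q : ℚ × ℚ | ε ≤ ‖x q.1 * y (q.2 - q.1) * z (n - q.2)‖}.Finite := by
  obtain ⟨c1, hc1, h1⟩ := exists_two hx hy
  obtain ⟨c2, hc2, h2⟩ := exists_two hz hz
  set c := min c1 c2
  have hc : 0 < c := lt_min hc1 hc2
  obtain ⟨C, hC, b1, b2, w1, w2⟩ := h1 c hc (min_le_left _ _)
  obtain ⟨D, hD, b3, -, w3, -⟩ := h2 c hc (min_le_right _ _)
  have hw : (0 : ℝ) < (p : ℝ) ^ (c * n) := weight_pos c n
  set ε' : ℝ := ε / (p : ℝ) ^ (c * n)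
  have hA : 0 < ε' / D / C := by positivity
  have hB : 0 < ε' / (C * C) := by positivity
  have hK := Set.AddAntidiagonal.finite_of_isPWO ((w1 _ hA).add (w2 _ hA)) (w3 _ hB) n
  have hI := fun k : ℚ => Set.AddAntidiagonal.finite_of_isPWO (w1 _ hA) (w2 _ hA) k
  refine ((hK.image Prod.fst).biUnion fun k _ =>
    ((hI k).image fun q => ((q.1, k) : ℚ × ℚ))).subset ?_
  rintro ⟨i, k⟩ hi
  have hi : ε ≤ ‖x i * y (k - i) * z (n - k)‖ := hi
  have hik := weight_sub (p := p) c k i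
  have hxy : ‖x i * y (k - i)‖ ≤ C * C * (p : ℝ) ^ (c * k) := by
    rw [norm_mul, hik]
    calc _ ≤ (C * (p : ℝ) ^ (c * i)) * (C * (p : ℝ) ^ (c * ((k - i : ℚ) : ℝ))) :=
          mul_le_mul (b1 _) (b2 _) (norm_nonneg _) (by have := weight_pos (p := p) c i; positivity)
      _ = _ := by ring
  have l1 := large_factor (ε := ε') (mul_pos hC hC) hD (weight_pos c k) (weight_pos c (n - k)) hxy
    (b3 (n - k)) (by
      rw [← weight_sub]; simpa [ε', div_mul_cancel₀ _ hw.ne'] using hi)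
  have l2 := large_factor (ε := ε' / D) hC hC (weight_pos c i) (weight_pos c (k - i)) (b1 i)
    (b2 (k - i)) (by rw [← hik]; exact l1.1)
  refine Set.mem_biUnion (x := k) ⟨(k, n - k), ⟨?_, l1.2, by simp⟩, rfl⟩
    ⟨(i, k - i), ⟨l2.1, l2.2, by simp⟩, rfl⟩
  exact ⟨i, l2.1, k - i, l2.2, by simp⟩

theorem tendsto_cofinite {ι : Type*} {f : ι → L} (h : ∀ ε : ℝ, 0 < ε → {i | ε ≤ ‖f i‖}.Finite) :
    Filter.Tendsto f Filter.cofinite (nhds 0) := by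
  rw [Metric.tendsto_nhds]
  intro ε hε
  simpa [Filter.eventually_cofinite] using h ε hε

theorem zero : IsAnCon p (0 : ℚ → L) :=
  ⟨fun r => by simp [(Real.rpow_pos_of_pos p_pos r).le.not_gt],
    fun _ => ⟨0, by simp⟩, ⟨1, one_pos, by simp [Real.rpow_pos_of_pos p_pos]⟩,
    fun d _ => by simp [Real.rpow_pos_of_pos p_pos]⟩

theorem single (a : L) : IsAnCon p (Pi.single (0 : ℚ) a) := by
  have h0 : ∀ n : ℚ, n ≠ 0 → (Pi.single (0 : ℚ) a : ℚ → L) n = 0 := fun n hn => by simp [hn]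
  refine ⟨fun r => ?_, fun _ => ⟨‖a‖, fun n _ => ?_⟩, ⟨1, one_pos, ?_⟩, fun d _ => ?_⟩
  · refine (Set.finite_singleton (0 : ℚ)).isWF.mono fun n hn => ?_
    by_contra hne
    have hn : (p : ℝ) ^ r < ‖(Pi.single (0 : ℚ) a : ℚ → L) n‖ := hn
    rw [h0 n hne, norm_zero] at hn
    exact (Real.rpow_pos_of_pos p_pos r).not_gt hn
  · by_cases hn : n = 0
    · subst hn; simp
    · rw [h0 n hn]; simp
  · filter_upwards [Filter.eventually_lt_atBot 0] with n hn
    rw [h0 n hn.ne, norm_zero]; exact Real.rpow_pos_of_pos p_pos _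
  · filter_upwards [Filter.eventually_gt_atTop 0] with n hn
    rw [h0 n hn.ne', norm_zero]; exact Real.rpow_pos_of_pos p_pos _

variable [IsUltrametricDist L]

theorem add (hx : IsAnCon p x) (hy : IsAnCon p y) : IsAnCon p (x + y) := by
  have hadd : ∀ n, ‖(x + y) n‖ ≤ max ‖x n‖ ‖y n‖ := fun n =>
    IsUltrametricDist.norm_add_le_max _ _
  have p1 : (1 : ℝ) < p := one_lt
  refine ⟨fun r => ?_, fun j => ?_, ?_, fun d hd => ?_⟩
  · refine (((hx.wo r).isPWO.union (hy.wo r).isPWO).mono fun n hn => ?_).isWF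
    exact lt_max_iff.1 (lt_of_lt_of_le hn (hadd n))
  · obtain ⟨C, hC⟩ := hx.bdd j
    obtain ⟨D, hD⟩ := hy.bdd j
    exact ⟨max C D, fun n hn => (hadd n).trans (max_le_max (hC n hn) (hD n hn))⟩
  · obtain ⟨c, hc, h⟩ := hx.neg
    obtain ⟨c', hc', h'⟩ := hy.neg
    refine ⟨min c c', lt_min hc hc', ?_⟩
    filter_upwards [h, h', Filter.eventually_le_atBot 0] with n h1 h2 hn
    have hn : (n : ℝ) ≤ 0 := by exact_mod_cast hn
    refine (hadd n).trans_lt (max_lt (h1.trans_le ?_) (h2.trans_le ?_)) <;>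
      refine Real.rpow_le_rpow_of_exponent_le p1.le (mul_le_mul_of_nonpos_right ?_ hn)
    exacts [min_le_left _ _, min_le_right _ _]
  · filter_upwards [hx.pos d hd, hy.pos d hd] with n h1 h2
    exact (hadd n).trans_lt (max_lt h1 h2)

theorem conv (hx : IsAnCon p x) (hy : IsAnCon p y) :
    IsAnCon p (fun n => ∑' i, x i * y (n - i)) := by
  obtain ⟨c, hc, h⟩ := exists_two hx hy
  refine of_bound hc hc (fun d hd hdc => ?_) fun ε hε => ?_
  · obtain ⟨C, hC, b1, b2, -, -⟩ := h d hd hdc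
    refine ⟨C * C, mul_pos hC hC, fun n => ?_⟩
    have hn := weight_pos (p := p) d n
    refine IsUltrametricDist.norm_tsum_le_of_forall_le_of_nonneg (by positivity) fun i => ?_
    rw [norm_mul, weight_sub d n i]
    calc _ ≤ (C * (p : ℝ) ^ (d * i)) * (C * (p : ℝ) ^ (d * ((n - i : ℚ) : ℝ))) :=
          mul_le_mul (b1 _) (b2 _) (norm_nonneg _) (by have := weight_pos (p := p) d i; positivity)
      _ = _ := by ring
  · obtain ⟨C, hC, b1, b2, w1, w2⟩ := h c hc le_rfl
    have hA : 0 < ε / 2 / C := by positivity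
    refine ((w1 _ hA).add (w2 _ hA)).mono fun n hn => ?_
    have hn : ε * (p : ℝ) ^ (c * n) ≤ ‖∑' i, x i * y (n - i)‖ := hn
    have hw := weight_pos (p := p) c n
    obtain ⟨i, hi⟩ : ∃ i, ε / 2 * (p : ℝ) ^ (c * n) ≤ ‖x i * y (n - i)‖ := by
      by_contra! hcon
      have := IsUltrametricDist.norm_tsum_le_of_forall_le_of_nonneg (by positivity)
        fun i => (hcon i).le
      nlinarith
    have l := large_factor (ε := ε / 2) hC hC (weight_pos c i) (weight_pos c (n - i)) (b1 i)
      (b2 (n - i)) (by rw [← weight_sub]; exact hi)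
    exact ⟨i, l.1, n - i, l.2, by simp⟩

variable [CompleteSpace L]

theorem summable (hx : IsAnCon p x) (hy : IsAnCon p y) (n : ℚ) :
    Summable fun i => x i * y (n - i) :=
  NonarchimedeanAddGroup.summable_of_tendsto_cofinite_zero
    (tendsto_cofinite fun _ hε => finite_large hx hy n hε)

theorem summable₃ (hx : IsAnCon p x) (hy : IsAnCon p y) (hz : IsAnCon p z) (n : ℚ) :
    Summable fun q : ℚ × ℚ => x q.1 * y (q.2 - q.1) * z (n - q.2) :=
  NonarchimedeanAddGroup.summable_of_tendsto_cofinite_zero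
    (tendsto_cofinite fun _ hε => finite_large₃ hx hy hz n hε)

end
end IsAnCon

/-- The generalized power series `∑ x_n t^n` that satisfy the conditions `IsAnCon`; they form a ring
under the convolution product. -/
@[ext]
structure ImmAnCon (p : ℕ) (L : Type*) [NormedField L] where
  coeff : ℚ → L
  isAnCon : IsAnCon p coeff

namespace ImmAnCon

section
variable {p : ℕ} [Fact p.Prime] {L : Type*} [NormedField L]

instance : Zero (ImmAnCon p L) := ⟨⟨0, .zero⟩⟩
instance : One (ImmAnCon p L) := ⟨⟨Pi.single 0 1, .single 1⟩⟩
instance : Neg (ImmAnCon p L) := ⟨fun x => ⟨-x.coeff, x.isAnCon.neg'⟩⟩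

theorem coeff_neg (x : ImmAnCon p L) (n : ℚ) : (-x).coeff n = - x.coeff n := rfl
theorem coeff_zero (n : ℚ) : (0 : ImmAnCon p L).coeff n = 0 := rfl
theorem coeff_one (n : ℚ) : (1 : ImmAnCon p L).coeff n = (Pi.single (0 : ℚ) 1 : ℚ → L) n := rfl

theorem frob_isAnCon (s : L ≃+* L) (hs : ∀ a, ‖s a‖ = ‖a‖) (x : ImmAnCon p L) :
    IsAnCon p fun n => s (x.coeff (n / p)) := by
  have p0 : (0 : ℚ) < p := by exact_mod_cast (Fact.out : p.Prime).pos
  have p0' : (0 : ℝ) < p := by exact_mod_cast p0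
  have h := x.isAnCon
  refine ⟨fun r => ?_, fun j => ?_, ?_, fun d hd => ?_⟩
  · simp only [hs]
    refine (((h.wo r).isPWO.image_of_monotone
      (f := fun n : ℚ => n * p) fun a b hab => mul_le_mul_of_nonneg_right hab p0.le).mono
      fun n hn => ⟨n / p, hn, by field_simp⟩).isWF
  · obtain ⟨C, hC⟩ := h.bdd (j / p)
    exact ⟨C, fun n hn => by rw [hs]; exact hC _ (div_lt_div_of_pos_right hn p0)⟩
  · obtain ⟨c, hc, hn⟩ := h.neg
    refine ⟨c / p, by positivity, ?_⟩
    have : Filter.Tendsto (fun n : ℚ => n / p) Filter.atBot Filter.atBot :=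
      Filter.tendsto_id.atBot_div_const p0
    filter_upwards [this.eventually hn] with n hn
    rw [hs]; refine hn.trans_le (le_of_eq ?_); congr 1; push_cast; ring
  · have : Filter.Tendsto (fun n : ℚ => n / p) Filter.atTop Filter.atTop :=
      Filter.tendsto_id.atTop_div_const p0
    filter_upwards [this.eventually (h.pos (d * p) (by positivity))] with n hn
    rw [hs]; refine hn.trans_le (le_of_eq ?_); congr 1; push_cast; field_simp

variable [IsUltrametricDist L]

instance : Add (ImmAnCon p L) := ⟨fun x y => ⟨x.coeff + y.coeff, x.isAnCon.add y.isAnCon⟩⟩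
noncomputable instance : Mul (ImmAnCon p L) :=
  ⟨fun x y => ⟨fun n => ∑' i : ℚ, x.coeff i * y.coeff (n - i), x.isAnCon.conv y.isAnCon⟩⟩

theorem coeff_mul (x y : ImmAnCon p L) (n : ℚ) :
    (x * y).coeff n = ∑' i : ℚ, x.coeff i * y.coeff (n - i) := rfl
theorem coeff_add (x y : ImmAnCon p L) (n : ℚ) :
    (x + y).coeff n = x.coeff n + y.coeff n := rfl

theorem mul_comm' (x y : ImmAnCon p L) : x * y = y * x := by
  ext n
  rw [coeff_mul, coeff_mul, ← (Equiv.subLeft n).tsum_eq]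
  exact tsum_congr fun i => by simp [mul_comm]

theorem one_mul' (x : ImmAnCon p L) : 1 * x = x := by
  ext n
  rw [coeff_mul, tsum_eq_single 0 fun i hi => by simp [coeff_one, hi]]
  simp [coeff_one]

variable [CompleteSpace L]

theorem add_mul' (x y z : ImmAnCon p L) : (x + y) * z = x * z + y * z := by
  ext n
  simp only [coeff_mul, coeff_add, add_mul]
  exact (x.isAnCon.summable z.isAnCon n).tsum_add (y.isAnCon.summable z.isAnCon n)

theorem mul_assoc' (x y z : ImmAnCon p L) : x * y * z = x * (y * z) := by
  ext n
  simp only [coeff_mul]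
  have h1 : ∀ k, (∑' i, x.coeff i * y.coeff (k - i)) * z.coeff (n - k) =
      ∑' i, x.coeff i * y.coeff (k - i) * z.coeff (n - k) := fun k => tsum_mul_right.symm
  have h2 : ∀ i, x.coeff i * ∑' j, y.coeff j * z.coeff (n - i - j) =
      ∑' k, x.coeff i * y.coeff (k - i) * z.coeff (n - k) := fun i => by
    rw [← tsum_mul_left, ← (Equiv.subRight i).tsum_eq]
    exact tsum_congr fun k => by simp [mul_assoc]
  simp only [h1, h2]
  exact Summable.tsum_comm (f := fun i k => x.coeff i * y.coeff (k - i) * z.coeff (n - k))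
    (IsAnCon.summable₃ x.isAnCon y.isAnCon z.isAnCon n)

noncomputable instance : CommRing (ImmAnCon p L) where
  add_assoc x y z := by ext n; simp [coeff_add, add_assoc]
  zero_add x := by ext n; simp [coeff_add, coeff_zero]
  add_zero x := by ext n; simp [coeff_add, coeff_zero]
  add_comm x y := by ext n; simp [coeff_add, add_comm]
  neg_add_cancel x := by ext n; simp [coeff_add, coeff_zero, coeff_neg]
  zero_mul x := by ext n; simp [coeff_mul, coeff_zero]
  mul_zero x := by ext n; simp [coeff_mul, coeff_zero]
  mul_assoc := mul_assoc'
  one_mul := one_mul'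
  mul_one x := by rw [mul_comm', one_mul']
  mul_comm := mul_comm'
  right_distrib := add_mul'
  left_distrib x y z := by rw [mul_comm', add_mul', mul_comm' y, mul_comm' z]
  nsmul := nsmulRec
  zsmul := zsmulRec

/-- The constant series, concentrated at the exponent `0`. -/
noncomputable def const : L →+* ImmAnCon p L where
  toFun a := ⟨Pi.single 0 a, .single a⟩
  map_one' := rfl
  map_zero' := by ext n; simp [coeff_zero]
  map_add' a b := by ext n; simp [coeff_add, Pi.single_add]
  map_mul' a b := by
    ext n
    rw [coeff_mul, tsum_eq_single 0 fun i hi => by simp [hi]]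
    by_cases hn : n = 0
    · subst hn; simp
    · simp [hn]

theorem coeff_const_mul (a : L) (x : ImmAnCon p L) (n : ℚ) :
    (const a * x).coeff n = a * x.coeff n := by
  rw [coeff_mul, tsum_eq_single 0 fun i hi => by simp [const, hi]]
  simp [const]

/-- The Frobenius `∑ x_n t^n ↦ ∑ s(x_n) t^(p n)` attached to an isometric automorphism `s` of the
field of coefficients. -/
noncomputable def frob (s : L ≃+* L) (hs : ∀ a, ‖s a‖ = ‖a‖) : ImmAnCon p L →+* ImmAnCon p L where
  toFun x := ⟨fun n => s (x.coeff (n / p)), frob_isAnCon s hs x⟩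
  map_zero' := by ext n; simp [coeff_zero]
  map_add' x y := by ext n; simp [coeff_add]
  map_one' := by
    have p0 : (p : ℚ) ≠ 0 := by exact_mod_cast (Fact.out : p.Prime).ne_zero
    ext n
    by_cases hn : n = 0
    · subst hn; simp [coeff_one]
    · have : n / p ≠ 0 := div_ne_zero hn p0
      simp [coeff_one, hn, this]
  map_mul' x y := by
    have p0 : (p : ℚ) ≠ 0 := by exact_mod_cast (Fact.out : p.Prime).ne_zero
    ext n
    have hcont : Continuous s := by
      have : Isometry s := AddMonoidHomClass.isometry_of_norm s hs
      exact this.continuous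
    simp only [coeff_mul]
    rw [(x.isAnCon.summable y.isAnCon (n / p)).map_tsum s hcont,
      ← (Equiv.divRight₀ (p : ℚ) p0).tsum_eq]
    exact tsum_congr fun i => by simp [sub_div]

end
end ImmAnCon

section
variable (p : ℕ) [Fact p.Prime] (k : Type*) [Field k] [IsAlgClosed k] [CharP k p]
  (O : Type*) [CommRing O] [IsDomain O] [IsDiscreteValuationRing O]
  [Algebra (WittVector p k) O] [Module.Finite (WittVector p k) O] [FaithfulSMul (WittVector p k) O]

theorem natCast_prime_mem (p : ℕ) [Fact p.Prime] (k : Type*) [Field k] [IsAlgClosed k] [CharP k p]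
    (O : Type*) [CommRing O] [IsLocalRing O] [Algebra (WittVector p k) O]
    [Module.Finite (WittVector p k) O] [FaithfulSMul (WittVector p k) O] :
    (p : O) ∈ IsLocalRing.maximalIdeal O := by
  rw [IsLocalRing.mem_maximalIdeal, mem_nonunits_iff]
  intro h
  have h1 : IsUnit (algebraMap (WittVector p k) O p) := by simpa using h
  have : Algebra.IsIntegral (WittVector p k) O := Algebra.IsIntegral.of_finite _ _
  have : IsLocalHom (algebraMap (WittVector p k) O) :=
    (algebraMap_isIntegral_iff.2 this).isLocalHom (FaithfulSMul.algebraMap_injective _ _)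
  exact (WittVector.irreducible p (k := k)).not_isUnit (isUnit_of_map_unit _ _ h1)

theorem natCast_prime_ne_zero (p : ℕ) [Fact p.Prime] (k : Type*) [Field k] [IsAlgClosed k]
    [CharP k p] (O : Type*) [CommRing O] [Algebra (WittVector p k) O]
    [FaithfulSMul (WittVector p k) O] : (p : O) ≠ 0 := by
  have := (FaithfulSMul.algebraMap_injective (WittVector p k) O).ne
    (WittVector.irreducible p (k := k)).ne_zero
  simpa using this

/-- The absolute ramification index of `O`. -/
noncomputable def ramIdx (p : ℕ) (O : Type*) [CommRing O] [IsDomain O]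
    [IsDiscreteValuationRing O] : ℕ :=
  (IsDiscreteValuationRing.addVal O (p : O)).toNat

theorem ramIdx_spec {p : ℕ} {O : Type*} [CommRing O] [IsDomain O]
    [IsDiscreteValuationRing O] (h0 : (p : O) ≠ 0) :
    ∃ (u : Oˣ) (ϖ : O), Irreducible ϖ ∧ (p : O) = u * ϖ ^ ramIdx p O := by
  obtain ⟨ϖ, hϖ⟩ := IsDiscreteValuationRing.exists_irreducible O
  obtain ⟨n, u, hu⟩ := IsDiscreteValuationRing.eq_unit_mul_pow_irreducible h0 hϖ
  refine ⟨u, ϖ, hϖ, ?_⟩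
  rw [ramIdx, IsDiscreteValuationRing.addVal_def _ u hϖ n hu]
  exact hu

theorem ramIdx_ne_zero (p : ℕ) [Fact p.Prime] (k : Type*) [Field k] [IsAlgClosed k] [CharP k p]
    (O : Type*) [CommRing O] [IsDomain O] [IsDiscreteValuationRing O] [Algebra (WittVector p k) O]
    [Module.Finite (WittVector p k) O] [FaithfulSMul (WittVector p k) O] :
    ramIdx p O ≠ 0 := by
  intro h
  obtain ⟨u, ϖ, -, hu⟩ := ramIdx_spec (natCast_prime_ne_zero p k O)
  rw [h, pow_zero, mul_one] at hu
  have := natCast_prime_mem p k O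
  rw [IsLocalRing.mem_maximalIdeal, mem_nonunits_iff] at this
  exact this (hu ▸ u.isUnit)

/-- The inverse `p^(1/e)` of the absolute value of a uniformizer of `O`, where `e` is the absolute
ramification index. -/
noncomputable def absBase (p : ℕ) (O : Type*) [CommRing O] [IsDomain O]
    [IsDiscreteValuationRing O] : NNReal := (p : NNReal) ^ (1 / ramIdx p O : ℝ)

theorem one_lt_absBase (p : ℕ) [Fact p.Prime] (k : Type*) [Field k] [IsAlgClosed k] [CharP k p]
    (O : Type*) [CommRing O] [IsDomain O] [IsDiscreteValuationRing O] [Algebra (WittVector p k) O]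
    [Module.Finite (WittVector p k) O] [FaithfulSMul (WittVector p k) O] :
    1 < absBase p O := by
  have := (Fact.out : p.Prime).one_lt
  have h2 := ramIdx_ne_zero p k O
  exact NNReal.one_lt_rpow (by exact_mod_cast this)
    (by have : 0 < ramIdx p O := Nat.pos_of_ne_zero h2
        positivity)

/-- The field `O[1/p]`, which is the fraction field of `O`; it carries the absolute value of `O`
normalized by `|p| = p⁻¹`. (`p` and `k` are arguments because the absolute value depends on
them.) -/
def CoeffField (_p : ℕ) (_k : Type*) (O : Type*) [CommRing O] : Type _ := FractionRing O

noncomputable instance : Field (CoeffField p k O) := inferInstanceAs (Field (FractionRing O))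
noncomputable instance : Algebra O (CoeffField p k O) :=
  inferInstanceAs (Algebra O (FractionRing O))
instance : IsFractionRing O (CoeffField p k O) :=
  inferInstanceAs (IsFractionRing O (FractionRing O))

noncomputable instance : NormedField (CoeffField p k O) :=
  ((IsDiscreteValuationRing.maximalIdeal O).adicAbv (K := CoeffField p k O)
    (one_lt_absBase p k O)).toNormedField

namespace CoeffField

theorem norm_def (x : CoeffField p k O) : ‖x‖ =
    (IsDiscreteValuationRing.maximalIdeal O).adicAbv (K := CoeffField p k O)
      (one_lt_absBase p k O) x := rfl

instance : IsUltrametricDist (CoeffField p k O) :=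
  IsUltrametricDist.isUltrametricDist_of_forall_norm_add_le_max_norm
    ((IsDiscreteValuationRing.maximalIdeal O).isNonarchimedean_adicAbv (one_lt_absBase p k O))

variable {p k O}

theorem norm_coe_le_one (a : O) : ‖algebraMap O (CoeffField p k O) a‖ ≤ 1 :=
  (IsDiscreteValuationRing.maximalIdeal O).adicAbv_coe_le_one _ a

theorem norm_coe_eq_one_iff (a : O) : ‖algebraMap O (CoeffField p k O) a‖ = 1 ↔ IsUnit a := by
  rw [← not_iff_not, ← mem_nonunits_iff, ← IsLocalRing.mem_maximalIdeal]
  rw [norm_def, IsDedekindDomain.HeightOneSpectrum.adicAbv_coe_eq_one_iff, not_not]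
  rfl

variable (p k O) in
theorem norm_natCast_prime : ‖(p : CoeffField p k O)‖ = (p : ℝ)⁻¹ := by
  obtain ⟨u, ϖ, hϖ, hp⟩ := ramIdx_spec (natCast_prime_ne_zero p k O)
  have h1 : ‖algebraMap O (CoeffField p k O) u‖ = 1 := (norm_coe_eq_one_iff _).2 u.isUnit
  have h2 : ‖algebraMap O (CoeffField p k O) ϖ‖ = (absBase p O : ℝ)⁻¹ := by
    have := IsDedekindDomain.HeightOneSpectrum.intValuation_singleton
      (IsDiscreteValuationRing.maximalIdeal O) hϖ.ne_zero hϖ.maximalIdeal_eq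
    rw [norm_def, IsDedekindDomain.HeightOneSpectrum.adicAbv_of_algebraMap]
    change ((WithZeroMulInt.toNNReal (ne_zero_of_lt (one_lt_absBase p k O)) _ : NNReal) : ℝ) = _
    rw [this, WithZeroMulInt.toNNReal_neg_apply _ WithZero.exp_ne_zero]
    change (((absBase p O) ^ (-1 : ℤ) : NNReal) : ℝ) = _
    simp
  have h3 : (absBase p O : ℝ) ^ ramIdx p O = p := by
    rw [absBase, NNReal.coe_rpow, ← Real.rpow_natCast, ← Real.rpow_mul (by positivity),
      one_div_mul_cancel (by exact_mod_cast ramIdx_ne_zero p k O)]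
    simp
  rw [← map_natCast (algebraMap O (CoeffField p k O)), hp, map_mul, map_pow, norm_mul, norm_pow,
    h1, h2, one_mul, inv_pow, h3]

theorem norm_le_one_iff (x : CoeffField p k O) :
    ‖x‖ ≤ 1 ↔ ∃ a : O, algebraMap O (CoeffField p k O) a = x := by
  constructor
  · intro h
    rcases (ValuationRing.isInteger_or_isInteger O x) with h1 | ⟨a, ha⟩
    · exact h1
    · by_cases hx : x = 0
      · exact ⟨0, by simp [hx]⟩
      have h2 : ‖x‖⁻¹ ≤ 1 := by rw [← norm_inv, ← ha]; exact norm_coe_le_one a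
      have h3 : ‖algebraMap O (CoeffField p k O) a‖ = 1 := by
        rw [ha, norm_inv]
        exact le_antisymm h2 ((one_le_inv₀ (norm_pos_iff.2 hx)).2 h)
      obtain ⟨u, rfl⟩ := (norm_coe_eq_one_iff a).1 h3
      refine ⟨(u⁻¹ : Oˣ), ?_⟩
      rw [← inv_inv x, ← ha]
      exact eq_inv_of_mul_eq_one_left (by rw [← map_mul]; simp)
  · rintro ⟨a, rfl⟩
    exact norm_coe_le_one a

/-- The extension to `O[1/p]` of an automorphism of `O`. -/
noncomputable def extAut (s : O ≃+* O) : CoeffField p k O ≃+* CoeffField p k O :=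
  IsFractionRing.ringEquivOfRingEquiv s

theorem extAut_algebraMap (s : O ≃+* O) (a : O) :
    extAut (p := p) (k := k) s (algebraMap O _ a) = algebraMap O _ (s a) :=
  IsFractionRing.ringEquivOfRingEquiv_algebraMap s a

theorem norm_ext_coe (s : O ≃+* O) (a : O) : ‖algebraMap O (CoeffField p k O) (s a)‖ =
    ‖algebraMap O (CoeffField p k O) a‖ := by
  by_cases ha : a = 0
  · simp [ha]
  obtain ⟨ϖ, hϖ⟩ := IsDiscreteValuationRing.exists_irreducible O
  obtain ⟨n, u, rfl⟩ := IsDiscreteValuationRing.eq_unit_mul_pow_irreducible ha hϖ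
  have h1 : Associated (s ϖ) ϖ := IsDiscreteValuationRing.associated_of_irreducible O
    ((MulEquiv.irreducible_iff s).2 hϖ) hϖ
  obtain ⟨v, hv⟩ := h1
  have hu : ∀ w : O, IsUnit w → ‖algebraMap O (CoeffField p k O) w‖ = 1 := fun w hw =>
    (norm_coe_eq_one_iff w).2 hw
  rw [map_mul, map_pow, map_mul, map_mul, norm_mul, norm_mul, hu _ u.isUnit,
    hu _ (u.isUnit.map s), map_pow, map_pow, norm_pow, norm_pow]
  nth_rewrite 2 [← hv]
  rw [map_mul, norm_mul, hu _ v.isUnit, mul_one]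

theorem norm_extAut (s : O ≃+* O) (x : CoeffField p k O) : ‖extAut s x‖ = ‖x‖ := by
  obtain ⟨a, b, hb, rfl⟩ := IsFractionRing.div_surjective (A := O) x
  rw [map_div₀, extAut_algebraMap, extAut_algebraMap, norm_div, norm_div, norm_ext_coe, norm_ext_coe]

end CoeffField
end

section
theorem exists_limit_of_dvd (p : ℕ) [Fact p.Prime] (k : Type*) [Field k] [IsAlgClosed k] [CharP k p]
    (O : Type*) [CommRing O] [IsDomain O] [Algebra (WittVector p k) O]
    [Module.Finite (WittVector p k) O] [FaithfulSMul (WittVector p k) O]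
    (a : ℕ → O) (h : ∀ m n, m ≤ n → (p : O) ^ m ∣ a n - a m) :
    ∃ l : O, ∀ n, (p : O) ^ n ∣ l - a n := by
  have : Module.Free (WittVector p k) O := inferInstance
  set b := Module.Free.chooseBasis (WittVector p k) O
  have hp : ∀ (x : O) (n : ℕ), (p : O) ^ n ∣ x ↔ ∀ i, (p : WittVector p k) ^ n ∣ b.repr x i := by
    intro x n
    have hs : ∀ y : O, (p : O) ^ n * y = (p : WittVector p k) ^ n • y := fun y => by
      rw [Algebra.smul_def]; simp
    constructor
    · rintro ⟨y, rfl⟩ i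
      rw [hs]; simp
    · intro h
      choose c hc using h
      refine ⟨∑ i, c i • b i, ?_⟩
      rw [hs]
      conv_lhs => rw [← b.sum_repr x]
      rw [Finset.smul_sum]
      exact Finset.sum_congr rfl fun i _ => by rw [hc i, mul_smul]
  have hW : ∀ i, ∃ l : WittVector p k, ∀ n, (p : WittVector p k) ^ n ∣ l - b.repr (a n) i := by
    intro i
    have hmod : ∀ (x y : WittVector p k) (n : ℕ), x ≡ y [SMOD
        (Ideal.span {(p : WittVector p k)} ^ n • ⊤ : Submodule (WittVector p k) (WittVector p k))] ↔
        (p : WittVector p k) ^ n ∣ x - y := fun x y n => by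
      rw [SModEq.sub_mem, smul_eq_mul, Ideal.mul_top, Ideal.span_singleton_pow,
        Ideal.mem_span_singleton]
    obtain ⟨l, hl⟩ := (inferInstance : IsPrecomplete (Ideal.span {(p : WittVector p k)})
      (WittVector p k)).prec (f := fun n => b.repr (a n) i) (fun {m n} hmn => by
        rw [hmod, ← dvd_neg, neg_sub]
        have := (hp _ _).1 (h m n hmn) i
        simpa using this)
    refine ⟨l, fun n => ?_⟩
    have := (hmod _ _ _).1 (hl n)
    rw [← dvd_neg, neg_sub]; exact this
  choose l hl using hW
  refine ⟨∑ i, l i • b i, fun n => (hp _ _).2 fun i => ?_⟩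
  have := hl i n
  rw [map_sub, Finsupp.sub_apply]
  rw [congrFun (b.repr_sum_self fun i => l i) i]
  exact this

end

section
variable (p : ℕ) [Fact p.Prime] (k : Type*) [Field k] [IsAlgClosed k] [CharP k p]
  (O : Type*) [CommRing O] [IsDomain O] [IsDiscreteValuationRing O]
  [Algebra (WittVector p k) O] [Module.Finite (WittVector p k) O] [FaithfulSMul (WittVector p k) O]

theorem CoeffField.norm_le_pow_iff (a : O) (n : ℕ) :
    ‖algebraMap O (CoeffField p k O) a‖ ≤ ((p : ℝ)⁻¹) ^ n ↔ (p : O) ^ n ∣ a := by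
  have hp : (p : CoeffField p k O) ≠ 0 := by
    have := (IsFractionRing.injective O (CoeffField p k O)).ne (natCast_prime_ne_zero p k O)
    simpa using this
  have hn : ‖(p : CoeffField p k O) ^ n‖ = ((p : ℝ)⁻¹) ^ n := by
    rw [norm_pow, norm_natCast_prime]
  have h0 : (0 : ℝ) < ‖(p : CoeffField p k O) ^ n‖ := norm_pos_iff.2 (pow_ne_zero _ hp)
  rw [← hn]
  constructor
  · intro h
    obtain ⟨c, hc⟩ := (norm_le_one_iff (algebraMap O (CoeffField p k O) a / (p : CoeffField p k O) ^ n)).1 (by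
      rw [norm_div]; exact (div_le_one h0).2 h)
    refine ⟨c, IsFractionRing.injective O (CoeffField p k O) ?_⟩
    rw [map_mul, hc]; simp; field_simp
  · rintro ⟨c, rfl⟩
    rw [map_mul, norm_mul]
    simp only [map_pow, map_natCast]
    exact mul_le_of_le_one_right (norm_nonneg _) (norm_coe_le_one c)

instance : CompleteSpace (CoeffField p k O) := by
  have p1 : (1 : ℝ) < p := by exact_mod_cast (Fact.out : p.Prime).one_lt
  have hB : ∀ n : ℕ, (0 : ℝ) < ((p : ℝ)⁻¹) ^ n := fun n => by positivity
  refine Metric.complete_of_convergent_controlled_sequences (fun n => ((p : ℝ)⁻¹) ^ n) hB ?_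
  intro u hu
  have h0 : ∀ n, ∃ a : O, algebraMap O (CoeffField p k O) a = u n - u 0 := fun n => by
    refine (CoeffField.norm_le_one_iff _).1 ?_
    have := hu 0 n 0 n.zero_le le_rfl
    rw [dist_eq_norm] at this
    simpa using this.le
  choose a ha using h0
  obtain ⟨l, hl⟩ := exists_limit_of_dvd p k O a fun m n hmn => by
    rw [← CoeffField.norm_le_pow_iff p k O, map_sub, ha, ha, sub_sub_sub_cancel_right,
      ← dist_eq_norm]
    exact (hu m n m hmn le_rfl).le
  refine ⟨algebraMap O _ l + u 0, ?_⟩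
  rw [tendsto_iff_norm_sub_tendsto_zero]
  have hlim : Filter.Tendsto (fun n : ℕ => ((p : ℝ)⁻¹) ^ n) Filter.atTop (nhds 0) :=
    tendsto_pow_atTop_nhds_zero_of_lt_one (by positivity) (inv_lt_one_of_one_lt₀ p1)
  refine squeeze_zero (fun _ => norm_nonneg _) (fun n => ?_) hlim
  have := (CoeffField.norm_le_pow_iff p k O _ n).2 (hl n)
  rw [map_sub, ha, ← norm_neg] at this
  convert! this using 2
  ring

end

section
variable (p : ℕ) [Fact p.Prime] (k : Type*) [Field k] [IsAlgClosed k] [CharP k p]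
  (O : Type*) [CommRing O] [IsDomain O] [IsDiscreteValuationRing O]
  [Algebra (WittVector p k) O] [Module.Finite (WittVector p k) O] [FaithfulSMul (WittVector p k) O]

/-- The ring `Γ^imm_{an,con}` of generalized power series over `O[1/p]`. -/
abbrev GammaImmAnCon : Type _ := ImmAnCon p (CoeffField p k O)

/-- The constant series with coefficients in `O`. -/
noncomputable def immConst : O →+* GammaImmAnCon p k O :=
  ImmAnCon.const.comp (algebraMap O (CoeffField p k O))

variable {p k O}

/-- The Frobenius `∑ x_i t^i ↦ ∑ σ(x_i) t^(p i)` on `Γ^imm_{an,con}`. -/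
noncomputable def immFrob (σ : O ≃+* O) : GammaImmAnCon p k O →+* GammaImmAnCon p k O :=
  ImmAnCon.frob (CoeffField.extAut σ) (CoeffField.norm_extAut σ)

/-- `K = κ((t))` as a subfield of `K^imm = κ((t^ℚ))`, where `κ` is the residue field of `O`
(which is `k`, because `k` is algebraically closed). -/
noncomputable def laurentToHahn (κ : Type*) [Field κ] : LaurentSeries κ →+* HahnSeries ℚ κ :=
  HahnSeries.embDomainRingHom (Int.castAddHom ℚ) Int.cast_injective fun _ _ => Int.cast_le

/-- `x` has all its coefficients in `O`, and its reduction modulo the maximal ideal is the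
generalized power series `f`. -/
def IsReduction (x : GammaImmAnCon p k O) (f : HahnSeries ℚ (IsLocalRing.ResidueField O)) : Prop :=
  ∀ i : ℚ, ∃ a : O, algebraMap O (CoeffField p k O) a = x.coeff i ∧
    IsLocalRing.residue O a = f.coeff i

/-- The Teichmüller lifts in `Γ^imm` of the elements of `K^alg`, the algebraic closure of `K` in
`K^imm`. The Teichmüller lift of `f` is the only lift of `f` on which the Frobenius acts as
the `p`-th power map; its exponents are bounded below, so it lies in `Γ^imm_con`. -/
def teichmullerAlg (σ : O ≃+* O) : Set (GammaImmAnCon p k O) :=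
  {y | immFrob σ y = y ^ p ∧ ∃ f : HahnSeries ℚ (IsLocalRing.ResidueField O),
    IsReduction y f ∧ (laurentToHahn (IsLocalRing.ResidueField O)).IsIntegralElem f}

/-- The subring generated by `O` and by the Teichmüller lifts of the elements of `K^alg`. It is a
`p`-adically dense subring of `Γ^alg`. -/
noncomputable def algDense (σ : O ≃+* O) : Subring (GammaImmAnCon p k O) :=
  Subring.closure (Set.range (immConst p k O) ∪ teichmullerAlg σ)

theorem immFrob_mem_algDense (σ : O ≃+* O) {x : GammaImmAnCon p k O} (hx : x ∈ algDense σ) :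
    immFrob σ x ∈ algDense σ := by
  suffices h : algDense σ ≤ (algDense σ).comap (immFrob (p := p) (k := k) σ) from h hx
  refine (Subring.closure_le).2 ?_
  rintro _ (⟨a, rfl⟩ | hy)
  · refine Subring.subset_closure (Or.inl ⟨σ a, ?_⟩)
    ext n
    have p0 : (p : ℚ) ≠ 0 := by exact_mod_cast (Fact.out : p.Prime).ne_zero
    change (Pi.single (0 : ℚ) (algebraMap O (CoeffField p k O) (σ a)) : ℚ → CoeffField p k O) n =
      CoeffField.extAut σ ((Pi.single (0 : ℚ) (algebraMap O (CoeffField p k O) a) :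
        ℚ → CoeffField p k O) (n / p))
    by_cases hn : n = 0
    · subst hn; simp [CoeffField.extAut_algebraMap]
    · have : n / p ≠ 0 := div_ne_zero hn p0
      simp [hn, this]
  · change immFrob σ _ ∈ algDense σ
    rw [hy.1]
    have h : _ ∈ algDense (p := p) (k := k) σ :=
      Subring.subset_closure (Set.mem_union_right _ hy)
    exact pow_mem h p

theorem norm_coeff_mul_le {L : Type*} [NormedField L] [IsUltrametricDist L] {C D : ℝ}
    {x y : ImmAnCon p L} (hC : 0 ≤ C) (hD : 0 ≤ D) (hx : ∀ i, ‖x.coeff i‖ ≤ C)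
    (hy : ∀ i, ‖y.coeff i‖ ≤ D) (n : ℚ) : ‖(x * y).coeff n‖ ≤ C * D :=
  IsUltrametricDist.norm_tsum_le_of_forall_le_of_nonneg (mul_nonneg hC hD) fun i => by
    rw [norm_mul]; exact mul_le_mul (hx _) (hy _) (norm_nonneg _) hC

/-- `Γ^alg_con = Γ^alg ∩ Γ^imm_con`: the series with coefficients in `O` that belong to the
`p`-adic closure `Γ^alg` of the subring generated by `O` and by the Teichmüller lifts of the
elements of `K^alg`. -/
noncomputable def algCon (σ : O ≃+* O) : Subring (GammaImmAnCon p k O) where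
  carrier := {x | (∀ i, ‖x.coeff i‖ ≤ 1) ∧
    ∀ N : ℕ, ∃ z ∈ algDense σ, ∀ i, ‖(x - z).coeff i‖ ≤ ((p : ℝ)⁻¹) ^ N}
  zero_mem' := ⟨fun i => by simp [ImmAnCon.coeff_zero],
    fun N => ⟨0, zero_mem _, fun i => by simp [ImmAnCon.coeff_zero]⟩⟩
  one_mem' := ⟨fun i => by
      rw [ImmAnCon.coeff_one]
      by_cases hi : i = 0
      · subst hi; simp
      · simp [hi],
    fun N => ⟨1, one_mem _, fun i => by simp [ImmAnCon.coeff_zero]⟩⟩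
  neg_mem' := by
    rintro x ⟨hx, h⟩
    refine ⟨fun i => by simpa [ImmAnCon.coeff_neg] using hx i, fun N => ?_⟩
    obtain ⟨z, hz, hzx⟩ := h N
    refine ⟨-z, neg_mem hz, fun i => ?_⟩
    have : -x - -z = -(x - z) := by ring
    rw [this, ImmAnCon.coeff_neg, norm_neg]
    exact hzx i
  add_mem' := by
    rintro x y ⟨hx, h⟩ ⟨hy, h'⟩
    refine ⟨fun i => (IsUltrametricDist.norm_add_le_max _ _).trans (max_le (hx i) (hy i)),
      fun N => ?_⟩
    obtain ⟨z, hz, hzx⟩ := h N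
    obtain ⟨w, hw, hwy⟩ := h' N
    refine ⟨z + w, add_mem hz hw, fun i => ?_⟩
    have : x + y - (z + w) = (x - z) + (y - w) := by ring
    rw [this]
    exact (IsUltrametricDist.norm_add_le_max _ _).trans (max_le (hzx i) (hwy i))
  mul_mem' := by
    rintro x y ⟨hx, h⟩ ⟨hy, h'⟩
    refine ⟨fun i => by simpa using norm_coeff_mul_le zero_le_one zero_le_one hx hy i,
      fun N => ?_⟩
    obtain ⟨z, hz, hzx⟩ := h N
    obtain ⟨w, hw, hwy⟩ := h' N
    have p1 : ((p : ℝ)⁻¹) ^ N ≤ 1 := by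
      refine pow_le_one₀ (by positivity) (inv_le_one_of_one_le₀ ?_)
      exact_mod_cast (Fact.out : p.Prime).one_lt.le
    have hz1 : ∀ i, ‖z.coeff i‖ ≤ 1 := fun i => by
      have : z = x + -(x - z) := by ring
      rw [this, ImmAnCon.coeff_add, ImmAnCon.coeff_neg]
      refine (IsUltrametricDist.norm_add_le_max _ _).trans (max_le (hx i) ?_)
      rw [norm_neg]; exact (hzx i).trans p1
    refine ⟨z * w, mul_mem hz hw, fun i => ?_⟩
    have : x * y - z * w = (x - z) * y + z * (y - w) := by ring
    rw [this]
    refine (IsUltrametricDist.norm_add_le_max _ _).trans (max_le ?_ ?_)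
    · simpa using norm_coeff_mul_le (by positivity) zero_le_one hzx hy i
    · simpa using norm_coeff_mul_le zero_le_one (by positivity) hz1 hwy i

theorem immFrob_mem_algCon (σ : O ≃+* O) {x : GammaImmAnCon p k O} (hx : x ∈ algCon σ) :
    immFrob σ x ∈ algCon σ := by
  have hn : ∀ (y : GammaImmAnCon p k O) (i : ℚ), ‖(immFrob σ y).coeff i‖ = ‖y.coeff (i / p)‖ :=
    fun y i => CoeffField.norm_extAut σ _
  refine ⟨fun i => by rw [hn]; exact hx.1 _, fun N => ?_⟩
  obtain ⟨z, hz, hzx⟩ := hx.2 N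
  refine ⟨immFrob σ z, immFrob_mem_algDense σ hz, fun i => ?_⟩
  rw [← map_sub, hn]
  exact hzx _

/-- `Γ^alg_con[1/p]`. -/
noncomputable def algConInv (σ : O ≃+* O) : Subring (GammaImmAnCon p k O) where
  carrier := {x | ∃ n : ℕ, (p : GammaImmAnCon p k O) ^ n * x ∈ algCon σ}
  zero_mem' := ⟨0, by simp⟩
  one_mem' := ⟨0, by simp⟩
  neg_mem' := by
    rintro x ⟨n, hn⟩
    exact ⟨n, by rw [mul_neg]; exact neg_mem hn⟩
  add_mem' := by
    rintro x y ⟨n, hn⟩ ⟨m, hm⟩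
    have hp := natCast_mem (algCon (p := p) (k := k) σ) p
    refine ⟨n + m, ?_⟩
    have : (p : GammaImmAnCon p k O) ^ (n + m) * (x + y) =
        (p : GammaImmAnCon p k O) ^ m * ((p : GammaImmAnCon p k O) ^ n * x) +
        (p : GammaImmAnCon p k O) ^ n * ((p : GammaImmAnCon p k O) ^ m * y) := by ring
    rw [this]
    exact add_mem (mul_mem (pow_mem hp m) hn) (mul_mem (pow_mem hp n) hm)
  mul_mem' := by
    rintro x y ⟨n, hn⟩ ⟨m, hm⟩
    refine ⟨n + m, ?_⟩
    have : (p : GammaImmAnCon p k O) ^ (n + m) * (x * y) =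
        ((p : GammaImmAnCon p k O) ^ n * x) * ((p : GammaImmAnCon p k O) ^ m * y) := by ring
    rw [this]
    exact mul_mem hn hm

/-- `Γ^alg_{an,con}`: the subring of the `x ∈ Γ^imm_{an,con}` such that for each `j` there is a
`y ∈ Γ^alg_con[1/p]` with the same coefficients as `x` at all exponents below `j`.
(These `x` are closed under the ring operations, so `Subring.closure` adds no element to them; it
only provides the ring structure.) -/
noncomputable def algAnCon (σ : O ≃+* O) : Subring (GammaImmAnCon p k O) :=
  Subring.closure {x | ∀ j : ℚ, ∃ y ∈ algConInv σ, ∀ i < j, x.coeff i = y.coeff i}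

theorem immFrob_mem_algAnCon (σ : O ≃+* O) (x : GammaImmAnCon p k O) (hx : x ∈ algAnCon σ) :
    immFrob σ x ∈ algAnCon σ := by
  suffices h : algAnCon σ ≤ (algAnCon σ).comap (immFrob (p := p) (k := k) σ) from h hx
  have p0 : (0 : ℚ) < p := by exact_mod_cast (Fact.out : p.Prime).pos
  refine (Subring.closure_le).2 fun y hy => Subring.subset_closure fun j => ?_
  obtain ⟨z, ⟨n, hn⟩, hz⟩ := hy (j / p)
  refine ⟨immFrob σ z, ⟨n, ?_⟩, fun i hi => ?_⟩
  · have := immFrob_mem_algCon σ hn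
    rwa [map_mul, map_pow, map_natCast] at this
  · exact congrArg (CoeffField.extAut σ) (hz (i / p) (div_lt_div_of_pos_right hi p0))

theorem immConst_mem_algAnCon (σ : O ≃+* O) (a : O) : immConst p k O a ∈ algAnCon σ := by
  refine Subring.subset_closure fun j => ⟨_, ⟨0, ?_⟩, fun i _ => rfl⟩
  rw [pow_zero, one_mul]
  refine ⟨fun i => ?_, fun N => ⟨_, Subring.subset_closure (Or.inl ⟨a, rfl⟩), fun i => ?_⟩⟩
  · change ‖(Pi.single (0 : ℚ) (algebraMap O (CoeffField p k O) a) : ℚ → CoeffField p k O) i‖ ≤ 1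
    by_cases hi : i = 0
    · subst hi; simpa using CoeffField.norm_coe_le_one a
    · simp [hi]
  · simp [ImmAnCon.coeff_zero]

variable (p k)

/-- The ring `Γ^alg_{an,con}`. -/
abbrev GammaAlgAnCon (σ : O ≃+* O) : Type _ := algAnCon (p := p) (k := k) σ

/-- The Frobenius on `Γ^alg_{an,con}`. -/
noncomputable def algFrob (σ : O ≃+* O) : GammaAlgAnCon p k σ →+* GammaAlgAnCon p k σ :=
  (immFrob σ).restrict _ _ (immFrob_mem_algAnCon σ)

/-- The constants of `Γ^alg_{an,con}` with coefficients in `O`. -/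
noncomputable def algConst (σ : O ≃+* O) : O →+* GammaAlgAnCon p k σ :=
  (immConst p k O).codRestrict _ (immConst_mem_algAnCon σ)

end

/-- An `F`-crystal over a ring `R` in which `p` is invertible, with Frobenius `φ`: a finite free
`R`-module `M` with a `φ`-linear endomorphism `F` whose linearization `φ^* M → M` is an isomorphism
(it is a map between free modules of the same rank, so this means that the image of `F`
generates `M`). -/
structure IsFCrystal {R : Type*} [CommRing R] {φ : R →+* R} {M : Type*} [AddCommGroup M]
    [Module R M] (F : M →ₛₗ[φ] M) : Prop where
  free : Module.Free R M
  finite : Module.Finite R M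
  span_range : Submodule.span R (Set.range F) = ⊤

/-! Put m = μ + 1 and let φ be the Frobenius of R. For x = α v + β w the equation F x = π^μ x says
that φ(β) = π^μ β and α - π φ(α) = c β. So a nonzero eigenvector β is wanted for which c β is a
coboundary, that is, of the form a - π φ(a). Two freedoms simplify c. Adding b - π^(μ+1) φ(b) to c
adds b β to α, and c may be multiplied by powers of π, which is invertible in R. Moreover every
series with positive exponents is a coboundary, by summing its twisted iterates
(`IsAnalyticHull.exists_sub_mul_frob_eq`).

If z has positive exponents, then β = ∑_{n ∈ ℤ} π^(-μ n) φ^n(z) is an eigenvector: for n ≥ 0 the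
exponents go to infinity, and for n < 0 the series converges π-adically to an element d. Write c =
∑_{i ≤ μ} π^i c_i. Modulo coboundaries, the term π^(i - μ n) c_i φ^n(z) with n ≥ 1 equals φ^l(c_i)
φ^N(z), where l = μ n - i and N = (μ+1) n - i, and each N ≥ 1 occurs exactly once. Terms with large
N have positive exponents. Hence c β is a coboundary as soon as the finite sum `obstruction`
vanishes. Its reduction modulo π is an additive polynomial ∑ B_N ζ^(p^N) over the field of
generalized power series.

Let θ^(μ+1) = p and suppose that c_i has poles of order at most A θ^i. Then the points (p^N, ord
B_N) lie on or above the strictly convex curve u ↦ -A u^(μ/(μ+1)). If in addition c_0 has a unit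
coefficient at the exponent -A, the points whose N is a multiple of μ+1 lie on the curve and are
vertices of the Newton polygon. An edge between two of them gives a root ζ ≠ 0 of positive order
(`HahnSeries.exists_addPoly_eq_zero`). Additive polynomials are surjective, with a bound on the
exponents of a solution (`HahnSeries.exists_addPoly_eq`), so successive approximation lifts ζ to a
zero of the obstruction (`FrobeniusLattice.exists_obstruction_eq_zero`). A unit coefficient of z
survives in β, so β ≠ 0.

It remains to bring c to this shape. Overconvergence allows a replacement of c by a series with
exponents bounded below (`FrobeniusLattice.exists_vanishBelow_sub_eq`). Then the digits c_i are
replaced by lifts of their reductions and the quotients by π are carried to the next digit, where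
the carry out of the last digit returns to digit 0 through φ⁻¹ (`IsDigits.exists_step`). Either some
digit acquires a unit coefficient at the extremal exponent, and multiplication by π rotates it to
position 0, or the poles shrink to 0 and c is itself of the form b - π^(μ+1) φ(b)
(`FrobeniusLattice.exists_eq_sub_of_forall`), where any nonzero eigenvector β serves.

Both rings are treated at once through `FrobeniusLattice` and `IsAnalyticHull`. For the algebraic
one the essential point is that the roots ζ satisfy a nonzero polynomial with algebraic coefficients
and are therefore algebraic. -/

set_option linter.unusedSectionVars false

/-! ### Lower bounds for the exponents of a series -/

/-- The coefficients of a generalized power series vanish at all exponents below `r`. -/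
def VanishBelow {A : Type*} [Zero A] (r : ℝ) (x : ℚ → A) : Prop := ∀ n : ℚ, (n : ℝ) < r → x n = 0

namespace VanishBelow
variable {A : Type*} {r s : ℝ}

theorem mono [Zero A] {x : ℚ → A} (h : VanishBelow s x) (hrs : r ≤ s) : VanishBelow r x :=
  fun n hn => h n (hn.trans_le hrs)

theorem zero [Zero A] : VanishBelow r (0 : ℚ → A) := fun _ _ => rfl

theorem add [AddGroup A] {x y : ℚ → A} (hx : VanishBelow r x) (hy : VanishBelow r y) :
    VanishBelow r (x + y) := fun n hn => by simp [hx n hn, hy n hn]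

theorem neg [AddGroup A] {x : ℚ → A} (hx : VanishBelow r x) : VanishBelow r (-x) :=
  fun n hn => by simp [hx n hn]

theorem sub [AddGroup A] {x y : ℚ → A} (hx : VanishBelow r x) (hy : VanishBelow r y) :
    VanishBelow r (x - y) := fun n hn => by simp [hx n hn, hy n hn]

end VanishBelow

/-! ### Additive polynomials over fields of generalized power series -/

namespace HahnSeries

section
variable {κ : Type*} [Field κ]

theorem vanishBelow_order (f : HahnSeries ℚ κ) : VanishBelow f.order f.coeff :=
  fun _ hn => coeff_eq_zero_of_lt_order (by exact_mod_cast hn)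

theorem le_order_of_vanishBelow {f : HahnSeries ℚ κ} (hf : f ≠ 0) {r : ℝ}
    (h : VanishBelow r f.coeff) : r ≤ f.order := by
  by_contra! hlt
  exact hf (coeff_order_eq_zero.1 (h _ hlt))

theorem vanishBelow_mul {f g : HahnSeries ℚ κ} {r s : ℝ} (hf : VanishBelow r f.coeff)
    (hg : VanishBelow s g.coeff) : VanishBelow (r + s) (f * g).coeff := by
  intro n hn
  rw [coeff_mul]
  refine Finset.sum_eq_zero fun ij hij => ?_
  have h := (Finset.mem_antidiagonal.1 hij).2.2
  by_cases h1 : (ij.1 : ℝ) < r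
  · rw [hf _ h1, zero_mul]
  · rw [hg ij.2, mul_zero]
    have : (ij.1 : ℝ) + ij.2 = n := by exact_mod_cast h
    linarith

theorem vanishBelow_pow {f : HahnSeries ℚ κ} {r : ℝ} (hf : VanishBelow r f.coeff) (n : ℕ) :
    VanishBelow (n * r) (f ^ n).coeff := by
  induction n with
  | zero =>
    intro n hn
    have : (n : ℝ) < 0 := by simpa using hn
    have : n ≠ 0 := by rintro rfl; simp at this
    rw [pow_zero, coeff_one, if_neg this]
  | succ n ih =>
    rw [pow_succ]
    exact (vanishBelow_mul ih hf).mono (by push_cast; linarith)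

theorem vanishBelow_sum {ι : Type*} {s : Finset ι} {f : ι → HahnSeries ℚ κ} {r : ℝ}
    (h : ∀ i ∈ s, VanishBelow r (f i).coeff) : VanishBelow r (∑ i ∈ s, f i).coeff := by
  intro n hn
  rw [coeff_sum]
  exact Finset.sum_eq_zero fun i hi => h i hi n hn

theorem vanishBelow_single {r : ℚ} {a : κ} : VanishBelow r (single r a).coeff := fun n hn =>
  coeff_single_of_ne (by rintro rfl; exact lt_irrefl _ hn)

open scoped Pointwise in
theorem support_pow_subset {g : HahnSeries ℚ κ} {s : Set ℚ} (hg : g.support ⊆ s) (k : ℕ) :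
    (g ^ k).support ⊆ k • s := by
  induction k with
  | zero => simp
  | succ k ih =>
    rw [pow_succ, succ_nsmul]
    exact support_mul_subset.trans (Set.add_subset_add ih hg)

open scoped Pointwise in
theorem isPWO_nsmul {s : Set ℚ} (hs : s.IsPWO) (k : ℕ) : (k • s).IsPWO := by
  induction k with
  | zero => rw [zero_nsmul]; exact (Set.finite_singleton (0 : ℚ)).isPWO
  | succ k ih => rw [succ_nsmul]; exact ih.add hs

variable {p : ℕ} [hp : Fact p.Prime] [CharP κ p]

instance charP : CharP (HahnSeries ℚ κ) p :=
  charP_of_injective_ringHom (f := (C : κ →+* HahnSeries ℚ κ)) C_injective p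

open scoped Pointwise in
/-- The Frobenius of a field of generalized power series of characteristic `p`. -/
theorem coeff_pow_char (f : HahnSeries ℚ κ) (n : ℚ) : (f ^ p).coeff n = f.coeff (n / p) ^ p := by
  obtain ⟨k, hk⟩ := Nat.exists_eq_succ_of_ne_zero hp.out.ne_zero
  have p0 : (p : ℚ) ≠ 0 := by exact_mod_cast hp.out.ne_zero
  set s := f.support
  -- With k = p - 1, only these exponents can be a factor in a product of p terms of f at the
  -- exponent n. They are split off as a finite sum h. The p-th power is additive, the rest f - h
  -- has no p-th power coefficient at n, and for h the claim is a finite computation.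
  have hfin : {a : ℚ | a ∈ s ∧ n - a ∈ k • s}.Finite :=
    ((Set.AddAntidiagonal.finite_of_isPWO f.isPWO_support (isPWO_nsmul f.isPWO_support k) n).image
      Prod.fst).subset fun a ha => ⟨(a, n - a), ⟨ha.1, ha.2, by simp⟩, rfl⟩
  set I := hfin.toFinset
  set h : HahnSeries ℚ κ := ∑ a ∈ I, single a (f.coeff a)
  have hh : ∀ a, h.coeff a = if a ∈ I then f.coeff a else 0 := by
    intro a
    rw [coeff_sum]
    split_ifs with ha
    · rw [Finset.sum_eq_single a (fun b _ hb => coeff_single_of_ne hb.symm) (absurd ha),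
        coeff_single_same]
    · exact Finset.sum_eq_zero fun b hb => coeff_single_of_ne (by rintro rfl; exact ha hb)
  have hg : ∀ a, (f - h).coeff a = if a ∈ I then 0 else f.coeff a := by
    intro a; rw [coeff_sub, hh]; split_ifs <;> simp
  have hgs : (f - h).support ⊆ s := fun a ha => by
    rw [mem_support, hg] at ha
    split_ifs at ha with h1
    · exact absurd rfl ha
    · exact ha
  have h1 : ((f - h) ^ p).coeff n = 0 := by
    rw [hk, pow_succ, coeff_mul]
    refine Finset.sum_eq_zero fun ij hij => ?_
    obtain ⟨hi, hj, hij⟩ := Finset.mem_antidiagonal.1 hij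
    have : ij.2 ∈ I := by
      refine hfin.mem_toFinset.2 ⟨hgs hj, ?_⟩
      rw [← hij, add_sub_cancel_right]
      exact support_pow_subset hgs k hi
    rw [hg, if_pos this, mul_zero]
  have h2 : f ^ p = h ^ p + (f - h) ^ p := by rw [← add_pow_char]; simp
  rw [h2, coeff_add, h1, add_zero, sum_pow_char]
  simp only [single_pow, coeff_sum]
  have h3 : ∀ a : ℚ, n = p • a ↔ n / p = a := fun a => by
    rw [nsmul_eq_mul, div_eq_iff p0, mul_comm]
  by_cases h4 : n / p ∈ I
  · rw [Finset.sum_eq_single (n / p) (fun b _ hb => coeff_single_of_ne fun h => hb ((h3 b).1 h).symm)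
      (absurd h4), ← (h3 _).2 rfl, coeff_single_same]
  rw [Finset.sum_eq_zero fun b hb => coeff_single_of_ne fun h => h4 ((h3 b).1 h ▸ hb)]
  symm
  by_contra hne
  have h5 : f.coeff (n / p) ≠ 0 := fun h => hne (by rw [h, zero_pow hp.out.ne_zero])
  -- The exponent n / p belongs to `I` whenever it is in the support of f, since n - n / p = (p -
  -- 1)(n / p).
  refine h4 (hfin.mem_toFinset.2 ⟨h5, ?_⟩)
  have : n - n / p = k • (n / p) := by
    have : (p : ℚ) = k + 1 := by rw [hk]; push_cast; ring
    rw [nsmul_eq_mul]; field_simp; rw [this]; ring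
  rw [this]
  exact Set.nsmul_mem_nsmul (by exact h5)

end

section
variable {κ : Type*} [Field κ]

/-- The additive polynomial `∑ A_n z^(p^n)` of a field of characteristic `p`. -/
noncomputable def addPoly (p : ℕ) (A : ℕ → HahnSeries ℚ κ) (N : ℕ) (z : HahnSeries ℚ κ) : HahnSeries ℚ κ :=
  ∑ n ∈ Finset.range (N + 1), A n * z ^ p ^ n

variable {p : ℕ} [hp : Fact p.Prime]

theorem addPoly_zero (A : ℕ → HahnSeries ℚ κ) (N : ℕ) : addPoly p A N 0 = 0 :=
  Finset.sum_eq_zero fun n _ => by rw [zero_pow (pow_ne_zero _ hp.out.ne_zero), mul_zero]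

theorem coeff_addPoly_single (A : ℕ → HahnSeries ℚ κ) (N : ℕ) (r : ℚ) (ζ : κ) (q : ℚ) :
    (addPoly p A N (single r ζ)).coeff q =
      ∑ n ∈ Finset.range (N + 1), (A n).coeff (q - p ^ n * r) * ζ ^ p ^ n := by
  rw [addPoly, coeff_sum]
  refine Finset.sum_congr rfl fun n _ => ?_
  rw [single_pow, coeff_mul_single, nsmul_eq_mul]
  push_cast; rfl

theorem vanishBelow_addPoly {A : ℕ → HahnSeries ℚ κ} {N : ℕ} {z : HahnSeries ℚ κ} {r s : ℝ}
    (hz : VanishBelow r z.coeff)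
    (h : ∀ n ≤ N, VanishBelow (s - p ^ n * r) (A n).coeff) :
    VanishBelow s (addPoly p A N z).coeff := by
  refine vanishBelow_sum fun n hn => ?_
  refine (vanishBelow_mul (h n (Nat.lt_succ_iff.1 (Finset.mem_range.1 hn)))
    (vanishBelow_pow hz (p ^ n))).mono ?_
  push_cast; linarith

variable [CharP κ p]

theorem addPoly_add (A : ℕ → HahnSeries ℚ κ) (N : ℕ) (x y : HahnSeries ℚ κ) :
    addPoly p A N (x + y) = addPoly p A N x + addPoly p A N y := by
  simp only [addPoly, add_pow_char_pow, mul_add, Finset.sum_add_distrib]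

theorem addPoly_sub (A : ℕ → HahnSeries ℚ κ) (N : ℕ) (x y : HahnSeries ℚ κ) :
    addPoly p A N (x - y) = addPoly p A N x - addPoly p A N y := by
  rw [eq_sub_iff_add_eq, ← addPoly_add, sub_add_cancel]

end

section
variable {κ : Type*} [Field κ] [IsAlgClosed κ] {p : ℕ} [hp : Fact p.Prime]

open Polynomial in
theorem coeff_sum_monomial_pow (a : ℕ → κ) (N n : ℕ) (hn : n ≤ N) :
    (∑ i ∈ Finset.range (N + 1), monomial (p ^ i) (a i)).coeff (p ^ n) = a n := by
  rw [finsetSum_coeff, Finset.sum_eq_single n]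
  · simp
  · intro b _ hb
    rw [coeff_monomial, if_neg]
    exact fun h => hb (Nat.pow_right_injective hp.out.two_le h)
  · intro h; exact absurd (Finset.mem_range.2 (by omega)) h

open Polynomial in
theorem exists_sum_mul_pow_eq (a : ℕ → κ) {N n : ℕ} (hn : n ≤ N) (ha : a n ≠ 0) (b : κ) :
    ∃ ζ : κ, ∑ i ∈ Finset.range (N + 1), a i * ζ ^ p ^ i = b := by
  set P : κ[X] := (∑ i ∈ Finset.range (N + 1), monomial (p ^ i) (a i)) - Polynomial.C b with hP
  have h1 : P.coeff (p ^ n) ≠ 0 := by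
    rw [hP, Polynomial.coeff_sub, coeff_sum_monomial_pow a N n hn, coeff_C_of_ne_zero (pow_ne_zero _ hp.out.ne_zero),
      sub_zero]
    exact ha
  have h2 : P.degree ≠ 0 := fun h => by
    have := le_degree_of_ne_zero h1
    rw [h] at this
    exact (pow_pos hp.out.pos n).not_ge (by exact_mod_cast this)
  obtain ⟨ζ, hζ⟩ := IsAlgClosed.exists_root P h2
  refine ⟨ζ, ?_⟩
  have : P.eval ζ = 0 := hζ
  simpa [P, eval_finsetSum, sub_eq_zero] using this

open Polynomial in
-- A polynomial with two distinct monomials is not a constant times a power of X. Once the largest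
-- power of X is divided out, the quotient is not constant and 0 is not a root of it.
theorem exists_sum_mul_pow_eq_zero (a : ℕ → κ) {N n n' : ℕ} (hn : n ≤ N) (hn' : n' ≤ N)
    (hnn : n ≠ n') (ha : a n ≠ 0) (ha' : a n' ≠ 0) :
    ∃ ζ : κ, ζ ≠ 0 ∧ ∑ i ∈ Finset.range (N + 1), a i * ζ ^ p ^ i = 0 := by
  set P : κ[X] := ∑ i ∈ Finset.range (N + 1), monomial (p ^ i) (a i)
  have h1 := coeff_sum_monomial_pow (p := p) a N n hn
  have h2 := coeff_sum_monomial_pow (p := p) a N n' hn'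
  have hP : P ≠ 0 := fun h => ha (by rw [← h1]; change P.coeff _ = 0; rw [h]; simp)
  obtain ⟨Q, hQ, hQ0⟩ := exists_eq_pow_rootMultiplicity_mul_and_not_dvd P hP 0
  rw [map_zero, sub_zero] at hQ hQ0
  have hdeg : Q.degree ≠ 0 := by
    intro hd
    rw [eq_C_of_degree_eq_zero hd, X_pow_mul_C] at hQ
    have e1 := h1; have e2 := h2
    change P.coeff _ = _ at e1 e2
    rw [hQ, coeff_C_mul_X_pow] at e1 e2
    split_ifs at e1 e2 with c1 c2
    · exact hnn (Nat.pow_right_injective hp.out.two_le (c1.trans c2.symm))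
    · exact ha' e2.symm
    · exact ha e1.symm
    · exact ha e1.symm
  obtain ⟨ζ, hζ⟩ := IsAlgClosed.exists_root Q hdeg
  refine ⟨ζ, ?_, ?_⟩
  · rintro rfl
    exact hQ0 (by simpa using dvd_iff_isRoot.2 hζ)
  · have : P.eval ζ = 0 := by rw [hQ, eval_mul, hζ, mul_zero]
    simpa [P, eval_finsetSum] using this

end

end HahnSeries

namespace HahnSeries

section
variable {κ : Type*} [Field κ] [IsAlgClosed κ] {p : ℕ} [hp : Fact p.Prime]

/-- One step of the solution of an additive equation: a monomial that cancels the leading term. -/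
theorem exists_single_coeff_addPoly {A : ℕ → HahnSeries ℚ κ} {N n₀ : ℕ} (hn₀ : n₀ ≤ N)
    (hA₀ : A n₀ ≠ 0) {q r : ℚ} (h₀ : (A n₀).order + p ^ n₀ * r = q)
    (h : ∀ n ≤ N, A n ≠ 0 → q ≤ (A n).order + p ^ n * r) (b : κ) :
    ∃ ζ : κ, (addPoly p A N (single r ζ)).coeff q = b ∧
      VanishBelow q (addPoly p A N (single r ζ)).coeff := by
  -- The coefficient at q is a polynomial in ζ. Its term of index n₀ is present because q - p^n₀ r
  -- is the order of A n₀.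
  obtain ⟨ζ, hζ⟩ := exists_sum_mul_pow_eq (p := p) (fun n => (A n).coeff (q - p ^ n * r)) hn₀ (by
    rw [← h₀, add_sub_cancel_right]
    exact coeff_order_eq_zero.not.2 hA₀) b
  refine ⟨ζ, by rw [coeff_addPoly_single]; exact hζ, ?_⟩
  refine vanishBelow_addPoly vanishBelow_single fun n hn => ?_
  by_cases hz : A n = 0
  · rw [hz]; exact VanishBelow.zero
  · refine (vanishBelow_order _).mono ?_
    have := h n hn hz
    have : (q : ℝ) ≤ (A n).order + p ^ n * r := by exact_mod_cast this
    linarith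

variable [CharP κ p]

/-- Additive polynomials over a field of generalized power series with algebraically closed field of
coefficients are surjective, with a bound for the exponents of a solution. -/
theorem exists_addPoly_eq {A : ℕ → HahnSeries ℚ κ} {N : ℕ} (hA : ∃ n ≤ N, A n ≠ 0)
    (f : HahnSeries ℚ κ) : ∃ z, addPoly p A N z = f ∧ ∀ n ≤ N, A n ≠ 0 → ∀ r : ℝ,
      VanishBelow ((A n).order + p ^ n * r) f.coeff → VanishBelow r z.coeff := by
  classical
  rcases eq_or_ne f 0 with rfl | hf
  · exact ⟨0, addPoly_zero A N, fun _ _ _ _ _ => VanishBelow.zero⟩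
  have p0 : ∀ n : ℕ, (0 : ℚ) < p ^ n := fun n => pow_pos (by exact_mod_cast hp.out.pos) n
  set T : Finset ℕ := {n ∈ Finset.range (N + 1) | A n ≠ 0}
  have memT : ∀ n, n ∈ T ↔ n ≤ N ∧ A n ≠ 0 := fun n => by simp [T]
  have hT : T.Nonempty := by
    obtain ⟨n, hn⟩ := hA
    exact ⟨n, (memT n).2 hn⟩
  -- `ρ` is the inverse of the increasing function r ↦ min_n (ord (A n) + p^n r): series with
  -- exponents at least ρ q have images with exponents at least q.
  set ρ : ℚ → ℚ := fun q => T.sup' hT fun n => (q - (A n).order) / p ^ n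
  have hρ : ∀ q n, n ≤ N → A n ≠ 0 → q ≤ (A n).order + p ^ n * ρ q := by
    intro q n hn hz
    have h1 : (q - (A n).order) / p ^ n ≤ ρ q :=
      Finset.le_sup' (fun n => (q - (A n).order) / p ^ n) ((memT n).2 ⟨hn, hz⟩)
    rw [div_le_iff₀ (p0 n)] at h1
    linarith
  have hρeq : ∀ q, ∃ n ≤ N, A n ≠ 0 ∧ (A n).order + p ^ n * ρ q = q := by
    intro q
    obtain ⟨n, hn, h⟩ := Finset.exists_mem_eq_sup' hT fun n => (q - (A n).order) / (p : ℚ) ^ n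
    refine ⟨n, ((memT n).1 hn).1, ((memT n).1 hn).2, ?_⟩
    change ρ q = _ at h
    rw [h, mul_div_cancel₀ _ (p0 n).ne']
    ring
  have hmono : Monotone ρ := by
    intro q q' hq
    refine Finset.sup'_le _ _ fun n hn => le_trans ?_ (Finset.le_sup' _ hn)
    exact div_le_div_of_nonneg_right (by linarith) (p0 n).le
  have hP : ∀ (x : HahnSeries ℚ κ) (q : ℚ), VanishBelow (ρ q) x.coeff →
      VanishBelow q (addPoly p A N x).coeff := by
    intro x q hx
    refine vanishBelow_addPoly hx fun n hn => ?_
    by_cases hz : A n = 0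
    · rw [hz]; exact VanishBelow.zero
    · refine (vanishBelow_order _).mono ?_
      have : (q : ℝ) ≤ (A n).order + p ^ n * ρ q := by exact_mod_cast hρ q n hn hz
      linarith
  suffices h : ∃ z, VanishBelow (ρ f.order) z.coeff ∧ addPoly p A N z = f by
    obtain ⟨z, hz, hzf⟩ := h
    refine ⟨z, hzf, fun n hn hAn r hr => hz.mono ?_⟩
    have h1 := le_order_of_vanishBelow hf hr
    have h2 : (f.order : ℝ) ≤ (A n).order + p ^ n * ρ f.order := by
      exact_mod_cast hρ f.order n hn hAn
    have h3 : (0 : ℝ) < p ^ n := by exact_mod_cast p0 n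
    nlinarith
  by_contra! hcon
  set S := {z : HahnSeries ℚ κ // VanishBelow (ρ f.order) z.coeff}
  set g : S → HahnSeries ℚ κ := fun z => f - addPoly p A N z.1
  have hg : ∀ z, g z ≠ 0 := fun z h => hcon z.1 z.2 (sub_eq_zero.1 h).symm
  have hgsub : ∀ z z' : S, g z' = g z - addPoly p A N (z'.1 - z.1) := fun z z' => by
    simp only [g, addPoly_sub]; ring
  -- Zorn's lemma is applied to approximate solutions z with error g z. A successor may change only
  -- the coefficients at exponents ≥ ρ (ord (g z)), so the earlier coefficients are final.
  set rel : S → S → Prop := fun z z' => (g z).order ≤ (g z').order ∧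
    VanishBelow (ρ (g z).order) (z'.1 - z.1).coeff
  have hrel : ∀ z z' : S, VanishBelow (ρ (g z).order) (z'.1 - z.1).coeff → rel z z' := by
    intro z z' h
    refine ⟨?_, h⟩
    have : VanishBelow ((g z).order : ℝ) (g z').coeff := by
      rw [hgsub z z']
      exact (vanishBelow_order _).sub (hP _ _ h)
    exact_mod_cast le_order_of_vanishBelow (hg z') this
  have htrans : ∀ {a b c : S}, rel a b → rel b c → rel a c := by
    intro a b c hab hbc
    refine ⟨hab.1.trans hbc.1, ?_⟩
    have : c.1 - a.1 = (c.1 - b.1) + (b.1 - a.1) := by ring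
    rw [this]
    exact (hbc.2.mono (by exact_mod_cast hmono hab.1)).add hab.2
  obtain ⟨z, hz⟩ := exists_maximal_of_chains_bounded (r := rel) (fun c hc => by
    have hcoh : ∀ z ∈ c, ∀ z' ∈ c, ∀ q : ℚ, q < ρ (g z).order → q < ρ (g z').order →
        z.1.coeff q = z'.1.coeff q := by
      intro z hz z' hz' q hq hq'
      rcases eq_or_ne z z' with rfl | hne
      · rfl
      rcases hc hz hz' hne with h | h
      · have := h.2 q (by exact_mod_cast hq)
        rw [coeff_sub, sub_eq_zero] at this
        exact this.symm
      · have := h.2 q (by exact_mod_cast hq')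
        rwa [coeff_sub, sub_eq_zero] at this
    set F : ℚ → κ := fun q => if h : ∃ z ∈ c, q < ρ (g z).order then h.choose.1.coeff q else 0
    have hF : ∀ z ∈ c, ∀ q : ℚ, q < ρ (g z).order → F q = z.1.coeff q := by
      intro z hz q hq
      have h : ∃ z ∈ c, q < ρ (g z).order := ⟨z, hz, hq⟩
      simp only [F, dif_pos h]
      exact hcoh _ h.choose_spec.1 _ hz _ h.choose_spec.2 hq
    -- A descending sequence of exponents stays below its first term, and there F coincides with a
    -- single member of the chain.
    have hpwo : (Function.support F).IsPWO := by
      refine Set.IsWF.isPWO ?_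
      rw [Set.isWF_iff_no_descending_seq]
      intro u hu hmem
      have h0 : ∃ z ∈ c, u 0 < ρ (g z).order := by
        by_contra h
        exact hmem 0 (by simp only [F, dif_neg h])
      obtain ⟨z, hz, hlt⟩ := h0
      refine Set.isWF_iff_no_descending_seq.1 z.1.isWF_support u hu fun n => ?_
      have := hF z hz (u n) ((hu.antitone (Nat.zero_le n)).trans_lt hlt)
      rw [mem_support, ← this]
      exact hmem n
    set w : HahnSeries ℚ κ := ⟨F, hpwo⟩
    have hw : VanishBelow (ρ f.order) w.coeff := by
      intro q hq
      change F q = 0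
      by_cases h : ∃ z ∈ c, q < ρ (g z).order
      · obtain ⟨z, hz, hlt⟩ := h
        rw [hF z hz q hlt]
        exact z.2 q hq
      · simp only [F, dif_neg h]
    refine ⟨⟨w, hw⟩, fun z hz => hrel _ _ fun q hq => ?_⟩
    rw [coeff_sub, sub_eq_zero]
    exact hF z hz q (by exact_mod_cast hq)) htrans
  set q := (g z).order
  obtain ⟨n₀, hn₀, hA₀, heq⟩ := hρeq q
  obtain ⟨ζ, hζ, hv⟩ := exists_single_coeff_addPoly hn₀ hA₀ heq (hρ q) ((g z).coeff q)
  have hqf : f.order ≤ q := by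
    have : VanishBelow (f.order : ℝ) (g z).coeff := (vanishBelow_order f).sub (hP _ _ z.2)
    exact_mod_cast le_order_of_vanishBelow (hg z) this
  set a : S := ⟨z.1 + single (ρ q) ζ,
    z.2.add (vanishBelow_single.mono (by exact_mod_cast hmono hqf))⟩
  have haz : a.1 - z.1 = single (ρ q) ζ := add_sub_cancel_left _ _
  -- By maximality the error of a has order at most q, the order of the error of z. But the added
  -- monomial cancels the term at q and creates none below it.
  have hle := (hz a (hrel z a (by rw [haz]; exact vanishBelow_single))).1
  have h0 := coeff_order_eq_zero.not.2 (hg a)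
  refine h0 ?_
  rw [hgsub z a, haz] at hle ⊢
  rcases hle.lt_or_eq with h | h
  · rw [coeff_sub, hv _ (by exact_mod_cast h), sub_zero]
    exact coeff_eq_zero_of_lt_order h
  · rw [h, coeff_sub, hζ, sub_self]

/-- A nonzero zero of an additive polynomial at a break of its Newton polygon. -/
theorem exists_addPoly_eq_zero {A : ℕ → HahnSeries ℚ κ} {N a b : ℕ} (hab : a < b) (hb : b ≤ N)
    (hAa : A a ≠ 0) (hAb : A b ≠ 0) {r₀ r₁ : ℝ}
    (h₀ : (A b).order + p ^ b * r₀ ≤ (A a).order + p ^ a * r₀)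
    (h₁ : ∀ n ≤ N, n < a → A n ≠ 0 → (A a).order + p ^ a * r₁ ≤ (A n).order + p ^ n * r₁)
    (h₂ : ∀ n ≤ N, a < n → A n ≠ 0 → (A a).order + p ^ a * r₁ < (A n).order + p ^ n * r₁) :
    ∃ z : HahnSeries ℚ κ, z ≠ 0 ∧ addPoly p A N z = 0 ∧ r₀ ≤ z.order ∧ z.order < r₁ := by
  classical
  have p0 : ∀ n : ℕ, (0 : ℚ) < p ^ n := fun n => pow_pos (by exact_mod_cast hp.out.pos) n
  have p1 : ∀ n n' : ℕ, n < n' → (0 : ℚ) < p ^ n' - p ^ n := fun n n' h =>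
    sub_pos.2 (pow_lt_pow_right₀ (by exact_mod_cast hp.out.one_lt) h)
  have p1' : ∀ n n' : ℕ, n < n' → (0 : ℝ) < p ^ n' - p ^ n := fun n n' h => by
    exact_mod_cast p1 n n' h
  set T : Finset ℕ := {n ∈ Finset.range (N + 1) | a < n ∧ A n ≠ 0}
  have memT : ∀ n, n ∈ T ↔ n ≤ N ∧ a < n ∧ A n ≠ 0 := fun n => by simp [T]
  have hT : T.Nonempty := ⟨b, (memT b).2 ⟨hb, hab, hAb⟩⟩
  -- At the exponent s n the terms of indices a and n have the same order. The largest s n belongs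
  -- to the edge of the Newton polygon that leaves the vertex a to the right.
  set s : ℕ → ℚ := fun n => ((A a).order - (A n).order) / (p ^ n - p ^ a)
  obtain ⟨n', hn', hr⟩ := Finset.exists_mem_eq_sup' hT s
  set r : ℚ := T.sup' hT s
  obtain ⟨hn'N, han', hAn'⟩ := (memT n').1 hn'
  have heq : (A n').order + p ^ n' * r = (A a).order + p ^ a * r := by
    rw [hr]
    have := p1 a n' han'
    simp only [s]
    field_simp
    ring
  have hge : ∀ n ≤ N, a < n → A n ≠ 0 → (A a).order + p ^ a * r ≤ (A n).order + p ^ n * r := by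
    intro n hn han hAn
    have h := Finset.le_sup' s ((memT n).2 ⟨hn, han, hAn⟩)
    change s n ≤ r at h
    rw [div_le_iff₀ (p1 a n han)] at h
    linarith
  have hr0 : r₀ ≤ r := by
    have h := Finset.le_sup' s ((memT b).2 ⟨hb, hab, hAb⟩)
    change s b ≤ r at h
    rw [div_le_iff₀ (p1 a b hab)] at h
    have h : ((A a).order - (A b).order : ℝ) ≤ r * (p ^ b - p ^ a) := by exact_mod_cast h
    have := p1' a b hab
    nlinarith
  have hr1 : (r : ℝ) < r₁ := by
    have h := h₂ n' hn'N han' hAn'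
    have heq' : ((A n').order + p ^ n' * r : ℝ) = (A a).order + p ^ a * r := by exact_mod_cast heq
    have := p1' a n' han'
    nlinarith
  have hle : ∀ n ≤ N, A n ≠ 0 → (A a).order + p ^ a * r ≤ (A n).order + p ^ n * r := by
    intro n hn hAn
    rcases lt_trichotomy n a with h | rfl | h
    · have h3 := h₁ n hn h hAn
      have := p1' n a h
      have : ((A a).order + p ^ a * r : ℝ) ≤ (A n).order + p ^ n * r := by nlinarith
      exact_mod_cast this
    · rfl
    · exact hge n hn h hAn
  set q : ℚ := (A a).order + p ^ a * r
  have haN : a ≤ N := hab.le.trans hb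
  obtain ⟨ζ, hζ0, hζ⟩ := exists_sum_mul_pow_eq_zero (p := p)
    (fun n => (A n).coeff (q - p ^ n * r)) haN hn'N han'.ne
    (by simp only [q, add_sub_cancel_right]; exact coeff_order_eq_zero.not.2 hAa)
    (by rw [← heq, add_sub_cancel_right]; exact coeff_order_eq_zero.not.2 hAn')
  -- The monomial already annihilates the coefficient at q, so f starts strictly after q. The
  -- correction z then starts strictly after r and leaves the leading term ζ t^r intact.
  set f := -addPoly p A N (single r ζ)
  have hf : ∀ x : ℚ, x ≤ q → f.coeff x = 0 := by
    intro x hx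
    rw [coeff_neg, neg_eq_zero]
    rcases hx.lt_or_eq with h | rfl
    · rw [coeff_addPoly_single]
      refine Finset.sum_eq_zero fun n hn => ?_
      by_cases hz : A n = 0
      · simp [hz]
      rw [coeff_eq_zero_of_lt_order, zero_mul]
      have := hle n (Nat.lt_succ_iff.1 (Finset.mem_range.1 hn)) hz
      linarith
    · rw [coeff_addPoly_single]; exact hζ
  obtain ⟨z, hz, hzv⟩ := exists_addPoly_eq ⟨a, haN, hAa⟩ f
  have hzr : ∀ x : ℚ, x ≤ r → z.coeff x = 0 := by
    intro x hx
    rcases eq_or_ne f 0 with h0 | h0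
    · exact hzv a haN hAa (x + 1) (by rw [h0]; exact VanishBelow.zero) x (by linarith)
    · have hq : q < f.order := by
        by_contra! h
        exact coeff_order_eq_zero.not.2 h0 (hf _ h)
      have hv := hzv a haN hAa (((f.order - (A a).order) / p ^ a : ℚ) : ℝ) (by
        refine (vanishBelow_order f).mono (le_of_eq ?_)
        have := (p0 a).ne'
        have h : (A a).order + p ^ a * ((f.order - (A a).order) / (p : ℚ) ^ a) = f.order := by
          field_simp; ring
        exact_mod_cast h)
      refine hv x ?_
      have : x < (f.order - (A a).order) / p ^ a := by
        rw [lt_div_iff₀ (p0 a)]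
        have := p0 a
        nlinarith
      exact_mod_cast this
  have hcr : (single r ζ + z).coeff r = ζ := by
    rw [coeff_add, coeff_single_same, hzr r le_rfl, add_zero]
  have hord : (single r ζ + z).order = r := by
    have hne : single r ζ + z ≠ 0 := ne_zero_of_coeff_ne_zero (by rw [hcr]; exact hζ0)
    refine le_antisymm (order_le_of_coeff_ne_zero (by rw [hcr]; exact hζ0)) ?_
    have : VanishBelow (r : ℝ) (single r ζ + z).coeff :=
      vanishBelow_single.add fun x hx => hzr x (by exact_mod_cast hx.le)
    exact_mod_cast le_order_of_vanishBelow hne this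
  refine ⟨single r ζ + z, ne_zero_of_coeff_ne_zero (by rw [hcr]; exact hζ0), ?_, ?_, ?_⟩
  · rw [addPoly_add, hz]; simp [f]
  · rw [hord]; exact hr0
  · rw [hord]; exact hr1

end

end HahnSeries

/-! ### Criteria for membership in the analytic ring, and products of series -/

section
variable {p : ℕ} [hp : Fact p.Prime] {L : Type*} [NormedField L]

theorem IsAnCon.eventually_lt_rpow (C : ℝ) {d : ℝ} (hd : 0 < d) :
    ∀ᶠ n : ℚ in Filter.atTop, C < (p : ℝ) ^ (d * n) := by
  have p1 : (1 : ℝ) < p := one_lt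
  obtain ⟨N, hN⟩ := exists_rat_gt (Real.logb p (max C 1) / d)
  filter_upwards [Filter.eventually_ge_atTop N] with n hn
  have hn' : (N : ℝ) ≤ n := by exact_mod_cast hn
  have h3 := hN.trans_le hn'
  rw [div_lt_iff₀ hd, Real.logb_lt_iff_lt_rpow p1 (by positivity), mul_comm] at h3
  exact (le_max_left _ _).trans_lt h3

theorem IsAnCon.of_vanishBelow {x : ℚ → L} {r C : ℝ} (hr : VanishBelow r x)
    (wo : ∀ r : ℝ, {n : ℚ | (p : ℝ) ^ r < ‖x n‖}.IsWF) (hC : ∀ n, ‖x n‖ ≤ C) : IsAnCon p x := by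
  refine ⟨wo, fun _ => ⟨C, fun n _ => hC n⟩, ⟨1, one_pos, ?_⟩, fun d hd => ?_⟩
  · obtain ⟨s, hs⟩ := exists_rat_lt r
    filter_upwards [Filter.eventually_lt_atBot s] with n hn
    have : (n : ℝ) < s := by exact_mod_cast hn
    rw [hr n (this.trans hs), norm_zero]
    exact Real.rpow_pos_of_pos p_pos _
  · filter_upwards [eventually_lt_rpow (p := p) C hd] with n hn
    exact (hC n).trans_lt hn

/-- By the ultrametric inequality a uniform approximation within p^r has the same coefficients of
norm > p^r up to their exact values, so well-ordering passes to the limit. The decay at negative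
exponents does not, which is why it is a hypothesis. -/
theorem IsAnCon.of_uniform_limit [IsUltrametricDist L] {s : ℚ → L} {C : ℝ}
    (hC : ∀ n, ‖s n‖ ≤ C)
    (hneg : ∃ c : ℝ, 0 < c ∧ ∀ᶠ n : ℚ in Filter.atBot, ‖s n‖ < (p : ℝ) ^ (c * n))
    (h : ∀ ε : ℝ, 0 < ε → ∃ z : ImmAnCon p L, ∀ n, ‖s n - z.coeff n‖ ≤ ε) : IsAnCon p s := by
  refine ⟨fun r => ?_, fun _ => ⟨C, fun n _ => hC n⟩, hneg, fun d hd => ?_⟩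
  · obtain ⟨z, hz⟩ := h _ (Real.rpow_pos_of_pos (p_pos (p := p)) r)
    refine (z.isAnCon.wo r).mono fun n hn => ?_
    have hn : (p : ℝ) ^ r < ‖s n‖ := hn
    by_contra hcon
    have h1 := IsUltrametricDist.norm_add_le_max (s n - z.coeff n) (z.coeff n)
    rw [sub_add_cancel] at h1
    exact (h1.trans (max_le (hz n) (not_lt.1 hcon))).not_gt hn
  · filter_upwards [eventually_lt_rpow (p := p) C hd] with n hn
    exact (hC n).trans_lt hn

theorem IsAnCon.comp_mul {x : ℚ → L} (hx : IsAnCon p x) {a : ℚ} (ha : 0 < a) (s : L → L)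
    (hs : ∀ y, ‖s y‖ = ‖y‖) : IsAnCon p fun n => s (x (n * a)) := by
  have ha' : (0 : ℝ) < a := by exact_mod_cast ha
  refine ⟨fun r => ?_, fun j => ?_, ?_, fun d hd => ?_⟩
  · simp only [hs]
    refine (((hx.wo r).isPWO.image_of_monotone
      (f := fun n : ℚ => n / a) fun b c hbc => div_le_div_of_nonneg_right hbc ha.le).mono
      fun n hn => ⟨n * a, hn, by field_simp⟩).isWF
  · obtain ⟨C, hC⟩ := hx.bdd (j * a)
    exact ⟨C, fun n hn => by rw [hs]; exact hC _ (mul_lt_mul_of_pos_right hn ha)⟩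
  · obtain ⟨c, hc, hn⟩ := hx.neg
    refine ⟨c * a, by positivity, ?_⟩
    have : Filter.Tendsto (fun n : ℚ => n * a) Filter.atBot Filter.atBot :=
      Filter.tendsto_id.atBot_mul_const ha
    filter_upwards [this.eventually hn] with n hn
    rw [hs]; refine hn.trans_le (le_of_eq ?_); congr 1; push_cast; ring
  · have : Filter.Tendsto (fun n : ℚ => n * a) Filter.atTop Filter.atTop :=
      Filter.tendsto_id.atTop_mul_const ha
    filter_upwards [this.eventually (hx.pos (d / a) (by positivity))] with n hn
    rw [hs]; refine hn.trans_le (le_of_eq ?_); congr 1; push_cast; field_simp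

end

namespace ImmAnCon
section
variable {p : ℕ} [Fact p.Prime] {L : Type*} [NormedField L] [IsUltrametricDist L] [CompleteSpace L]

theorem coeff_sub (x y : ImmAnCon p L) (n : ℚ) : (x - y).coeff n = x.coeff n - y.coeff n := by
  rw [sub_eq_add_neg, coeff_add, coeff_neg, sub_eq_add_neg]

theorem coeff_sum {ι : Type*} (s : Finset ι) (f : ι → ImmAnCon p L) (n : ℚ) :
    (∑ i ∈ s, f i).coeff n = ∑ i ∈ s, (f i).coeff n :=
  map_sum (⟨⟨fun x : ImmAnCon p L => x.coeff n, coeff_zero n⟩, fun x y => coeff_add x y n⟩ :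
    ImmAnCon p L →+ L) f s

variable {x y : ImmAnCon p L} {r s : ℝ}

theorem vanishBelow_zero : VanishBelow r (0 : ImmAnCon p L).coeff := fun _ _ => rfl

theorem vanishBelow_add (hx : VanishBelow r x.coeff) (hy : VanishBelow r y.coeff) :
    VanishBelow r (x + y).coeff := hx.add hy

theorem vanishBelow_sub (hx : VanishBelow r x.coeff) (hy : VanishBelow r y.coeff) :
    VanishBelow r (x - y).coeff := fun n hn => by rw [coeff_sub, hx n hn, hy n hn, sub_zero]

theorem vanishBelow_neg (hx : VanishBelow r x.coeff) : VanishBelow r (-x).coeff := hx.neg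

theorem vanishBelow_sum {ι : Type*} {t : Finset ι} {f : ι → ImmAnCon p L}
    (h : ∀ i ∈ t, VanishBelow r (f i).coeff) : VanishBelow r (∑ i ∈ t, f i).coeff := by
  intro n hn
  rw [coeff_sum]
  exact Finset.sum_eq_zero fun i hi => h i hi n hn

theorem vanishBelow_mul (hx : VanishBelow r x.coeff) (hy : VanishBelow s y.coeff) :
    VanishBelow (r + s) (x * y).coeff := by
  intro n hn
  rw [coeff_mul]
  refine (tsum_congr fun i => ?_).trans tsum_zero
  by_cases h1 : (i : ℝ) < r
  · rw [hx _ h1, zero_mul]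
  · rw [hy _ (by push_cast; linarith), mul_zero]

theorem vanishBelow_const_mul (a : L) (hx : VanishBelow r x.coeff) :
    VanishBelow r (const a * x).coeff := fun n hn => by
  rw [coeff_const_mul, hx n hn, mul_zero]

end
end ImmAnCon

/-! ### The residue field of O and the Frobenius as an automorphism -/

section
variable {p : ℕ} [Fact p.Prime] {k : Type*} [Field k] [IsAlgClosed k] [CharP k p]
  {O : Type*} [CommRing O] [IsDomain O] [IsDiscreteValuationRing O]
  [Algebra (WittVector p k) O] [Module.Finite (WittVector p k) O] [FaithfulSMul (WittVector p k) O]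

theorem charP_residueField (p : ℕ) [Fact p.Prime] (k : Type*) [Field k] [IsAlgClosed k] [CharP k p]
    (O : Type*) [CommRing O] [IsLocalRing O] [Algebra (WittVector p k) O]
    [Module.Finite (WittVector p k) O] [FaithfulSMul (WittVector p k) O] :
    CharP (IsLocalRing.ResidueField O) p := by
  refine (CharP.charP_iff_prime_eq_zero Fact.out).2 ?_
  rw [← map_natCast (IsLocalRing.residue O), IsLocalRing.residue_eq_zero_iff]
  exact natCast_prime_mem p k O

/-- Since O is finite over the Witt vectors, its residue field is integral over k and hence
isomorphic to k. -/
theorem isAlgClosed_residueField (p : ℕ) [Fact p.Prime] (k : Type*) [Field k] [IsAlgClosed k]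
    [CharP k p] (O : Type*) [CommRing O] [IsLocalRing O] [Algebra (WittVector p k) O]
    [Module.Finite (WittVector p k) O] [FaithfulSMul (WittVector p k) O] :
    IsAlgClosed (IsLocalRing.ResidueField O) := by
  have hsurj : Function.Surjective (WittVector.constantCoeff : WittVector p k →+* k) :=
    fun a => ⟨WittVector.teichmuller p a, WittVector.teichmuller_coeff_zero p a⟩
  set f : WittVector p k →+* IsLocalRing.ResidueField O :=
    (IsLocalRing.residue O).comp (algebraMap _ O)
  have hker : RingHom.ker (WittVector.constantCoeff : WittVector p k →+* k) ≤ RingHom.ker f := by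
    have hmax : (RingHom.ker (WittVector.constantCoeff : WittVector p k →+* k)).IsMaximal :=
      RingHom.ker_isMaximal_of_surjective _ hsurj
    rw [IsLocalRing.eq_maximalIdeal hmax,
      (WittVector.irreducible p (k := k)).maximalIdeal_eq, Ideal.span_le, Set.singleton_subset_iff]
    have : f p = 0 := by
      simp only [f, map_natCast]
      rw [← map_natCast (IsLocalRing.residue O), IsLocalRing.residue_eq_zero_iff]
      exact natCast_prime_mem p k O
    exact this
  set g : k →+* IsLocalRing.ResidueField O := RingHom.liftOfSurjective _ hsurj ⟨f, hker⟩
  have hg : ∀ x, g (WittVector.constantCoeff x) = f x :=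
    RingHom.liftOfRightInverse_comp_apply _ _ (Function.rightInverse_surjInv hsurj) ⟨f, hker⟩
  let : Algebra k (IsLocalRing.ResidueField O) := g.toAlgebra
  have hint : Algebra.IsIntegral k (IsLocalRing.ResidueField O) := by
    refine ⟨fun y => ?_⟩
    obtain ⟨b, rfl⟩ := IsLocalRing.residue_surjective y
    have : Algebra.IsIntegral (WittVector p k) O := Algebra.IsIntegral.of_finite _ _
    obtain ⟨P, hP, hPb⟩ := Algebra.IsIntegral.isIntegral (R := WittVector p k) b
    refine ⟨P.map WittVector.constantCoeff, hP.map _, ?_⟩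
    rw [Polynomial.eval₂_map]
    have h1 : (algebraMap k (IsLocalRing.ResidueField O)).comp WittVector.constantCoeff = f :=
      RingHom.ext hg
    rw [h1, ← Polynomial.hom_eval₂, hPb, map_zero]
  have hbij := IsAlgClosed.algebraMap_bijective_of_isIntegral (k := k)
    (K := IsLocalRing.ResidueField O)
  set e := RingEquiv.ofBijective _ hbij
  refine IsAlgClosed.of_exists_root _ fun P hP hirr => ?_
  have hd : (P.map (e.symm : IsLocalRing.ResidueField O →+* k)).degree ≠ 0 := by
    rw [Polynomial.degree_map]
    exact (Polynomial.degree_pos_of_irreducible hirr).ne'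
  obtain ⟨x, hx⟩ := IsAlgClosed.exists_root _ hd
  refine ⟨e x, ?_⟩
  have h2 : e (Polynomial.eval x (P.map (e.symm : IsLocalRing.ResidueField O →+* k))) = 0 := by
    rw [hx, map_zero]
  rw [Polynomial.eval_map] at h2
  have h3 := Polynomial.hom_eval₂ P (e.symm : IsLocalRing.ResidueField O →+* k)
    (e : k →+* IsLocalRing.ResidueField O) x
  rw [show (e : k →+* IsLocalRing.ResidueField O) (Polynomial.eval₂
    (e.symm : IsLocalRing.ResidueField O →+* k) x P) = 0 from h2] at h3
  simpa using h3.symm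

namespace GammaImmAnCon

theorem immFrob_bijective (σ : O ≃+* O) :
    Function.Bijective (immFrob (p := p) (k := k) σ) := by
  have p0 : (0 : ℚ) < p := by exact_mod_cast (Fact.out : p.Prime).pos
  constructor
  · intro x y hxy
    ext n
    have := congrArg (fun z => z.coeff (n * p)) hxy
    have h : CoeffField.extAut σ (x.coeff (n * p / p)) = CoeffField.extAut σ (y.coeff (n * p / p)) :=
      this
    rw [mul_div_cancel_right₀ _ p0.ne'] at h
    exact (CoeffField.extAut σ).injective h
  · intro x
    refine ⟨⟨_, x.isAnCon.comp_mul p0 (CoeffField.extAut σ).symm fun y => ?_⟩, ?_⟩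
    · rw [← CoeffField.norm_extAut σ, RingEquiv.apply_symm_apply]
    · ext n
      change CoeffField.extAut σ ((CoeffField.extAut σ).symm (x.coeff (n / p * p))) = _
      rw [RingEquiv.apply_symm_apply, div_mul_cancel₀ _ p0.ne']

/-- The Frobenius as an automorphism of `Γ^imm_{an,con}`. -/
noncomputable def frobAut (σ : O ≃+* O) : RingAut (GammaImmAnCon p k O) :=
  RingEquiv.ofBijective (immFrob σ) (immFrob_bijective σ)

variable {σ : O ≃+* O} {x y : GammaImmAnCon p k O} {r s : ℝ}

theorem frobAut_apply (x : GammaImmAnCon p k O) : frobAut σ x = immFrob σ x := rfl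

theorem frobAut_inv_apply_self (x : GammaImmAnCon p k O) : (frobAut σ)⁻¹ (frobAut σ x) = x :=
  (frobAut σ).symm_apply_apply x

theorem frobAut_apply_inv (x : GammaImmAnCon p k O) : frobAut σ ((frobAut σ)⁻¹ x) = x :=
  (frobAut σ).apply_symm_apply x

theorem norm_coeff_frobAut (x : GammaImmAnCon p k O) (n : ℚ) :
    ‖(frobAut σ x).coeff n‖ = ‖x.coeff (n / p)‖ := CoeffField.norm_extAut σ _

theorem norm_coeff_frobAut_inv (x : GammaImmAnCon p k O) (n : ℚ) :
    ‖((frobAut σ)⁻¹ x).coeff n‖ = ‖x.coeff (n * p)‖ := by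
  have p0 : (p : ℚ) ≠ 0 := by exact_mod_cast (Fact.out : p.Prime).ne_zero
  conv_rhs => rw [← frobAut_apply_inv (σ := σ) x, norm_coeff_frobAut, mul_div_cancel_right₀ _ p0]

theorem norm_coeff_frobAut_pow (x : GammaImmAnCon p k O) (l : ℕ) (n : ℚ) :
    ‖((frobAut σ ^ l) x).coeff n‖ = ‖x.coeff (n / p ^ l)‖ := by
  induction l generalizing n with
  | zero => simp
  | succ l ih =>
    rw [pow_succ', RingAut.mul_apply, norm_coeff_frobAut, ih, div_div, pow_succ']

theorem norm_coeff_frobAut_inv_pow (x : GammaImmAnCon p k O) (l : ℕ) (n : ℚ) :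
    ‖(((frobAut σ)⁻¹ ^ l) x).coeff n‖ = ‖x.coeff (n * p ^ l)‖ := by
  induction l generalizing n with
  | zero => simp
  | succ l ih =>
    rw [pow_succ', RingAut.mul_apply, norm_coeff_frobAut_inv, ih, mul_assoc, pow_succ']

theorem vanishBelow_frobAut_pow (hx : VanishBelow r x.coeff) (l : ℕ) :
    VanishBelow (p ^ l * r) ((frobAut σ ^ l) x).coeff := fun n hn => by
  have p0 : (0 : ℝ) < p ^ l := pow_pos (by exact_mod_cast (Fact.out : p.Prime).pos) l
  rw [← norm_eq_zero, norm_coeff_frobAut_pow, norm_eq_zero]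
  refine hx _ ?_
  push_cast
  rwa [div_lt_iff₀' p0]

theorem vanishBelow_frobAut_inv_pow (hx : VanishBelow r x.coeff) (l : ℕ) :
    VanishBelow (r / p ^ l) (((frobAut σ)⁻¹ ^ l) x).coeff := fun n hn => by
  have p0 : (0 : ℝ) < p ^ l := pow_pos (by exact_mod_cast (Fact.out : p.Prime).pos) l
  rw [← norm_eq_zero, norm_coeff_frobAut_inv_pow, norm_eq_zero]
  refine hx _ ?_
  push_cast
  rwa [lt_div_iff₀ p0] at hn

theorem vanishBelow_frobAut (hx : VanishBelow r x.coeff) :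
    VanishBelow (p * r) (frobAut σ x).coeff := by
  simpa using vanishBelow_frobAut_pow (σ := σ) hx 1

theorem vanishBelow_frobAut_inv (hx : VanishBelow r x.coeff) :
    VanishBelow (r / p) ((frobAut σ)⁻¹ x).coeff := by
  simpa using vanishBelow_frobAut_inv_pow (σ := σ) hx 1

theorem frobAut_const (a : CoeffField p k O) :
    frobAut σ (ImmAnCon.const a) = ImmAnCon.const (CoeffField.extAut σ a) := by
  have p0 : (p : ℚ) ≠ 0 := by exact_mod_cast (Fact.out : p.Prime).ne_zero
  ext n
  change CoeffField.extAut σ ((Pi.single (0 : ℚ) a : ℚ → CoeffField p k O) (n / p)) =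
    (Pi.single (0 : ℚ) (CoeffField.extAut σ a) : ℚ → CoeffField p k O) n
  by_cases hn : n = 0
  · subst hn; simp
  · have : n / p ≠ 0 := div_ne_zero hn p0
    simp [hn, this]

theorem coeff_immConst_mul (a : O) (x : GammaImmAnCon p k O) (n : ℚ) :
    (immConst p k O a * x).coeff n = algebraMap O (CoeffField p k O) a * x.coeff n :=
  ImmAnCon.coeff_const_mul _ _ _

theorem frobAut_immConst {a : O} (ha : σ a = a) :
    frobAut σ (immConst p k O a) = immConst p k O a := by
  change frobAut σ (ImmAnCon.const _) = ImmAnCon.const _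
  rw [frobAut_const, CoeffField.extAut_algebraMap, ha]

theorem frobAut_inv_immConst {a : O} (ha : σ a = a) :
    (frobAut σ)⁻¹ (immConst p k O a) = immConst p k O a := by
  conv_lhs => rw [← frobAut_immConst (p := p) (k := k) ha]
  rw [frobAut_inv_apply_self]

end GammaImmAnCon
end

/-! ### Divisibility by π and reduction modulo π -/

section
variable {p : ℕ} [Fact p.Prime] {k : Type*} [Field k] [IsAlgClosed k] [CharP k p]
  {O : Type*} [CommRing O] [IsDomain O] [IsDiscreteValuationRing O]
  [Algebra (WittVector p k) O] [Module.Finite (WittVector p k) O] [FaithfulSMul (WittVector p k) O]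

namespace CoeffField

variable {π : O}

theorem algebraMap_ne_zero (hπ : Irreducible π) : algebraMap O (CoeffField p k O) π ≠ 0 := by
  have := (IsFractionRing.injective O (CoeffField p k O)).ne hπ.ne_zero
  simpa using this

theorem norm_pos (hπ : Irreducible π) : 0 < ‖algebraMap O (CoeffField p k O) π‖ :=
  norm_pos_iff.2 (algebraMap_ne_zero hπ)

theorem norm_lt_one (hπ : Irreducible π) : ‖algebraMap O (CoeffField p k O) π‖ < 1 :=
  (norm_coe_le_one π).lt_of_ne fun h => hπ.not_isUnit ((norm_coe_eq_one_iff π).1 h)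

/-- Discreteness of the valuation. It turns a vanishing reduction into divisibility by π, uniformly
in the exponent. -/
theorem norm_le_of_lt_one (hπ : Irreducible π) {x : CoeffField p k O} (hx : ‖x‖ < 1) :
    ‖x‖ ≤ ‖algebraMap O (CoeffField p k O) π‖ := by
  obtain ⟨a, rfl⟩ := (norm_le_one_iff x).1 hx.le
  have h1 : a ∈ IsLocalRing.maximalIdeal O := by
    rw [IsLocalRing.mem_maximalIdeal, mem_nonunits_iff, ← norm_coe_eq_one_iff (p := p) (k := k)]
    exact hx.ne
  rw [hπ.maximalIdeal_eq, Ideal.mem_span_singleton] at h1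
  obtain ⟨b, rfl⟩ := h1
  rw [map_mul, norm_mul]
  exact mul_le_of_le_one_right (norm_nonneg _) (norm_coe_le_one b)

theorem norm_coe_lt_one_iff (a : O) :
    ‖algebraMap O (CoeffField p k O) a‖ < 1 ↔ IsLocalRing.residue O a = 0 := by
  rw [IsLocalRing.residue_eq_zero_iff, IsLocalRing.mem_maximalIdeal, mem_nonunits_iff,
    ← norm_coe_eq_one_iff (p := p) (k := k)]
  exact ⟨fun h => h.ne, fun h => (norm_coe_le_one a).lt_of_ne h⟩

/-- `p` is a unit times a power of `π`. -/
theorem exists_norm_natCast_prime (p : ℕ) [Fact p.Prime] (k : Type*) [Field k] [IsAlgClosed k]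
    [CharP k p] [Algebra (WittVector p k) O] [Module.Finite (WittVector p k) O]
    [FaithfulSMul (WittVector p k) O] (hπ : Irreducible π) :
    ∃ (e : ℕ) (u : Oˣ), e ≠ 0 ∧ (p : O) = u * π ^ e := by
  obtain ⟨e, u, hu⟩ := IsDiscreteValuationRing.eq_unit_mul_pow_irreducible
    (natCast_prime_ne_zero p k O) hπ
  refine ⟨e, u, ?_, hu⟩
  rintro rfl
  have := natCast_prime_mem p k O
  rw [hu, pow_zero, mul_one, IsLocalRing.mem_maximalIdeal] at this
  exact this u.isUnit

end CoeffField

namespace GammaImmAnCon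
variable {π : O} {σ : O ≃+* O} {x y : GammaImmAnCon p k O}

theorem exists_eq_immConst_pow_mul (hπ : Irreducible π) (h : ℕ)
    (hx : ∀ n, ‖x.coeff n‖ ≤ ‖algebraMap O (CoeffField p k O) π‖ ^ h) :
    ∃ y : GammaImmAnCon p k O, (∀ n, ‖y.coeff n‖ ≤ 1) ∧ x = immConst p k O π ^ h * y := by
  have h0 := CoeffField.algebraMap_ne_zero (p := p) (k := k) hπ
  refine ⟨ImmAnCon.const ((algebraMap O (CoeffField p k O) π)⁻¹ ^ h) * x, fun n => ?_, ?_⟩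
  · rw [ImmAnCon.coeff_const_mul, norm_mul, norm_pow, norm_inv, inv_pow]
    exact inv_mul_le_one_of_le₀ (hx n) (by positivity)
  · rw [← mul_assoc, ← map_pow]
    change x = ImmAnCon.const _ * _ * x
    rw [← map_mul, map_pow, ← mul_pow, mul_inv_cancel₀ h0, one_pow, map_one, one_mul]

theorem norm_coeff_immConst_pow_mul (h : ℕ) (x : GammaImmAnCon p k O) (n : ℚ) :
    ‖(immConst p k O π ^ h * x).coeff n‖ =
      ‖algebraMap O (CoeffField p k O) π‖ ^ h * ‖x.coeff n‖ := by
  rw [← map_pow, coeff_immConst_mul, norm_mul, map_pow, norm_pow]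

theorem immConst_pow_mul_injective (hπ : Irreducible π) (h : ℕ) :
    Function.Injective fun x : GammaImmAnCon p k O => immConst p k O π ^ h * x := by
  intro x y hxy
  ext n
  have := congrArg (fun z => z.coeff n) hxy
  simp only at this
  rw [← map_pow, coeff_immConst_mul, coeff_immConst_mul] at this
  refine mul_left_cancel₀ ?_ this
  rw [map_pow]
  exact pow_ne_zero _ (CoeffField.algebraMap_ne_zero hπ)

theorem vanishBelow_of_immConst_pow_mul (hπ : Irreducible π) {h : ℕ} {r : ℝ}
    (hx : VanishBelow r (immConst p k O π ^ h * x).coeff) : VanishBelow r x.coeff := by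
  intro n hn
  have := hx n hn
  rw [← map_pow, coeff_immConst_mul, mul_eq_zero] at this
  refine this.resolve_left ?_
  rw [map_pow]
  exact pow_ne_zero _ (CoeffField.algebraMap_ne_zero hπ)

theorem vanishBelow_immConst_mul (a : O) {r : ℝ} (hx : VanishBelow r x.coeff) :
    VanishBelow r (immConst p k O a * x).coeff := ImmAnCon.vanishBelow_const_mul _ hx

theorem vanishBelow_immConst_pow_mul (h : ℕ) {r : ℝ} (hx : VanishBelow r x.coeff) :
    VanishBelow r (immConst p k O π ^ h * x).coeff := by
  rw [← map_pow]; exact vanishBelow_immConst_mul _ hx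

theorem norm_coeff_add_le {C : ℝ} (hx : ∀ n, ‖x.coeff n‖ ≤ C) (hy : ∀ n, ‖y.coeff n‖ ≤ C) (n : ℚ) :
    ‖(x + y).coeff n‖ ≤ C :=
  (IsUltrametricDist.norm_add_le_max _ _).trans (max_le (hx n) (hy n))

theorem norm_coeff_const_le {a : CoeffField p k O} {C : ℝ} (ha : ‖a‖ ≤ C) (n : ℚ) :
    ‖(ImmAnCon.const a : GammaImmAnCon p k O).coeff n‖ ≤ C := by
  change ‖(Pi.single (0 : ℚ) a : ℚ → CoeffField p k O) n‖ ≤ C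
  by_cases hn : n = 0
  · subst hn; simpa using ha
  · simpa [hn] using (norm_nonneg a).trans ha

variable (p k O) in
/-- The subring of the series with coefficients in `O`. -/
noncomputable def integers : Subring (GammaImmAnCon p k O) where
  carrier := {x | ∀ n, ‖x.coeff n‖ ≤ 1}
  zero_mem' n := by simp [ImmAnCon.coeff_zero]
  one_mem' n := by
    rw [← map_one (ImmAnCon.const (p := p) (L := CoeffField p k O))]
    exact norm_coeff_const_le (by simp) n
  neg_mem' hx n := by rw [ImmAnCon.coeff_neg, norm_neg]; exact hx n
  add_mem' hx hy := norm_coeff_add_le hx hy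
  mul_mem' hx hy n := by
    simpa using norm_coeff_mul_le zero_le_one zero_le_one hx hy n

end GammaImmAnCon

namespace IsReduction
open GammaImmAnCon

variable {π : O} {σ : O ≃+* O} {x y : GammaImmAnCon p k O}
  {f g : HahnSeries ℚ (IsLocalRing.ResidueField O)}

theorem integral (h : IsReduction x f) : x ∈ integers p k O := fun n => by
  obtain ⟨a, ha, -⟩ := h n
  rw [← ha]; exact CoeffField.norm_coe_le_one a

theorem exists_of_mem (hx : x ∈ integers p k O) :
    ∃ f : HahnSeries ℚ (IsLocalRing.ResidueField O), IsReduction x f := by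
  choose a ha using fun n => (CoeffField.norm_le_one_iff (x.coeff n)).1 (hx n)
  refine ⟨⟨fun n => IsLocalRing.residue O (a n), ?_⟩, fun n => ⟨a n, ha n, rfl⟩⟩
  refine (x.isAnCon.wo (-1)).isPWO.mono fun n hn => ?_
  have h1 : ‖x.coeff n‖ = 1 := by
    by_contra hne
    rw [← ha] at hne
    exact hn ((CoeffField.norm_coe_lt_one_iff (a n)).1
      ((CoeffField.norm_coe_le_one (a n)).lt_of_ne hne))
  change (p : ℝ) ^ (-1 : ℝ) < ‖x.coeff n‖
  rw [h1]
  exact Real.rpow_lt_one_of_one_lt_of_neg IsAnCon.one_lt (by norm_num)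

theorem coeff_eq_zero_iff (h : IsReduction x f) (n : ℚ) : f.coeff n = 0 ↔ ‖x.coeff n‖ < 1 := by
  obtain ⟨a, ha, ha'⟩ := h n
  rw [← ha, ← ha', CoeffField.norm_coe_lt_one_iff]

theorem unique (h : IsReduction x f) (h' : IsReduction x g) : f = g := by
  ext n
  obtain ⟨a, ha, ha'⟩ := h n
  obtain ⟨b, hb, hb'⟩ := h' n
  rw [← ha', ← hb', IsFractionRing.injective O (CoeffField p k O) (ha.trans hb.symm)]

theorem add (h : IsReduction x f) (h' : IsReduction y g) : IsReduction (x + y) (f + g) := by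
  intro n
  obtain ⟨a, ha, ha'⟩ := h n
  obtain ⟨b, hb, hb'⟩ := h' n
  exact ⟨a + b, by rw [map_add, ha, hb, ImmAnCon.coeff_add],
    by rw [map_add, ha', hb', HahnSeries.coeff_add]⟩

theorem neg (h : IsReduction x f) : IsReduction (-x) (-f) := by
  intro n
  obtain ⟨a, ha, ha'⟩ := h n
  exact ⟨-a, by rw [map_neg, ha, ImmAnCon.coeff_neg], by rw [map_neg, ha', HahnSeries.coeff_neg]⟩

theorem sub (h : IsReduction x f) (h' : IsReduction y g) : IsReduction (x - y) (f - g) := by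
  rw [sub_eq_add_neg, sub_eq_add_neg]; exact h.add h'.neg

theorem of_norm_lt_one (h : ∀ n, ‖x.coeff n‖ < 1) : IsReduction x 0 := by
  intro n
  obtain ⟨a, ha⟩ := (CoeffField.norm_le_one_iff (x.coeff n)).1 (h n).le
  refine ⟨a, ha, ?_⟩
  rw [HahnSeries.coeff_zero, ← CoeffField.norm_coe_lt_one_iff (p := p) (k := k), ha]
  exact h n

theorem zero : IsReduction (0 : GammaImmAnCon p k O) 0 :=
  of_norm_lt_one fun n => by simp [ImmAnCon.coeff_zero]

theorem norm_le (hπ : Irreducible π) (h : IsReduction x 0) (n : ℚ) :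
    ‖x.coeff n‖ ≤ ‖algebraMap O (CoeffField p k O) π‖ :=
  CoeffField.norm_le_of_lt_one hπ ((h.coeff_eq_zero_iff n).1 rfl)

theorem immConst_mul (hπ : Irreducible π) (hx : x ∈ integers p k O) :
    IsReduction (immConst p k O π * x) 0 := by
  refine of_norm_lt_one fun n => ?_
  rw [coeff_immConst_mul, norm_mul]
  exact (mul_le_of_le_one_right (norm_nonneg _) (hx n)).trans_lt (CoeffField.norm_lt_one hπ)

theorem const (a : O) :
    IsReduction (immConst p k O a) (HahnSeries.C (IsLocalRing.residue O a)) := by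
  intro n
  change ∃ b : O, _ = (Pi.single (0 : ℚ) (algebraMap O (CoeffField p k O) a) :
    ℚ → CoeffField p k O) n ∧ _ = (HahnSeries.single (0 : ℚ) (IsLocalRing.residue O a)).coeff n
  by_cases hn : n = 0
  · subst hn
    exact ⟨a, by simp, by rw [HahnSeries.coeff_single_same]⟩
  · exact ⟨0, by simp [hn], by rw [HahnSeries.coeff_single_of_ne hn, map_zero]⟩

theorem one : IsReduction (1 : GammaImmAnCon p k O) 1 := by
  simpa using const (p := p) (k := k) (O := O) 1

/-- The infinite convolution splits into the finite sum over pairs of exponents in both residual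
supports and a remainder. Each term of the remainder has a factor of norm at most |π|, so the
remainder reduces to 0. -/
theorem mul (h : IsReduction x f) (h' : IsReduction y g) : IsReduction (x * y) (f * g) := by
  obtain ⟨π, hπ⟩ := IsDiscreteValuationRing.exists_irreducible O
  intro n
  choose a ha ha' using h
  choose b hb hb' using h'
  set S := Finset.antidiagonal f.isPWO_support g.isPWO_support n
  set T := S.image Prod.fst
  have hST : ∀ (M : Type _) [AddCommMonoid M] (F : ℚ → ℚ → M),
      ∑ i ∈ T, F i (n - i) = ∑ ij ∈ S, F ij.1 ij.2 := by
    intro M _ F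
    have hij : ∀ ij ∈ S, n - ij.1 = ij.2 := fun ij hij => by
      rw [← (Finset.mem_antidiagonal.1 hij).2.2]; ring
    rw [Finset.sum_image]
    · exact Finset.sum_congr rfl fun ij h => by rw [hij ij h]
    · intro ij h ij' h' heq
      have h1 : ij.1 = ij'.1 := heq
      exact Prod.ext h1 (by rw [← hij ij h, ← hij ij' h', h1])
  set c : O := ∑ i ∈ T, a i * b (n - i)
  have hc : IsLocalRing.residue O c = (f * g).coeff n := by
    simp only [c, map_sum, map_mul, ha', hb', HahnSeries.coeff_mul]
    exact hST _ fun i j => f.coeff i * g.coeff j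
  have hs := x.isAnCon.summable y.isAnCon n
  have hsum : (x * y).coeff n = algebraMap O (CoeffField p k O) c +
      ∑' i : ((T : Set ℚ)ᶜ : Set ℚ), x.coeff i * y.coeff (n - i) := by
    rw [ImmAnCon.coeff_mul, ← hs.sum_add_tsum_compl (s := T)]
    simp only [c, map_sum, map_mul, ha, hb]
  have hnorm : ‖∑' i : ((T : Set ℚ)ᶜ : Set ℚ), x.coeff i * y.coeff (n - i)‖ ≤
      ‖algebraMap O (CoeffField p k O) π‖ := by
    refine IsUltrametricDist.norm_tsum_le_of_forall_le_of_nonneg (norm_nonneg _) fun i => ?_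
    have hx1 : ∀ i, ‖x.coeff i‖ ≤ 1 := fun i => by rw [← ha]; exact CoeffField.norm_coe_le_one _
    have hy1 : ∀ i, ‖y.coeff i‖ ≤ 1 := fun i => by rw [← hb]; exact CoeffField.norm_coe_le_one _
    rw [norm_mul]
    by_cases hfi : f.coeff i = 0
    · have : ‖x.coeff i‖ < 1 := by
        rw [← ha, CoeffField.norm_coe_lt_one_iff, ha', hfi]
      exact (mul_le_of_le_one_right (norm_nonneg _) (hy1 _)).trans
        (CoeffField.norm_le_of_lt_one hπ this)
    by_cases hgi : g.coeff (n - i) = 0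
    · have : ‖y.coeff (n - i)‖ < 1 := by
        rw [← hb, CoeffField.norm_coe_lt_one_iff, hb', hgi]
      exact (mul_le_of_le_one_left (norm_nonneg _) (hx1 _)).trans
        (CoeffField.norm_le_of_lt_one hπ this)
    refine absurd (Finset.mem_coe.2 (Finset.mem_image.2 ⟨((i : ℚ), n - i), ?_, rfl⟩)) i.2
    exact Finset.mem_antidiagonal.2 ⟨hfi, hgi, by simp⟩
  obtain ⟨d, hd⟩ := (CoeffField.norm_le_one_iff _).1
    (hnorm.trans (CoeffField.norm_lt_one hπ).le)
  refine ⟨c + d, by rw [map_add, hsum, hd], ?_⟩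
  rw [map_add, hc]
  have : IsLocalRing.residue O d = 0 := by
    rw [← CoeffField.norm_coe_lt_one_iff (p := p) (k := k), hd]
    exact hnorm.trans_lt (CoeffField.norm_lt_one hπ)
  rw [this, add_zero]

theorem pow (h : IsReduction x f) (n : ℕ) : IsReduction (x ^ n) (f ^ n) := by
  induction n with
  | zero => simpa using one
  | succ n ih => rw [pow_succ, pow_succ]; exact ih.mul h

theorem sum {ι : Type*} {s : Finset ι} {x : ι → GammaImmAnCon p k O}
    {f : ι → HahnSeries ℚ (IsLocalRing.ResidueField O)} (h : ∀ i ∈ s, IsReduction (x i) (f i)) :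
    IsReduction (∑ i ∈ s, x i) (∑ i ∈ s, f i) := by
  classical
  induction s using Finset.induction_on with
  | empty => simpa using zero
  | insert i s hi ih =>
    rw [Finset.sum_insert hi, Finset.sum_insert hi]
    exact (h i (Finset.mem_insert_self i s)).add
      (ih fun j hj => h j (Finset.mem_insert_of_mem hj))

theorem vanishBelow (h : IsReduction x f) {r : ℝ} (hx : VanishBelow r x.coeff) :
    VanishBelow r f.coeff := fun n hn => by
  rw [h.coeff_eq_zero_iff, hx n hn, norm_zero]; exact one_pos

theorem frobAut (hσ : ∀ a : O, IsLocalRing.residue O (σ a) = IsLocalRing.residue O a ^ p)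
    (h : IsReduction x f) :
    IsReduction (GammaImmAnCon.frobAut σ x) (f ^ p) := by
  have := charP_residueField p k O
  intro n
  obtain ⟨a, ha, ha'⟩ := h (n / p)
  refine ⟨σ a, ?_, ?_⟩
  · rw [← CoeffField.extAut_algebraMap, ha]; rfl
  · rw [hσ, ha', HahnSeries.coeff_pow_char]

theorem frobAut_pow (hσ : ∀ a : O, IsLocalRing.residue O (σ a) = IsLocalRing.residue O a ^ p)
    (h : IsReduction x f) (l : ℕ) :
    IsReduction ((GammaImmAnCon.frobAut σ ^ l) x) (f ^ p ^ l) := by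
  induction l with
  | zero => simpa using h
  | succ l ih =>
    rw [pow_succ', RingAut.mul_apply, pow_succ, pow_mul]
    exact frobAut hσ ih

theorem frobAut_inv (hσ : ∀ a : O, IsLocalRing.residue O (σ a) = IsLocalRing.residue O a ^ p)
    (h : IsReduction x f) :
    ∃ g, IsReduction ((GammaImmAnCon.frobAut σ)⁻¹ x) g ∧ g ^ p = f := by
  obtain ⟨g, hg⟩ := exists_of_mem (x := (GammaImmAnCon.frobAut σ)⁻¹ x) (fun n => by
    rw [norm_coeff_frobAut_inv]; exact h.integral _)
  refine ⟨g, hg, ?_⟩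
  have := frobAut hσ hg
  rw [frobAut_apply_inv] at this
  exact this.unique h

end IsReduction
end

/-! ### An axiomatic setting common to both rings, and π-adic series -/

section
variable (p : ℕ) [Fact p.Prime] (k : Type*) [Field k] [IsAlgClosed k] [CharP k p]
  {O : Type*} [CommRing O] [IsDomain O] [IsDiscreteValuationRing O]
  [Algebra (WittVector p k) O] [Module.Finite (WittVector p k) O] [FaithfulSMul (WittVector p k) O]

/-- The common properties of `Γ^imm_con` and `Γ^alg_con`: a subring of the series with coefficients
in `O`, closed for the `π`-adic topology, stable under the Frobenius and its inverse, saturated, with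
a residue ring `res` whose elements can be lifted without enlarging the exponents and in which
separable additive equations have all their generalized power series solutions. -/
structure FrobeniusLattice (σ : O ≃+* O) (π : O) where
  /-- the subring -/
  ring : Subring (GammaImmAnCon p k O)
  /-- the residue ring -/
  res : Set (HahnSeries ℚ (IsLocalRing.ResidueField O))
  le_integers : ring ≤ GammaImmAnCon.integers p k O
  closed : ∀ x ∈ GammaImmAnCon.integers p k O, (∀ N : ℕ, ∃ z ∈ ring, ∀ n,
    ‖(x - z).coeff n‖ ≤ ‖algebraMap O (CoeffField p k O) π‖ ^ N) → x ∈ ring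
  frob : ∀ x ∈ ring, GammaImmAnCon.frobAut σ x ∈ ring
  frob_inv : ∀ x ∈ ring, (GammaImmAnCon.frobAut σ)⁻¹ x ∈ ring
  const : ∀ a, immConst p k O a ∈ ring
  div : ∀ x ∈ ring, (∀ n, ‖x.coeff n‖ ≤ ‖algebraMap O (CoeffField p k O) π‖) →
    ∃ y ∈ ring, x = immConst p k O π * y
  single_mem : HahnSeries.single (-1) 1 ∈ res
  res_mem : ∀ x ∈ ring, ∀ f, IsReduction x f → f ∈ res
  lift : ∀ f ∈ res, ∃ x ∈ ring, IsReduction x f ∧ ∀ r, VanishBelow r f.coeff → VanishBelow r x.coeff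
  root : ∀ (A : ℕ → HahnSeries ℚ (IsLocalRing.ResidueField O)) (N : ℕ), (∀ n ≤ N, A n ∈ res) →
    A 0 ≠ 0 → ∀ z, HahnSeries.addPoly p A N z ∈ res → z ∈ res

namespace FrobeniusLattice
open GammaImmAnCon

variable {p k} {σ : O ≃+* O} {π : O} (G : FrobeniusLattice p k σ π)
  {x y : GammaImmAnCon p k O}

theorem frob_pow (hx : x ∈ G.ring) (l : ℕ) : (frobAut σ ^ l) x ∈ G.ring := by
  induction l with
  | zero => simpa using hx
  | succ l ih => rw [pow_succ', RingAut.mul_apply]; exact G.frob _ ih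

theorem frob_inv_pow (hx : x ∈ G.ring) (l : ℕ) : ((frobAut σ)⁻¹ ^ l) x ∈ G.ring := by
  induction l with
  | zero => simpa using hx
  | succ l ih => rw [pow_succ', RingAut.mul_apply]; exact G.frob_inv _ ih

theorem const_pow_mul (hx : x ∈ G.ring) (h : ℕ) : immConst p k O π ^ h * x ∈ G.ring :=
  mul_mem (pow_mem (G.const π) h) hx

theorem div_pow (hπ : Irreducible π) (hx : x ∈ G.ring) (h : ℕ)
    (hxn : ∀ n, ‖x.coeff n‖ ≤ ‖algebraMap O (CoeffField p k O) π‖ ^ h) :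
    ∃ y ∈ G.ring, x = immConst p k O π ^ h * y := by
  induction h with
  | zero => exact ⟨x, hx, by simp⟩
  | succ h ih =>
    have q0 := CoeffField.norm_pos (p := p) (k := k) hπ
    have q1 := CoeffField.norm_lt_one (p := p) (k := k) hπ
    obtain ⟨y, hy, rfl⟩ := ih fun n => (hxn n).trans
      (pow_le_pow_of_le_one q0.le q1.le (Nat.le_succ h))
    obtain ⟨z, hz, rfl⟩ := G.div y hy fun n => by
      have := hxn n
      rw [norm_coeff_immConst_pow_mul, pow_succ] at this
      exact le_of_mul_le_mul_left this (pow_pos q0 h)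
    exact ⟨z, hz, by rw [pow_succ, mul_assoc]⟩

/-- A lift of the reduction of `x`, with a quotient by `π` for the difference. -/
theorem exists_eq_lift_add (hπ : Irreducible π) (hx : x ∈ G.ring)
    {f : HahnSeries ℚ (IsLocalRing.ResidueField O)} (hf : IsReduction x f) :
    ∃ t ∈ G.ring, ∃ y ∈ G.ring, x = t + immConst p k O π * y ∧ IsReduction t f ∧
      ∀ r, VanishBelow r f.coeff → VanishBelow r t.coeff := by
  obtain ⟨t, ht, htf, htv⟩ := G.lift f (G.res_mem x hx f hf)
  have h0 : IsReduction (x - t) 0 := by simpa using hf.sub htf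
  obtain ⟨y, hy, hxy⟩ := G.div (x - t) (sub_mem hx ht) (h0.norm_le hπ)
  exact ⟨t, ht, y, hy, by rw [← hxy]; ring, htf, htv⟩

/-- Divisibility by a power of `π` on an initial segment of the exponents. -/
theorem exists_trim (hπ : Irreducible π) (hx : x ∈ G.ring) (h : ℕ) (J : ℝ)
    (hxn : ∀ n : ℚ, (n : ℝ) < J → ‖x.coeff n‖ ≤ ‖algebraMap O (CoeffField p k O) π‖ ^ h) :
    ∃ y ∈ G.ring, VanishBelow J (x - immConst p k O π ^ h * y).coeff := by
  have q0 := CoeffField.norm_pos (p := p) (k := k) hπ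
  have q1 := CoeffField.norm_lt_one (p := p) (k := k) hπ
  induction h with
  | zero => exact ⟨x, hx, by simpa using ImmAnCon.vanishBelow_zero⟩
  | succ h ih =>
    obtain ⟨y, hy, hxy⟩ := ih fun n hn => (hxn n hn).trans
      (pow_le_pow_of_le_one q0.le q1.le (Nat.le_succ h))
    obtain ⟨f, hf⟩ := IsReduction.exists_of_mem (G.le_integers hy)
    obtain ⟨t, ht, z, hz, hyz, -, htv⟩ := G.exists_eq_lift_add hπ hy hf
    refine ⟨z, hz, ?_⟩
    -- Below J the quotient y is still divisible by π, so its reduction vanishes there, and so does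
    -- a lift that does not enlarge the exponents.
    have ht : VanishBelow J t.coeff := htv J fun n hn => by
      rw [hf.coeff_eq_zero_iff]
      have h1 := hxy n hn
      rw [ImmAnCon.coeff_sub, sub_eq_zero] at h1
      have h2 := hxn n hn
      rw [h1, norm_coeff_immConst_pow_mul, pow_succ] at h2
      exact (le_of_mul_le_mul_left h2 (pow_pos q0 h)).trans_lt q1
    have : x - immConst p k O π ^ (h + 1) * z =
        (x - immConst p k O π ^ h * y) + immConst p k O π ^ h * t := by rw [hyz]; ring
    rw [this]
    exact ImmAnCon.vanishBelow_add hxy (vanishBelow_immConst_pow_mul h ht)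

/-- The π-adic topology is separated. Functional equations of infinite sums are checked below modulo
each power of π and concluded with this. -/
theorem eq_zero_of_forall_dvd (hπ : Irreducible π) {h : ℕ} (hh : h ≠ 0)
    (hx : ∀ K : ℕ, ∃ y ∈ G.ring, x = immConst p k O π ^ (h * K) * y) : x = 0 := by
  have q0 := CoeffField.norm_pos (p := p) (k := k) hπ
  have q1 := CoeffField.norm_lt_one (p := p) (k := k) hπ
  ext n
  rw [ImmAnCon.coeff_zero, ← norm_le_zero_iff]
  refine ge_of_tendsto' (tendsto_pow_atTop_nhds_zero_of_lt_one q0.le q1) fun K => ?_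
  obtain ⟨y, hy, hxy⟩ := hx K
  rw [hxy, norm_coeff_immConst_pow_mul]
  refine (mul_le_of_le_one_right (by positivity) (G.le_integers hy n)).trans ?_
  exact pow_le_pow_of_le_one q0.le q1.le (Nat.le_mul_of_pos_left K (Nat.pos_of_ne_zero hh))

theorem norm_coeff_immConst_pow_mul_le (hx : x ∈ G.ring) (h : ℕ) (n : ℚ) :
    ‖(immConst p k O π ^ h * x).coeff n‖ ≤ ‖algebraMap O (CoeffField p k O) π‖ ^ h := by
  rw [norm_coeff_immConst_pow_mul]
  exact mul_le_of_le_one_right (by positivity) (G.le_integers hx n)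

theorem summable_coeff (hπ : Irreducible π) {h : ℕ} (hh : h ≠ 0) {x : ℕ → GammaImmAnCon p k O}
    (hx : ∀ j, x j ∈ G.ring) (n : ℚ) :
    Summable fun j => (immConst p k O π ^ (h * j) * x j).coeff n := by
  refine NonarchimedeanAddGroup.summable_of_tendsto_cofinite_zero ?_
  rw [Nat.cofinite_eq_atTop]
  refine squeeze_zero_norm (fun j => G.norm_coeff_immConst_pow_mul_le (hx j) (h * j) n) ?_
  simp only [pow_mul]
  exact tendsto_pow_atTop_nhds_zero_of_lt_one (by positivity)
    (pow_lt_one₀ (norm_nonneg _) (CoeffField.norm_lt_one hπ) hh)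

theorem norm_tsum_coeff_sub_le (hπ : Irreducible π) {h : ℕ} (hh : h ≠ 0)
    {x : ℕ → GammaImmAnCon p k O} (hx : ∀ j, x j ∈ G.ring) (K : ℕ) (n : ℚ) :
    ‖(∑' j, (immConst p k O π ^ (h * j) * x j).coeff n) -
      (∑ j ∈ Finset.range K, immConst p k O π ^ (h * j) * x j).coeff n‖ ≤
      ‖algebraMap O (CoeffField p k O) π‖ ^ (h * K) := by
  rw [ImmAnCon.coeff_sum, ← (G.summable_coeff hπ hh hx n).sum_add_tsum_nat_add K,
    add_sub_cancel_left]
  exact IsUltrametricDist.norm_tsum_le_of_forall_le_of_nonneg (by positivity) fun j =>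
    (G.norm_coeff_immConst_pow_mul_le (hx _) _ n).trans (pow_le_pow_of_le_one (norm_nonneg _)
      (CoeffField.norm_lt_one hπ).le (Nat.mul_le_mul_left h (Nat.le_add_left K j)))

/-- Convergence of `∑ π^(h j) x_j`. -/
theorem exists_coeff_eq_tsum (hπ : Irreducible π) {h : ℕ} (hh : h ≠ 0)
    {x : ℕ → GammaImmAnCon p k O} (hx : ∀ j, x j ∈ G.ring)
    (hneg : ∃ c : ℝ, 0 < c ∧ ∀ᶠ n : ℚ in Filter.atBot,
      ‖∑' j, (immConst p k O π ^ (h * j) * x j).coeff n‖ < (p : ℝ) ^ (c * n)) :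
    ∃ s ∈ G.ring, (∀ n, s.coeff n = ∑' j, (immConst p k O π ^ (h * j) * x j).coeff n) ∧
      ∀ K : ℕ, ∃ y ∈ G.ring, s = ∑ j ∈ Finset.range K, immConst p k O π ^ (h * j) * x j +
        immConst p k O π ^ (h * K) * y := by
  have q0 := CoeffField.norm_pos (p := p) (k := k) hπ
  have q1 := CoeffField.norm_lt_one (p := p) (k := k) hπ
  have hrem := G.norm_tsum_coeff_sub_le hπ hh hx
  have hS1 : ∀ n, ‖∑' j, (immConst p k O π ^ (h * j) * x j).coeff n‖ ≤ 1 := fun n => by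
    simpa [ImmAnCon.coeff_zero] using hrem 0 n
  have hcon : IsAnCon p fun n : ℚ => ∑' j, (immConst p k O π ^ (h * j) * x j).coeff n := by
    refine IsAnCon.of_uniform_limit hS1 hneg fun ε hε => ?_
    obtain ⟨K, hK⟩ := exists_pow_lt_of_lt_one hε (pow_lt_one₀ q0.le q1 hh)
    refine ⟨∑ j ∈ Finset.range K, immConst p k O π ^ (h * j) * x j, fun n => ?_⟩
    exact (hrem K n).trans (by rw [pow_mul]; exact hK.le)
  have hmem : ∀ K, ∑ j ∈ Finset.range K, immConst p k O π ^ (h * j) * x j ∈ G.ring := fun K =>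
    sum_mem fun j _ => G.const_pow_mul (hx j) _
  set s : GammaImmAnCon p k O :=
    ⟨fun n => ∑' j, (immConst p k O π ^ (h * j) * x j).coeff n, hcon⟩
  have hsub : ∀ K n, ‖(s - ∑ j ∈ Finset.range K, immConst p k O π ^ (h * j) * x j).coeff n‖ ≤
      ‖algebraMap O (CoeffField p k O) π‖ ^ (h * K) := fun K n => by
    rw [ImmAnCon.coeff_sub]
    exact hrem K n
  have hsG : s ∈ G.ring := G.closed s hS1 fun N => ⟨_, hmem N, fun n => (hsub N n).trans
    (pow_le_pow_of_le_one q0.le q1.le (Nat.le_mul_of_pos_left N (Nat.pos_of_ne_zero hh)))⟩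
  refine ⟨s, hsG, fun n => rfl, fun K => ?_⟩
  obtain ⟨y, hy, hsy⟩ := G.div_pow hπ (sub_mem hsG (hmem K)) (h * K) (hsub K)
  exact ⟨y, hy, by rw [← hsy]; ring⟩

/-- Convergence of `∑ π^(h j) x_j` when the poles of the `x_j` grow at most linearly. -/
theorem exists_sum (hπ : Irreducible π) {h : ℕ} (hh : h ≠ 0) {x : ℕ → GammaImmAnCon p k O}
    (hx : ∀ j, x j ∈ G.ring) {C : ℝ} (hv : ∀ j : ℕ, VanishBelow (-C * (j + 1)) (x j).coeff) :
    ∃ s ∈ G.ring, ∀ K : ℕ, ∃ y ∈ G.ring,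
      s = ∑ j ∈ Finset.range K, immConst p k O π ^ (h * j) * x j +
        immConst p k O π ^ (h * K) * y ∧
      ∀ r, (∀ j, VanishBelow r (x j).coeff) → VanishBelow r y.coeff := by
  have q0 := CoeffField.norm_pos (p := p) (k := k) hπ
  have q1 := CoeffField.norm_lt_one (p := p) (k := k) hπ
  have p1 : (1 : ℝ) < p := IsAnCon.one_lt
  have p0 : (0 : ℝ) < p := IsAnCon.p_pos
  have hrem := G.norm_tsum_coeff_sub_le hπ hh hx
  set q := ‖algebraMap O (CoeffField p k O) π‖
  set D : ℝ := max C 1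
  have hD : 0 < D := lt_max_of_lt_right one_pos
  replace hv : ∀ j : ℕ, VanishBelow (-D * (j + 1)) (x j).coeff := fun j =>
    (hv j).mono (mul_le_mul_of_nonneg_right (neg_le_neg (le_max_left _ _)) (by positivity))
  obtain ⟨s, hs, hsn, hsK⟩ := G.exists_coeff_eq_tsum hπ hh hx (by
    set e : ℝ := -Real.logb p q
    have he : 0 < e := by
      have := Real.logb_neg p1 q0 q1
      simp only [e]; linarith
    have hqe : ∀ K : ℕ, q ^ K = (p : ℝ) ^ (-e * K) := fun K => by
      rw [Real.rpow_mul p0.le, neg_neg, Real.rpow_logb p0 p1.ne' q0, Real.rpow_natCast]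
    -- At a very negative exponent n the first K ≈ |n| / (2 D) terms vanish, and the rest is
    -- divisible by π^K, so it has norm at most p^(-e K). Rounding K down costs at most another
    -- factor 2 in the exponent once n < -4 D.
    refine ⟨e / (4 * D), by positivity, ?_⟩
    obtain ⟨N, hN⟩ := exists_rat_lt (-4 * D)
    filter_upwards [Filter.eventually_lt_atBot N] with n hn
    have hn : (n : ℝ) < N := by exact_mod_cast hn
    have hnD : (n : ℝ) < -4 * D := hn.trans hN
    set K := ⌊-(n : ℝ) / (2 * D)⌋₊
    have hK1 : (K : ℝ) ≤ -n / (2 * D) :=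
      Nat.floor_le (div_nonneg (by linarith) (by positivity))
    have hK2 : -(n : ℝ) / (2 * D) < K + 1 := Nat.lt_floor_add_one _
    rw [le_div_iff₀ (by positivity)] at hK1
    rw [div_lt_iff₀ (by positivity)] at hK2
    have h0 : (∑ j ∈ Finset.range K, immConst p k O π ^ (h * j) * x j).coeff n = 0 := by
      rw [ImmAnCon.coeff_sum]
      refine Finset.sum_eq_zero fun j hj => ?_
      refine vanishBelow_immConst_pow_mul (h * j) (hv j) n ?_
      have : (j : ℝ) + 1 ≤ K := by exact_mod_cast Finset.mem_range.1 hj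
      nlinarith
    have h1 := hrem K n
    rw [h0, sub_zero] at h1
    refine h1.trans_lt ?_
    refine (pow_le_pow_of_le_one q0.le q1.le
      (Nat.le_mul_of_pos_left K (Nat.pos_of_ne_zero hh))).trans_lt ?_
    rw [hqe]
    refine Real.rpow_lt_rpow_of_exponent_lt p1 ?_
    rw [div_mul_eq_mul_div, lt_div_iff₀ (by positivity)]
    nlinarith)
  refine ⟨s, hs, fun K => ?_⟩
  obtain ⟨y, hy, hsy⟩ := hsK K
  refine ⟨y, hy, hsy, fun r hr => ?_⟩
  refine vanishBelow_of_immConst_pow_mul hπ (h := h * K) ?_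
  rw [show immConst p k O π ^ (h * K) * y = s - ∑ j ∈ Finset.range K,
    immConst p k O π ^ (h * j) * x j by rw [hsy]; ring]
  refine ImmAnCon.vanishBelow_sub (fun n hn => ?_)
    (ImmAnCon.vanishBelow_sum fun j _ => vanishBelow_immConst_pow_mul _ (hr j))
  rw [hsn]
  exact (tsum_congr fun j => vanishBelow_immConst_pow_mul (h * j) (hr j) n hn).trans tsum_zero

end FrobeniusLattice
end

/-! ### Analytic hulls and coboundaries -/

section
variable {p : ℕ} [Fact p.Prime] {k : Type*} [Field k] [IsAlgClosed k] [CharP k p]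
  {O : Type*} [CommRing O] [IsDomain O] [IsDiscreteValuationRing O]
  [Algebra (WittVector p k) O] [Module.Finite (WittVector p k) O] [FaithfulSMul (WittVector p k) O]
  {σ : O ≃+* O} {π : O}

open GammaImmAnCon

/-- The properties that relate `Γ^imm_{an,con}` to `Γ^imm_con` and `Γ^alg_{an,con}` to
`Γ^alg_con`. -/
structure IsAnalyticHull (G : FrobeniusLattice p k σ π) (R : Subring (GammaImmAnCon p k O)) :
    Prop where
  le : G.ring ≤ R
  const_inv : ImmAnCon.const (algebraMap O (CoeffField p k O) π)⁻¹ ∈ R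
  frob : ∀ x ∈ R, frobAut σ x ∈ R
  mem_of_local : ∀ x, (∀ j : ℚ, ∃ y ∈ R, ∀ i < j, x.coeff i = y.coeff i) → x ∈ R
  exists_approx : ∀ x ∈ R, ∃ N : ℕ, ∃ y ∈ G.ring,
    VanishBelow 1 (immConst p k O π ^ N * x - y).coeff

/-- The elements `b - a φ(b)` for `b ∈ R`. -/
noncomputable def coboundaries (σ : O ≃+* O) (R : Subring (GammaImmAnCon p k O))
    (a : GammaImmAnCon p k O) : AddSubgroup (GammaImmAnCon p k O) where
  carrier := {x | ∃ b ∈ R, b - a * frobAut σ b = x}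
  zero_mem' := ⟨0, zero_mem R, by simp⟩
  add_mem' := by
    rintro _ _ ⟨b, hb, rfl⟩ ⟨d, hd, rfl⟩
    exact ⟨b + d, add_mem hb hd, by rw [map_add]; ring⟩
  neg_mem' := by
    rintro _ ⟨b, hb, rfl⟩
    exact ⟨-b, neg_mem hb, by rw [map_neg]; ring⟩

namespace IsAnalyticHull

variable {G : FrobeniusLattice p k σ π} {R : Subring (GammaImmAnCon p k O)}
  {x u : GammaImmAnCon p k O}

theorem frob_pow (hR : IsAnalyticHull G R) (hx : x ∈ R) (l : ℕ) : (frobAut σ ^ l) x ∈ R := by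
  induction l with
  | zero => simpa using hx
  | succ l ih => rw [pow_succ', RingAut.mul_apply]; exact hR.frob _ ih

/-- The equation `b - a φ(b) = u` for `u` with positive exponents. -/
theorem exists_sub_mul_frob_eq (hR : IsAnalyticHull G R) {a : CoeffField p k O} (ha : ImmAnCon.const a ∈ R) (hu : u ∈ R)
    {r : ℝ} (hr : 0 < r) (hur : VanishBelow r u.coeff) :
    ∃ b ∈ R, VanishBelow r b.coeff ∧ b - ImmAnCon.const a * frobAut σ b = u := by
  have p1 : (1 : ℝ) < p := IsAnCon.one_lt
  have p0 : (0 : ℝ) < p := IsAnCon.p_pos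
  have p0' : (0 : ℚ) < p := by exact_mod_cast p0
  -- These are the partial sums of b = u + a φ(u) + a φ(a) φ²(u) + ⋯. Since φ multiplies exponents
  -- by p, the coefficients below p^J r no longer change after step J.
  set S : ℕ → GammaImmAnCon p k O := fun J =>
    Nat.rec 0 (fun _ y => u + ImmAnCon.const a * frobAut σ y) J
  have S0 : S 0 = 0 := rfl
  have S1 : ∀ J, S (J + 1) = u + ImmAnCon.const a * frobAut σ (S J) := fun J => rfl
  clear_value S
  have hSR : ∀ J, S J ∈ R := fun J => by
    induction J with
    | zero => rw [S0]; exact zero_mem R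
    | succ J ih => rw [S1]; exact add_mem hu (mul_mem ha (hR.frob _ ih))
  have hstep : ∀ J, VanishBelow (p ^ J * r) (S (J + 1) - S J).coeff := fun J => by
    induction J with
    | zero => simpa [S1, S0] using hur
    | succ J ih =>
      have : S (J + 1 + 1) - S (J + 1) = ImmAnCon.const a * frobAut σ (S (J + 1) - S J) := by
        rw [map_sub]
        linear_combination S1 (J + 1) - S1 J
      rw [this]
      refine ImmAnCon.vanishBelow_const_mul _ ((vanishBelow_frobAut ih).mono (le_of_eq ?_))
      ring
  have hmono : ∀ J J', J ≤ J' → VanishBelow (p ^ J * r) (S J' - S J).coeff := fun J J' h => by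
    induction J', h using Nat.le_induction with
    | base => rw [sub_self]; exact ImmAnCon.vanishBelow_zero
    | succ J' hJ ih =>
      rw [← sub_add_sub_cancel _ (S J')]
      refine ImmAnCon.vanishBelow_add ((hstep J').mono ?_) ih
      exact mul_le_mul_of_nonneg_right (pow_le_pow_right₀ p1.le hJ) hr.le
  have hex : ∀ n : ℝ, ∃ J : ℕ, n < p ^ J * r := fun n => by
    obtain ⟨J, hJ⟩ := pow_unbounded_of_one_lt (n / r) p1
    exact ⟨J, (div_lt_iff₀ hr).1 hJ⟩
  choose I hI using hex
  set B : ℚ → CoeffField p k O := fun n => (S (I n)).coeff n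
  have hB : ∀ (n : ℚ) (J : ℕ), (n : ℝ) < p ^ J * r → B n = (S J).coeff n := fun n J hn => by
    rcases le_total (I n) J with h | h
    · have := hmono _ _ h n (hI n)
      rw [ImmAnCon.coeff_sub, sub_eq_zero] at this
      exact this.symm
    · have := hmono _ _ h n hn
      rwa [ImmAnCon.coeff_sub, sub_eq_zero] at this
  have hrec : ∀ n : ℚ, B n = u.coeff n + a * CoeffField.extAut σ (B (n / p)) := fun n => by
    obtain ⟨J, hJ⟩ : ∃ J : ℕ, (n : ℝ) / p < p ^ J * r := ⟨_, hI _⟩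
    have h1 : (n : ℝ) < p ^ (J + 1) * r := by
      rw [div_lt_iff₀ p0] at hJ; rw [pow_succ]; linarith
    rw [hB n _ h1, hB (n / p) J (by push_cast; exact hJ), S1, ImmAnCon.coeff_add,
      ImmAnCon.coeff_const_mul]
    rfl
  have hB0 : ∀ n : ℚ, (n : ℝ) < r → B n = 0 := fun n hn => by
    rw [hB n 0 (by simpa using hn), S0]; rfl
  have hnorm : ∀ (n : ℚ) (C : ℝ), ‖u.coeff n‖ ≤ C → ‖a‖ * ‖B (n / p)‖ ≤ C → ‖B n‖ ≤ C := by
    intro n C h1 h2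
    rw [hrec n]
    refine (IsUltrametricDist.norm_add_le_max _ _).trans (max_le h1 ?_)
    rwa [norm_mul, CoeffField.norm_extAut]
  have hcon : IsAnCon p B := by
    refine ⟨fun t => IsAnCon.isWF_of_Iic fun j => ?_, fun j => ?_, ⟨1, one_pos, ?_⟩,
      fun e he => ?_⟩
    · refine ((S (I j)).isAnCon.wo t).mono ?_
      rintro n ⟨hn, hnj⟩
      have hnj : (n : ℝ) ≤ j := by exact_mod_cast hnj
      have hn : (p : ℝ) ^ t < ‖B n‖ := hn
      rwa [hB n _ (hnj.trans_lt (hI j))] at hn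
    · obtain ⟨C, hC⟩ := (S (I j)).isAnCon.bdd j
      refine ⟨C, fun n hn => ?_⟩
      have hnj : (n : ℝ) < j := by exact_mod_cast hn
      rw [hB n _ (hnj.trans (hI j))]
      exact hC n hn
    · filter_upwards [Filter.eventually_lt_atBot 0] with n hn
      have : (n : ℝ) < 0 := by exact_mod_cast hn
      rw [hB0 n (this.trans hr), norm_zero]
      exact Real.rpow_pos_of_pos p0 _
    · obtain ⟨c, hc, hbd⟩ := u.isAnCon.bound
      set d := min c (e / 2)
      have hd : 0 < d := lt_min hc (by linarith)
      obtain ⟨C, hC, hCu⟩ := hbd d hd (min_le_left _ _)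
      -- Each use of the recursion multiplies by a but passes from n / p to n. For large n the gain
      -- p^(d n (1 - 1/p)) in the weight absorbs the factor ‖a‖.
      have hd' : 0 < d * (1 - 1 / p) := mul_pos hd (by
        rw [sub_pos, div_lt_one p0]; exact p1)
      obtain ⟨n₁, hn₁⟩ := Filter.eventually_atTop.1 (IsAnCon.eventually_lt_rpow (p := p) ‖a‖ hd')
      set n₂ : ℚ := max n₁ 1
      have hn₂ : 0 < n₂ := lt_max_of_lt_right one_pos
      obtain ⟨C₁, hC₁⟩ := (S (I n₂)).isAnCon.bdd n₂
      set C' := max C C₁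
      have hC' : 0 < C' := lt_max_of_lt_left hC
      have hw : ∀ n : ℚ, (0 : ℝ) < (p : ℝ) ^ (d * n) := fun n => Real.rpow_pos_of_pos p0 _
      have hbase : ∀ n < n₂, ‖B n‖ ≤ C' * (p : ℝ) ^ (d * n) := fun n hn => by
        by_cases h0 : (n : ℝ) < 0
        · rw [hB0 n (h0.trans hr), norm_zero]
          exact (mul_pos hC' (hw n)).le
        · have hnn : (n : ℝ) < n₂ := by exact_mod_cast hn
          rw [hB n _ (hnn.trans (hI n₂))]
          refine ((hC₁ n hn).trans (le_max_right C C₁)).trans ?_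
          refine le_mul_of_one_le_right hC'.le (Real.one_le_rpow p1.le ?_)
          exact mul_nonneg hd.le (not_lt.1 h0)
      -- The bound is propagated from the initial segment below n₂ by enlarging the segment by the
      -- factor p at each step.
      have hall : ∀ J : ℕ, ∀ n : ℚ, n < p ^ J * n₂ → ‖B n‖ ≤ C' * (p : ℝ) ^ (d * n) := by
        intro J
        induction J with
        | zero => intro n hn; exact hbase n (by simpa using hn)
        | succ J ih =>
          intro n hn
          by_cases hnn : n < n₂
          · exact hbase n hnn
          refine hnorm n _ ((hCu n).trans
            (mul_le_mul_of_nonneg_right (le_max_left _ _) (hw n).le)) ?_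
          have h1 := ih (n / p) (by
            rw [div_lt_iff₀ p0']; rw [pow_succ] at hn; linarith)
          have h2 := hn₁ n ((le_max_left _ _).trans (not_lt.1 hnn))
          calc ‖a‖ * ‖B (n / p)‖ ≤ (p : ℝ) ^ (d * (1 - 1 / p) * n) *
                (C' * (p : ℝ) ^ (d * ((n / p : ℚ) : ℝ))) :=
                mul_le_mul h2.le h1 (norm_nonneg _) (Real.rpow_pos_of_pos p0 _).le
            _ = C' * (p : ℝ) ^ (d * n) := by
                rw [mul_left_comm, ← Real.rpow_add p0]
                congr 2; push_cast; field_simp; ring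
      filter_upwards [IsAnCon.eventually_lt_rpow (p := p) C' (half_pos he),
        Filter.eventually_ge_atTop 0] with n hn hn0
      have hn0 : (0 : ℝ) ≤ n := by exact_mod_cast hn0
      have h1 : ‖B n‖ ≤ C' * (p : ℝ) ^ (d * n) := by
        obtain ⟨J, hJ⟩ := pow_unbounded_of_one_lt (n / n₂) (show (1 : ℚ) < p by exact_mod_cast p1)
        exact hall J n ((div_lt_iff₀ hn₂).1 hJ)
      refine h1.trans_lt ?_
      calc C' * (p : ℝ) ^ (d * n) < (p : ℝ) ^ (e / 2 * n) * (p : ℝ) ^ (d * n) :=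
            mul_lt_mul_of_pos_right hn (hw n)
        _ = (p : ℝ) ^ ((e / 2 + d) * n) := by rw [← Real.rpow_add p0, add_mul]
        _ ≤ (p : ℝ) ^ (e * n) := Real.rpow_le_rpow_of_exponent_le p1.le
            (mul_le_mul_of_nonneg_right (by linarith [min_le_right c (e / 2)]) hn0)
  refine ⟨⟨B, hcon⟩, hR.mem_of_local _ fun j => ⟨S (I j), hSR _, fun i hi => ?_⟩, hB0, ?_⟩
  · have hi : (i : ℝ) < j := by exact_mod_cast hi
    exact hB i _ (hi.trans (hI j))
  · ext n
    rw [ImmAnCon.coeff_sub, ImmAnCon.coeff_const_mul]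
    change B n - a * CoeffField.extAut σ (B (n / p)) = _
    rw [hrec n, add_sub_cancel_right]

theorem immConst_mem (hR : IsAnalyticHull G R) (a : O) : immConst p k O a ∈ R := hR.le (G.const a)

theorem mem_coboundaries_of_pos (hR : IsAnalyticHull G R) {a : O} (hu : u ∈ R) {r : ℝ} (hr : 0 < r)
    (hur : VanishBelow r u.coeff) : u ∈ coboundaries σ R (immConst p k O a) := by
  obtain ⟨b, hb, -, h⟩ := hR.exists_sub_mul_frob_eq (hR.immConst_mem a) hu hr hur
  exact ⟨b, hb, h⟩

end IsAnalyticHull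
end

/-! ### Indexing of the terms of the obstruction and the convexity inequality -/

/-- The residue `μ - n` modulo `μ + 1`. -/
def reflectMod (μ n : ℕ) : ℕ := μ - n % (μ + 1)

/-- The exponent `l` with `reflectMod μ n + (μ + 1) l = μ (n + 1)`. -/
def frobExponent (μ n : ℕ) : ℕ := μ * (n / (μ + 1)) + n % (μ + 1)

theorem reflectMod_lt (μ n : ℕ) : reflectMod μ n < μ + 1 :=
  Nat.lt_succ_of_le (Nat.sub_le _ _)

theorem reflectMod_add_mul_frobExponent (μ n : ℕ) :
    reflectMod μ n + (μ + 1) * frobExponent μ n = μ * (n + 1) := by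
  have h1 : n % (μ + 1) ≤ μ := Nat.lt_succ_iff.1 (Nat.mod_lt n (Nat.succ_pos μ))
  have h2 := Nat.div_add_mod n (μ + 1)
  rw [reflectMod, frobExponent]
  zify [h1] at h2 ⊢
  linear_combination (μ : ℤ) * h2

theorem reflectMod_mul_add (μ j r : ℕ) (hr : r < μ + 1) :
    reflectMod μ ((μ + 1) * j + r) = μ - r := by
  rw [reflectMod, Nat.mul_add_mod, Nat.mod_eq_of_lt hr]

theorem frobExponent_mul_add (μ j r : ℕ) (hr : r < μ + 1) :
    frobExponent μ ((μ + 1) * j + r) = μ * j + r := by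
  rw [frobExponent, Nat.mul_add_mod, Nat.mod_eq_of_lt hr, Nat.mul_add_div (Nat.succ_pos μ),
    Nat.div_eq_of_lt hr, add_zero]

theorem sum_range_mul_eq_sum_sum {M : Type*} [AddCommMonoid M] (f : ℕ → M) (m J : ℕ) :
    ∑ n ∈ Finset.range (m * J), f n = ∑ j ∈ Finset.range J, ∑ r ∈ Finset.range m, f (m * j + r) := by
  induction J with
  | zero => simp
  | succ J ih => rw [Finset.sum_range_succ, mul_add, mul_one, Finset.sum_range_add, ih]

section
variable {θ : ℝ} {μ : ℕ}

/-- Strict concavity of u ↦ u^(μ/(μ+1)). With p = θ^(μ+1), the right side is the tangent at u =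
p^((μ+1) s), evaluated at u = p^n. This makes the multiples of μ + 1 vertices of the Newton polygon.
-/
theorem pow_lt_weight (hθ : 1 < θ) (hμ : μ ≠ 0) {n s : ℕ} (hn : n ≠ (μ + 1) * s) :
    θ ^ (μ * n) < (θ ^ (μ + 1)) ^ (μ * s) / (μ + 1) +
      μ / (μ + 1) / (θ ^ (μ + 1)) ^ s * (θ ^ (μ + 1)) ^ n := by
  have θ0 : 0 < θ := zero_lt_one.trans hθ
  have hμ' : (0 : ℝ) < μ := by exact_mod_cast Nat.pos_of_ne_zero hμ
  set k := (μ + 1) * s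
  -- After division by θ^(μ n) the claim becomes 1 < (v^μ + μ v⁻¹) / (μ + 1). This is Bernoulli's
  -- inequality for v^(μ+1), strict because v ≠ 1.
  set v : ℝ := θ ^ k / θ ^ n
  have hv : 0 < v := by positivity
  have hv1 : v ≠ 1 := fun h => by
    rw [div_eq_one_iff_eq (by positivity)] at h
    exact hn (pow_right_injective₀ θ0 hθ.ne' h).symm
  have h := one_add_mul_self_lt_rpow_one_add (s := v - 1) (by linarith) (sub_ne_zero.2 hv1)
    (p := μ + 1) (by linarith)
  have h' : 1 + (μ + 1) * (v - 1) < v ^ (μ + 1) := by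
    have h2 : (1 + (v - 1)) ^ ((μ : ℝ) + 1) = v ^ (μ + 1) := by
      rw [add_sub_cancel, ← Real.rpow_natCast]; push_cast; rfl
    rwa [h2] at h
  have e1 : (θ ^ (μ + 1)) ^ (μ * s) = θ ^ (μ * n) * v ^ μ := by
    simp only [v, div_pow, ← pow_mul, k]
    rw [mul_comm n μ, mul_div_cancel₀ _ (by positivity)]
    congr 1; ring
  have e2 : (θ ^ (μ + 1)) ^ n = θ ^ (μ * n) * v⁻¹ * (θ ^ (μ + 1)) ^ s := by
    simp only [v, ← pow_mul, inv_div, k]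
    field_simp
    ring
  rw [e1, e2]
  have h3 : (1 + (μ + 1) * (v - 1)) / v < v ^ μ := by
    rw [div_lt_iff₀ hv, ← pow_succ]; exact h'
  have h4 : (1 : ℝ) < (v ^ μ + μ * v⁻¹) / (μ + 1) := by
    rw [lt_div_iff₀ (by positivity)]
    have : (1 + (μ + 1) * (v - 1)) / v = μ + 1 - μ * v⁻¹ := by field_simp; ring
    linarith
  have h5 : θ ^ (μ * n) * v ^ μ / (μ + 1) + μ / (μ + 1) / (θ ^ (μ + 1)) ^ s *
      (θ ^ (μ * n) * v⁻¹ * (θ ^ (μ + 1)) ^ s) = θ ^ (μ * n) * ((v ^ μ + μ * v⁻¹) / (μ + 1)) := by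
    field_simp
  rw [h5]
  exact lt_mul_of_one_lt_right (by positivity) h4

theorem pow_eq_weight (hθ : 1 < θ) (s : ℕ) :
    θ ^ (μ * ((μ + 1) * s)) = (θ ^ (μ + 1)) ^ (μ * s) / (μ + 1) +
      μ / (μ + 1) / (θ ^ (μ + 1)) ^ s * (θ ^ (μ + 1)) ^ ((μ + 1) * s) := by
  have θ0 : 0 < θ := zero_lt_one.trans hθ
  have h1 : (θ ^ (μ + 1)) ^ ((μ + 1) * s) = (θ ^ (μ + 1)) ^ s * (θ ^ (μ + 1)) ^ (μ * s) := by
    rw [← pow_add]; congr 1; ring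
  have h2 : θ ^ (μ * ((μ + 1) * s)) = (θ ^ (μ + 1)) ^ (μ * s) := by
    rw [← pow_mul]; congr 1; ring
  rw [h1, h2]
  field_simp
  ring

theorem pow_le_weight (hθ : 1 < θ) (hμ : μ ≠ 0) (n s : ℕ) :
    θ ^ (μ * n) ≤ (θ ^ (μ + 1)) ^ (μ * s) / (μ + 1) +
      μ / (μ + 1) / (θ ^ (μ + 1)) ^ s * (θ ^ (μ + 1)) ^ n := by
  rcases eq_or_ne n ((μ + 1) * s) with rfl | hn
  · exact (pow_eq_weight hθ s).le
  · exact (pow_lt_weight hθ hμ hn).le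

end

/-! ### The obstruction and its reduction to an additive polynomial -/

section
variable {p : ℕ} [Fact p.Prime] {k : Type*} [Field k] [IsAlgClosed k] [CharP k p]
  {O : Type*} [CommRing O] [IsDomain O] [IsDiscreteValuationRing O]
  [Algebra (WittVector p k) O] [Module.Finite (WittVector p k) O] [FaithfulSMul (WittVector p k) O]
  {σ : O ≃+* O} {π : O}

open GammaImmAnCon

/-- The element `∑ π^i c_i`. -/
noncomputable def digitSum (π : O) (μ : ℕ) (c : ℕ → GammaImmAnCon p k O) : GammaImmAnCon p k O :=
  ∑ i ∈ Finset.range (μ + 1), immConst p k O π ^ i * c i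

/-- The obstruction to solve `α - π φ(α) = (∑ π^i c_i) β` for the `β` with
`φ(β) = π^μ β` that is determined by `z` and `d`. -/
noncomputable def obstruction (σ : O ≃+* O) (π : O) (μ J : ℕ) (c : ℕ → GammaImmAnCon p k O)
    (z d : GammaImmAnCon p k O) : GammaImmAnCon p k O :=
  digitSum π μ c * (z + d) + ∑ n ∈ Finset.range ((μ + 1) * J),
    (frobAut σ ^ frobExponent μ n) (c (reflectMod μ n)) * (frobAut σ ^ (n + 1)) z

theorem frobAut_pow_immConst_pow (hπσ : σ π = π) (l s : ℕ) :
    (frobAut σ ^ l) (immConst p k O π ^ s) = immConst p k O π ^ s := by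
  induction l with
  | zero => simp
  | succ l ih => rw [pow_succ', RingAut.mul_apply, ih, map_pow, frobAut_immConst hπσ]

section
variable {μ J : ℕ} {c : ℕ → GammaImmAnCon p k O} {z d z' d' : GammaImmAnCon p k O}

theorem obstruction_add :
    obstruction σ π μ J c (z + z') (d + d') = obstruction σ π μ J c z d +
      obstruction σ π μ J c z' d' := by
  simp only [obstruction, map_add, mul_add, Finset.sum_add_distrib]
  ring

theorem obstruction_immConst_pow_mul (hπσ : σ π = π) (s : ℕ) :
    obstruction σ π μ J c (immConst p k O π ^ s * z) (immConst p k O π ^ s * d) =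
      immConst p k O π ^ s * obstruction σ π μ J c z d := by
  simp only [obstruction, map_mul, frobAut_pow_immConst_pow hπσ, mul_add, Finset.mul_sum,
    mul_left_comm (immConst p k O π ^ s)]

theorem obstruction_zero : obstruction σ π μ J c 0 0 = 0 := by
  simp [obstruction]

theorem obstruction_sum (hπσ : σ π = π) (x y : ℕ → GammaImmAnCon p k O) (K : ℕ) :
    obstruction σ π μ J c (∑ s ∈ Finset.range K, immConst p k O π ^ s * x s)
      (∑ s ∈ Finset.range K, immConst p k O π ^ s * y s) =
    ∑ s ∈ Finset.range K, immConst p k O π ^ s * obstruction σ π μ J c (x s) (y s) := by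
  induction K with
  | zero => simp [obstruction_zero]
  | succ K ih =>
    rw [Finset.sum_range_succ, Finset.sum_range_succ, Finset.sum_range_succ, obstruction_add, ih,
      obstruction_immConst_pow_mul hπσ]

theorem digitSum_mem {G : FrobeniusLattice p k σ π} (hc : ∀ i < μ + 1, c i ∈ G.ring) :
    digitSum π μ c ∈ G.ring :=
  sum_mem fun i hi => G.const_pow_mul (hc i (Finset.mem_range.1 hi)) i

theorem obstruction_mem {G : FrobeniusLattice p k σ π} (hc : ∀ i < μ + 1, c i ∈ G.ring)
    (hz : z ∈ G.ring) (hd : d ∈ G.ring) : obstruction σ π μ J c z d ∈ G.ring :=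
  add_mem (mul_mem (digitSum_mem hc) (add_mem hz hd)) (sum_mem fun n _ =>
    mul_mem (G.frob_pow (hc _ (reflectMod_lt μ n)) _) (G.frob_pow hz _))

theorem vanishBelow_digitSum {A θ : ℝ} (hA : 0 ≤ A) (hθ : 1 ≤ θ)
    (hc : ∀ i < μ + 1, VanishBelow (-A * θ ^ i) (c i).coeff) :
    VanishBelow (-A * θ ^ μ) (digitSum π μ c).coeff :=
  ImmAnCon.vanishBelow_sum fun i hi => vanishBelow_immConst_pow_mul i
    ((hc i (Finset.mem_range.1 hi)).mono (mul_le_mul_of_nonpos_left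
      (pow_le_pow_right₀ hθ (Nat.lt_succ_iff.1 (Finset.mem_range.1 hi))) (neg_nonpos.2 hA)))

/-- The product with φ^N(z) has a pole of order at most A θ^(μ N) - δ p^N, because the indices are
related by i + (μ+1) l = μ N. A line of slope δ and intercept F above all the A θ^(μ N) therefore
bounds every pole by F. -/
theorem vanishBelow_obstruction {A θ δ F : ℝ} (hA : 0 ≤ A) (hθ : 1 ≤ θ) (hθp : θ ^ (μ + 1) = p)
    (hδ : 0 ≤ δ) (hF : A * θ ^ μ ≤ F) (hw : ∀ n : ℕ, A * θ ^ (μ * n) ≤ F + δ * p ^ n)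
    (hc : ∀ i < μ + 1, VanishBelow (-A * θ ^ i) (c i).coeff)
    (hz : VanishBelow δ z.coeff) (hd : VanishBelow 0 d.coeff) :
    VanishBelow (-F) (obstruction σ π μ J c z d).coeff := by
  refine ImmAnCon.vanishBelow_add ?_ (ImmAnCon.vanishBelow_sum fun n _ => ?_)
  · exact (ImmAnCon.vanishBelow_mul (vanishBelow_digitSum hA hθ hc)
      (ImmAnCon.vanishBelow_add (hz.mono hδ) hd)).mono (by linarith)
  · refine (ImmAnCon.vanishBelow_mul
      (vanishBelow_frobAut_pow (hc _ (reflectMod_lt μ n)) (frobExponent μ n))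
      (vanishBelow_frobAut_pow hz (n + 1))).mono ?_
    have h1 : (p : ℝ) ^ frobExponent μ n * θ ^ reflectMod μ n = θ ^ (μ * (n + 1)) := by
      rw [← hθp, ← pow_mul, ← pow_add, add_comm, reflectMod_add_mul_frobExponent]
    have h2 := hw (n + 1)
    calc -F ≤ -(A * θ ^ (μ * (n + 1))) + δ * p ^ (n + 1) := by linarith
      _ = _ := by rw [← h1]; ring

/-- The coefficients of the additive polynomial that is the reduction of the obstruction. -/
noncomputable def obstructionCoeff (p μ : ℕ) {κ : Type*} [Field κ] (a : ℕ → HahnSeries ℚ κ) :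
    ℕ → HahnSeries ℚ κ
  | 0 => a 0
  | n + 1 => a (reflectMod μ n) ^ p ^ frobExponent μ n

/-- Modulo π only the digit 0 of the digit sum and the part z of z + d survive, and φ becomes the
p-th power. So the coefficient of the linear term is the reduction of c 0. -/
theorem isReduction_obstruction (hπ : Irreducible π)
    (hσ : ∀ a : O, IsLocalRing.residue O (σ a) = IsLocalRing.residue O a ^ p)
    {a : ℕ → HahnSeries ℚ (IsLocalRing.ResidueField O)}
    (hc : ∀ i < μ + 1, IsReduction (c i) (a i)) {ζ : HahnSeries ℚ (IsLocalRing.ResidueField O)}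
    (hz : IsReduction z ζ) (hd : IsReduction d 0) :
    IsReduction (obstruction σ π μ J c z d)
      (HahnSeries.addPoly p (obstructionCoeff p μ a) ((μ + 1) * J) ζ) := by
  rw [HahnSeries.addPoly, Finset.sum_range_succ', add_comm, pow_zero, pow_one]
  refine IsReduction.add ?_ (IsReduction.sum fun n _ => ?_)
  · have h1 : IsReduction (digitSum π μ c) (a 0) := by
      rw [digitSum, Finset.sum_range_succ', ← zero_add (a 0), pow_zero, one_mul]
      refine IsReduction.add ?_ (hc 0 (Nat.succ_pos μ))
      rw [← Finset.sum_const_zero (s := Finset.range μ)]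
      refine IsReduction.sum fun i hi => ?_
      rw [pow_succ', mul_assoc]
      refine IsReduction.immConst_mul hπ (mul_mem (pow_mem (IsReduction.const π).integral i)
        (hc _ ?_).integral)
      exact Nat.succ_lt_succ (Finset.mem_range.1 hi)
    simpa [obstructionCoeff] using h1.mul (hz.add hd)
  · exact (IsReduction.frobAut_pow hσ (hc _ (reflectMod_lt μ n)) _).mul
      (IsReduction.frobAut_pow hσ hz _)

end

namespace FrobeniusLattice
variable (G : FrobeniusLattice p k σ π)

/-- The part `∑_{n ≥ 1} π^(μ n) φ^(-n)(z)` of an eigenvector of the Frobenius. -/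
theorem exists_frobAut_eq (hπ : Irreducible π) (hπσ : σ π = π) {μ : ℕ} (hμ : μ ≠ 0)
    {z : GammaImmAnCon p k O} (hz : z ∈ G.ring) (hzv : VanishBelow 0 z.coeff) :
    ∃ d ∈ G.ring, VanishBelow 0 d.coeff ∧ frobAut σ d = immConst p k O π ^ μ * (z + d) := by
  set P := immConst p k O π
  set x : ℕ → GammaImmAnCon p k O := fun j => P ^ μ * ((frobAut σ)⁻¹ ^ (j + 1)) z
  have hx : ∀ j, x j ∈ G.ring := fun j => G.const_pow_mul (G.frob_inv_pow hz _) _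
  have hxv : ∀ j, VanishBelow 0 (x j).coeff := fun j => vanishBelow_immConst_pow_mul _ (by
    simpa using vanishBelow_frobAut_inv_pow hzv (j + 1))
  obtain ⟨d, hd, hdK⟩ := G.exists_sum hπ hμ hx (C := 0) (by simpa using hxv)
  refine ⟨d, hd, ?_, sub_eq_zero.1 (G.eq_zero_of_forall_dvd hπ hμ fun K => ?_)⟩
  · obtain ⟨y, -, hy, hyv⟩ := hdK 0
    have : d = y := by simpa using hy
    rw [this]; exact hyv 0 hxv
  · obtain ⟨y, hy, (hdy : d = ∑ j ∈ Finset.range K, P ^ (μ * j) * x j + P ^ (μ * K) * y), -⟩ :=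
      hdK K
    obtain ⟨y', hy', (hdy' : d = ∑ j ∈ Finset.range (K + 1), P ^ (μ * j) * x j +
      P ^ (μ * (K + 1)) * y'), -⟩ := hdK (K + 1)
    have hP : frobAut σ P = P := frobAut_immConst hπσ
    -- φ shifts the series d by one index. The new first term is π^μ z.
    have h0 : ∀ j, frobAut σ (((frobAut σ)⁻¹ ^ (j + 1)) z) = ((frobAut σ)⁻¹ ^ j) z := fun j => by
      rw [pow_succ', RingAut.mul_apply, frobAut_apply_inv]
    have h1 : frobAut σ (∑ j ∈ Finset.range (K + 1), P ^ (μ * j) * x j) =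
        P ^ μ * (z + ∑ j ∈ Finset.range K, P ^ (μ * j) * x j) := by
      rw [map_sum, Finset.sum_range_succ', add_comm, mul_add, Finset.mul_sum]
      simp only [x, map_mul, map_pow, hP, h0]
      refine congrArg₂ _ (by simp) (Finset.sum_congr rfl fun j _ => ?_)
      ring
    refine ⟨P ^ μ * frobAut σ y' - P ^ μ * y, sub_mem (G.const_pow_mul (G.frob _ hy') _)
      (G.const_pow_mul hy _), ?_⟩
    conv_lhs => enter [1]; rw [hdy', map_add, h1]
    conv_lhs => enter [2]; rw [hdy]
    simp only [map_mul, map_pow, hP]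
    ring

end FrobeniusLattice
end

/-! ### Exact zeros of the obstruction by successive approximation -/

section
variable {p : ℕ} [Fact p.Prime] {k : Type*} [Field k] [IsAlgClosed k] [CharP k p]
  {O : Type*} [CommRing O] [IsDomain O] [IsDiscreteValuationRing O]
  [Algebra (WittVector p k) O] [Module.Finite (WittVector p k) O] [FaithfulSMul (WittVector p k) O]
  {σ : O ≃+* O} {π : O}

open GammaImmAnCon

namespace FrobeniusLattice
variable (G : FrobeniusLattice p k σ π)

/-- φ permutes the norms of the coefficients, and φ(d) is divisible by π^μ with μ ≥ 1. So d does not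
contribute to the reduction. -/
theorem norm_coeff_lt_one_of_frobAut_eq (hπ : Irreducible π) {μ : ℕ} (hμ : μ ≠ 0)
    {z d : GammaImmAnCon p k O} (hz : z ∈ G.ring) (hd : d ∈ G.ring)
    (h : frobAut σ d = immConst p k O π ^ μ * (z + d)) (n : ℚ) : ‖d.coeff n‖ < 1 := by
  have p0 : (p : ℚ) ≠ 0 := by exact_mod_cast (Fact.out : p.Prime).ne_zero
  have h1 := norm_coeff_frobAut (σ := σ) d (n * p)
  rw [mul_div_cancel_right₀ _ p0, h, norm_coeff_immConst_pow_mul] at h1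
  rw [← h1]
  exact (mul_le_of_le_one_right (by positivity) (G.le_integers (add_mem hz hd) _)).trans_lt
    (pow_lt_one₀ (norm_nonneg _) (CoeffField.norm_lt_one hπ) hμ)

/-- Successive approximation for the obstruction. -/
theorem exists_obstruction_eq_zero_of_step (hπ : Irreducible π) (hπσ : σ π = π) {μ J : ℕ}
    {c : ℕ → GammaImmAnCon p k O} (hc : ∀ i < μ + 1, c i ∈ G.ring) {δ F : ℝ} (hδ : 0 ≤ δ)
    (Q : GammaImmAnCon p k O → GammaImmAnCon p k O → Prop)
    (hQ : ∀ z d, Q z d ↔ z ∈ G.ring ∧ d ∈ G.ring ∧ VanishBelow δ z.coeff ∧ VanishBelow 0 d.coeff ∧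
      frobAut σ d = immConst p k O π ^ μ * (z + d))
    (hstep : ∀ g ∈ G.ring, VanishBelow F g.coeff → ∃ z d, Q z d ∧ ∃ g' ∈ G.ring,
      VanishBelow F g'.coeff ∧ g - obstruction σ π μ J c z d = immConst p k O π * g')
    {z₀ d₀ g₀ : GammaImmAnCon p k O} (h₀ : Q z₀ d₀) (hg₀ : g₀ ∈ G.ring)
    (hgv : VanishBelow F g₀.coeff)
    (hzg : obstruction σ π μ J c z₀ d₀ = -(immConst p k O π * g₀)) :
    ∃ z d, Q z d ∧ obstruction σ π μ J c z d = 0 ∧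
      ∃ y ∈ G.ring, z = z₀ + immConst p k O π * y := by
  set P := immConst p k O π
  choose! fz fd hfQ fg hfg hfv hf using hstep
  -- `g n` is minus the obstruction of the n-th approximation divided by π^(n+1). The next pair,
  -- scaled by π^(n+1), corrects it. This works because the obstruction is additive and commutes
  -- with multiplication by π.
  set g : ℕ → GammaImmAnCon p k O := fun n => fg^[n] g₀
  have hg : ∀ n, g n ∈ G.ring ∧ VanishBelow F (g n).coeff := fun n => by
    induction n with
    | zero => exact ⟨hg₀, hgv⟩
    | succ n ih =>
      simp only [g, Function.iterate_succ_apply']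
      exact ⟨hfg _ ih.1 ih.2, hfv _ ih.1 ih.2⟩
  have hgs : ∀ n, g (n + 1) = fg (g n) := fun n => Function.iterate_succ_apply' _ _ _
  set Z : ℕ → GammaImmAnCon p k O := fun n => Nat.casesOn n z₀ fun n => fz (g n)
  set D : ℕ → GammaImmAnCon p k O := fun n => Nat.casesOn n d₀ fun n => fd (g n)
  have hZD : ∀ n, Q (Z n) (D n) := fun n => by
    cases n with
    | zero => exact h₀
    | succ n => exact hfQ _ (hg n).1 (hg n).2
  have hE : ∀ K, ∑ s ∈ Finset.range (K + 1), P ^ s * obstruction σ π μ J c (Z s) (D s) =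
      -(P ^ (K + 1) * g K) := fun K => by
    induction K with
    | zero =>
      rw [zero_add, Finset.sum_range_one, pow_zero, one_mul, pow_one]
      exact hzg
    | succ K ih =>
      have h1 := hf _ (hg K).1 (hg K).2
      rw [Finset.sum_range_succ, ih, hgs]
      change _ + P ^ (K + 1) * obstruction σ π μ J c (fz (g K)) (fd (g K)) = _
      linear_combination (-P ^ (K + 1)) * h1
  have hZ : ∀ n, Z n ∈ G.ring := fun n => ((hQ _ _).1 (hZD n)).1
  have hD : ∀ n, D n ∈ G.ring := fun n => ((hQ _ _).1 (hZD n)).2.1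
  have hZv : ∀ n, VanishBelow δ (Z n).coeff := fun n => ((hQ _ _).1 (hZD n)).2.2.1
  have hDv : ∀ n, VanishBelow 0 (D n).coeff := fun n => ((hQ _ _).1 (hZD n)).2.2.2.1
  have hF : ∀ n, frobAut σ (D n) = P ^ μ * (Z n + D n) := fun n =>
    ((hQ _ _).1 (hZD n)).2.2.2.2
  obtain ⟨z, hz, hzK⟩ := G.exists_sum hπ one_ne_zero hZ (C := 0)
    (by simpa using fun j => (hZv j).mono hδ)
  obtain ⟨d, hd, hdK⟩ := G.exists_sum hπ one_ne_zero hD (C := 0) (by simpa using hDv)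
  simp only [one_mul] at hzK hdK
  have hP : frobAut σ P = P := frobAut_immConst hπσ
  have hzv : VanishBelow δ z.coeff := by
    obtain ⟨y, -, hy, hyv⟩ := hzK 0
    have : z = y := by simpa using hy
    rw [this]; exact hyv δ hZv
  have hdv : VanishBelow 0 d.coeff := by
    obtain ⟨y, -, hy, hyv⟩ := hdK 0
    have : d = y := by simpa using hy
    rw [this]; exact hyv 0 hDv
  have hfrob : frobAut σ d = P ^ μ * (z + d) := by
    refine sub_eq_zero.1 (G.eq_zero_of_forall_dvd hπ one_ne_zero fun K => ?_)
    obtain ⟨y, hy, hzy, -⟩ := hzK K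
    obtain ⟨y', hy', hdy, -⟩ := hdK K
    refine ⟨frobAut σ y' - P ^ μ * (y + y'),
      sub_mem (G.frob _ hy') (G.const_pow_mul (add_mem hy hy') μ), ?_⟩
    have h1 : frobAut σ (∑ s ∈ Finset.range K, P ^ s * D s) =
        P ^ μ * (∑ s ∈ Finset.range K, P ^ s * Z s + ∑ s ∈ Finset.range K, P ^ s * D s) := by
      rw [map_sum, ← Finset.sum_add_distrib, Finset.mul_sum]
      refine Finset.sum_congr rfl fun s _ => ?_
      rw [map_mul, map_pow, hP, hF]
      ring
    rw [hzy, hdy, map_add, h1, map_mul, map_pow, hP, one_mul]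
    ring
  refine ⟨z, d, (hQ _ _).2 ⟨hz, hd, hzv, hdv, hfrob⟩,
    G.eq_zero_of_forall_dvd hπ one_ne_zero fun K => ?_, ?_⟩
  · cases K with
    | zero => exact ⟨_, obstruction_mem (J := J) hc hz hd, by simp⟩
    | succ K =>
      obtain ⟨y, hy, hzy, -⟩ := hzK (K + 1)
      obtain ⟨y', hy', hdy, -⟩ := hdK (K + 1)
      refine ⟨-g K + obstruction σ π μ J c y y',
        add_mem (neg_mem (hg K).1) (obstruction_mem hc hy hy'), ?_⟩
      rw [hzy, hdy, obstruction_add, obstruction_sum hπσ, obstruction_immConst_pow_mul hπσ, hE]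
      ring
  · obtain ⟨y, hy, hzy, -⟩ := hzK 1
    rw [Finset.sum_range_one, pow_zero, one_mul, pow_one] at hzy
    exact ⟨y, hy, hzy⟩

/-- Solutions of the equation `obstruction = 0`. -/
theorem exists_obstruction_eq_zero (hπ : Irreducible π) (hπσ : σ π = π)
    (hσ : ∀ a : O, IsLocalRing.residue O (σ a) = IsLocalRing.residue O a ^ p) {μ J : ℕ}
    (hμ : μ ≠ 0) (hJ : 2 ≤ J) {A θ : ℝ} (hA : 0 < A) (hθ : 1 < θ) (hθp : θ ^ (μ + 1) = p)
    {c : ℕ → GammaImmAnCon p k O} (hc : ∀ i < μ + 1, c i ∈ G.ring)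
    (hv : ∀ i < μ + 1, VanishBelow (-A * θ ^ i) (c i).coeff) {e : ℚ} (he : (e : ℝ) = -A)
    (hce : ‖(c 0).coeff e‖ = 1) :
    ∃ z ∈ G.ring, ∃ d ∈ G.ring, VanishBelow (A * (μ / (μ + 1) / p ^ 2)) z.coeff ∧
      VanishBelow 0 d.coeff ∧ frobAut σ d = immConst p k O π ^ μ * (z + d) ∧
      obstruction σ π μ J c z d = 0 ∧
      ∃ ν : ℚ, (ν : ℝ) < p * (A * (μ / (μ + 1) / p ^ 2)) ∧ ‖z.coeff ν‖ = 1 := by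
  have hcp := charP_residueField p k O
  have hac := isAlgClosed_residueField p k O
  have p0 : (0 : ℝ) < p := IsAnCon.p_pos
  have p2 : (2 : ℝ) ≤ p := by exact_mod_cast (Fact.out : p.Prime).two_le
  have μ0 : (0 : ℝ) < μ := by exact_mod_cast Nat.pos_of_ne_zero hμ
  -- δ and F are the slope and the intercept of A times the tangent of `pow_le_weight` at s = 2, so
  -- p δ is the slope at s = 1.
  set δ : ℝ := A * (μ / (μ + 1) / p ^ 2) with hδdef
  have hδ : 0 < δ := by positivity
  set F : ℝ := A * (p ^ (μ * 2) / (μ + 1)) with hFdef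
  have hw2 : ∀ n : ℕ, A * θ ^ (μ * n) ≤ F + δ * p ^ n := fun n => by
    have h := pow_le_weight hθ hμ n 2
    rw [hθp] at h
    calc _ ≤ _ := mul_le_mul_of_nonneg_left h hA.le
      _ = _ := by simp only [hFdef, hδdef]; ring
  have hF : A * θ ^ μ ≤ F := by
    refine mul_le_mul_of_nonneg_left ?_ hA.le
    rw [le_div_iff₀ (by positivity)]
    have h1 : θ ^ μ ≤ p := by
      rw [← hθp]; exact pow_le_pow_right₀ hθ.le (Nat.le_succ μ)
    have h2 : (μ : ℝ) + 1 ≤ p ^ μ := by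
      have : μ + 1 ≤ 2 ^ μ := Nat.lt_two_pow_self
      calc (μ : ℝ) + 1 ≤ 2 ^ μ := by exact_mod_cast this
        _ ≤ p ^ μ := pow_le_pow_left₀ (by norm_num) p2 μ
    calc θ ^ μ * (μ + 1) ≤ p * p ^ μ := mul_le_mul h1 h2 (by positivity) p0.le
      _ = p ^ (μ + 1) := (pow_succ' _ _).symm
      _ ≤ p ^ (μ * 2) := pow_le_pow_right₀ (by linarith) (by omega)
  have ha : ∀ i, ∃ f, i < μ + 1 → IsReduction (c i) f := fun i => by
    by_cases hi : i < μ + 1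
    · obtain ⟨f, hf⟩ := IsReduction.exists_of_mem (G.le_integers (hc i hi))
      exact ⟨f, fun _ => hf⟩
    · exact ⟨0, fun h => absurd h hi⟩
  choose a ha using ha
  set N := (μ + 1) * J
  set B := obstructionCoeff p μ a
  have haord : ∀ i < μ + 1, a i ≠ 0 → -(A * θ ^ i) ≤ ((a i).order : ℝ) := fun i hi h0 =>
    HahnSeries.le_order_of_vanishBelow h0 ((ha i hi).vanishBelow (by simpa using hv i hi))
  have ha0' : (a 0).coeff e ≠ 0 := fun h => by
    rw [(ha 0 (Nat.succ_pos μ)).coeff_eq_zero_iff, hce] at h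
    exact lt_irrefl _ h
  have ha0 : a 0 ≠ 0 := fun h => ha0' (by rw [h]; rfl)
  have ha0ord : ((a 0).order : ℝ) = -A := by
    refine le_antisymm ?_ (by simpa using haord 0 (Nat.succ_pos μ) ha0)
    rw [← he]
    exact_mod_cast HahnSeries.order_le_of_coeff_ne_zero ha0'
  have hBord : ∀ n, B n ≠ 0 → -(A * θ ^ (μ * n)) ≤ ((B n).order : ℝ) := fun n hn => by
    cases n with
    | zero => simp [B, obstructionCoeff, ha0ord]
    | succ n =>
      have hne : a (reflectMod μ n) ≠ 0 := fun h => hn (by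
        simp only [B, obstructionCoeff, h]
        exact zero_pow (pow_ne_zero _ (Fact.out : p.Prime).ne_zero))
      have h1 := haord _ (reflectMod_lt μ n) hne
      simp only [B, obstructionCoeff, HahnSeries.order_pow, nsmul_eq_mul]
      push_cast
      calc -(A * θ ^ (μ * (n + 1))) = (p : ℝ) ^ frobExponent μ n *
            (-(A * θ ^ reflectMod μ n)) := by
            rw [← reflectMod_add_mul_frobExponent, pow_add, pow_mul, hθp]; ring
        _ ≤ _ := mul_le_mul_of_nonneg_left h1 (by positivity)
  -- At these indices the digit is c 0, whose reduction has order exactly -A, so the bound for the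
  -- order is attained.
  have hBex : ∀ s, B ((μ + 1) * (s + 1)) ≠ 0 ∧
      ((B ((μ + 1) * (s + 1))).order : ℝ) = -(A * θ ^ (μ * ((μ + 1) * (s + 1)))) := fun s => by
    have h1 : (μ + 1) * (s + 1) = (μ + 1) * s + μ + 1 := by ring
    have h2 : B ((μ + 1) * (s + 1)) = a 0 ^ p ^ (μ * s + μ) := by
      rw [h1]
      change a _ ^ p ^ _ = _
      rw [reflectMod_mul_add _ _ _ (Nat.lt_succ_self μ),
        frobExponent_mul_add _ _ _ (Nat.lt_succ_self μ), Nat.sub_self]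
    rw [h2]
    refine ⟨pow_ne_zero _ ha0, ?_⟩
    rw [HahnSeries.order_pow, nsmul_eq_mul]
    push_cast
    rw [ha0ord, ← hθp, ← pow_mul]
    have : (μ + 1) * (μ * s + μ) = μ * ((μ + 1) * (s + 1)) := by ring
    rw [this]; ring
  have hN : (μ + 1) * (1 + 1) ≤ N := Nat.mul_le_mul_left _ hJ
  have hBres : ∀ n ≤ N, B n ∈ G.res := fun n _ => by
    cases n with
    | zero => exact G.res_mem _ (hc 0 (Nat.succ_pos μ)) _ (ha 0 (Nat.succ_pos μ))
    | succ n =>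
      have h := IsReduction.frobAut_pow hσ (ha _ (reflectMod_lt μ n)) (frobExponent μ n)
      exact G.res_mem _ (G.frob_pow (hc _ (reflectMod_lt μ n)) _) _ h
  have hB0 : B 0 ≠ 0 := ha0
  -- The line of slope δ touches the Newton polygon at the vertex of index 2(μ+1). The bound of
  -- `HahnSeries.exists_addPoly_eq` at that index turns right-hand sides with poles of order at most
  -- F into solutions with exponents at least δ.
  have heq2 : -F = ((B ((μ + 1) * (1 + 1))).order : ℝ) + p ^ ((μ + 1) * (1 + 1)) * δ := by
    have h := pow_eq_weight (μ := μ) hθ (1 + 1)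
    rw [(hBex 1).2, h, hθp]
    simp only [hFdef, hδdef]
    ring
  have hlift : ∀ ζ ∈ G.res, VanishBelow δ ζ.coeff → ∃ z d, (z ∈ G.ring ∧ d ∈ G.ring ∧
      VanishBelow δ z.coeff ∧ VanishBelow 0 d.coeff ∧
      frobAut σ d = immConst p k O π ^ μ * (z + d)) ∧ IsReduction z ζ ∧ IsReduction d 0 := by
    intro ζ hζ hζv
    obtain ⟨z, hz, hzr, hzv⟩ := G.lift ζ hζ
    obtain ⟨d, hd, hdv, hdz⟩ := G.exists_frobAut_eq hπ hπσ hμ hz ((hzv _ hζv).mono hδ.le)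
    exact ⟨z, d, ⟨hz, hd, hzv _ hζv, hdv, hdz⟩, hzr,
      IsReduction.of_norm_lt_one (G.norm_coeff_lt_one_of_frobAut_eq hπ hμ hz hd hdz)⟩
  have hdiv : ∀ g ∈ G.ring, VanishBelow (-F) g.coeff → ∀ z d, (z ∈ G.ring ∧ d ∈ G.ring ∧
      VanishBelow δ z.coeff ∧ VanishBelow 0 d.coeff ∧
      frobAut σ d = immConst p k O π ^ μ * (z + d)) →
      IsReduction (g - obstruction σ π μ J c z d) 0 → ∃ g' ∈ G.ring, VanishBelow (-F) g'.coeff ∧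
        g - obstruction σ π μ J c z d = immConst p k O π * g' := by
    rintro g hg hgv z d ⟨hz, hd, hzv, hdv, -⟩ h0
    obtain ⟨g', hg', hgg⟩ := G.div _ (sub_mem hg (obstruction_mem hc hz hd)) (h0.norm_le hπ)
    refine ⟨g', hg', vanishBelow_of_immConst_pow_mul hπ (h := 1) ?_, hgg⟩
    rw [pow_one, ← hgg]
    exact ImmAnCon.vanishBelow_sub hgv
      (vanishBelow_obstruction hA.le hθ.le hθp hδ.le hF hw2 hv hzv hdv)
  have hstep : ∀ g ∈ G.ring, VanishBelow (-F) g.coeff → ∃ z d, (z ∈ G.ring ∧ d ∈ G.ring ∧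
      VanishBelow δ z.coeff ∧ VanishBelow 0 d.coeff ∧
      frobAut σ d = immConst p k O π ^ μ * (z + d)) ∧ ∃ g' ∈ G.ring, VanishBelow (-F) g'.coeff ∧
        g - obstruction σ π μ J c z d = immConst p k O π * g' := by
    intro g hg hgv
    obtain ⟨f, hf⟩ := IsReduction.exists_of_mem (G.le_integers hg)
    obtain ⟨ζ, hζ, hζv⟩ := HahnSeries.exists_addPoly_eq (p := p) ⟨_, hN, (hBex 1).1⟩ f
    -- The solution is found among all generalized power series. It lies in the residue ring because
    -- the coefficient of the linear term is not zero.
    have hζres : ζ ∈ G.res := G.root B N hBres hB0 ζ (by rw [hζ]; exact G.res_mem _ hg _ hf)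
    obtain ⟨z, d, hzd, hzr, hdr⟩ := hlift ζ hζres
      (hζv _ hN (hBex 1).1 δ (heq2 ▸ hf.vanishBelow hgv))
    refine ⟨z, d, hzd, hdiv g hg hgv z d hzd ?_⟩
    have := hf.sub (isReduction_obstruction (J := J) hπ hσ ha hzr hdr)
    rwa [show HahnSeries.addPoly p (obstructionCoeff p μ a) ((μ + 1) * J) ζ = f from hζ,
      sub_self] at this
  have heq1 : ((B ((μ + 1) * (0 + 1))).order : ℝ) + p ^ ((μ + 1) * (0 + 1)) * (p * δ) =
      -(A * (p ^ (μ * 1) / (μ + 1))) := by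
    have h := pow_eq_weight (μ := μ) hθ (0 + 1)
    rw [(hBex 0).2, h, hθp]
    simp only [hδdef]
    field_simp
    ring
  have hδ1 : p * δ = A * (μ / (μ + 1) / p ^ 1) := by
    simp only [hδdef]; field_simp
  -- The edge starts at the vertex of index μ + 1. Comparison with the vertex of index 2(μ+1) gives
  -- an order at least δ, and the tangent at the first vertex gives an order less than p δ.
  obtain ⟨ζ, hζ0, hζ, hζ1, hζ2⟩ := HahnSeries.exists_addPoly_eq_zero (p := p) (A := B) (N := N)
    (a := (μ + 1) * (0 + 1)) (b := (μ + 1) * (1 + 1)) (r₀ := δ) (r₁ := p * δ)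
    (Nat.mul_lt_mul_of_pos_left (by norm_num) (Nat.succ_pos μ)) hN (hBex 0).1 (hBex 1).1
    (by
      rw [← heq2]
      have h1 := hw2 ((μ + 1) * (0 + 1))
      have h2 := hBord _ (hBex 0).1
      linarith)
    (fun n _ hn h0 => by
      rw [heq1]
      have h1 := pow_le_weight hθ hμ n 1
      rw [hθp] at h1
      have h2 := hBord _ h0
      have h3 := mul_le_mul_of_nonneg_left h1 hA.le
      rw [hδ1]
      linarith)
    (fun n _ hn h0 => by
      rw [heq1]
      have h1 := pow_lt_weight hθ hμ (n := n) (s := 1) (by omega)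
      rw [hθp] at h1
      have h2 := hBord _ h0
      have h3 := mul_lt_mul_of_pos_left h1 hA
      rw [hδ1]
      linarith)
  have h0res : (0 : HahnSeries ℚ (IsLocalRing.ResidueField O)) ∈ G.res :=
    G.res_mem 0 (zero_mem _) 0 IsReduction.zero
  obtain ⟨z₀, d₀, hzd, hzr, hdr⟩ := hlift ζ (G.root B N hBres hB0 ζ (by rw [hζ]; exact h0res))
    ((HahnSeries.vanishBelow_order ζ).mono hζ1)
  obtain ⟨g₀, hg₀, hg₀v, hg₀e⟩ := hdiv 0 (zero_mem _) ImmAnCon.vanishBelow_zero z₀ d₀ hzd (by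
    have := IsReduction.zero.sub (isReduction_obstruction (J := J) hπ hσ ha hzr hdr)
    rwa [show HahnSeries.addPoly p (obstructionCoeff p μ a) ((μ + 1) * J) ζ = 0 from hζ,
      sub_self] at this)
  obtain ⟨z, d, ⟨hz, hd, hzv, hdv, hzdf⟩, hE, y, hy, hzy⟩ :=
    G.exists_obstruction_eq_zero_of_step hπ hπσ hc hδ.le _ (fun _ _ => Iff.rfl) hstep hzd hg₀ hg₀v
      (by rw [← hg₀e]; ring)
  refine ⟨z, hz, d, hd, hzv, hdv, hzdf, hE, ζ.order, hζ2, ?_⟩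
  -- All corrections after the first approximation are divisible by π, so ζ remains the reduction
  -- and its leading coefficient gives a unit coefficient of z.
  have hzr' : IsReduction z ζ := by
    rw [hzy, ← add_zero ζ]
    exact hzr.add (IsReduction.immConst_mul hπ (G.le_integers hy))
  refine le_antisymm (hzr'.integral _) (not_lt.1 fun h => ?_)
  rw [← hzr'.coeff_eq_zero_iff] at h
  exact hζ0 (HahnSeries.coeff_order_eq_zero.1 h)

end FrobeniusLattice
end

/-! ### From a zero of the obstruction to an eigenvector -/

section
variable {p : ℕ} [Fact p.Prime] {k : Type*} [Field k] [IsAlgClosed k] [CharP k p]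
  {O : Type*} [CommRing O] [IsDomain O] [IsDiscreteValuationRing O]
  [Algebra (WittVector p k) O] [Module.Finite (WittVector p k) O] [FaithfulSMul (WittVector p k) O]
  {σ : O ≃+* O} {π : O}

open GammaImmAnCon

/-- There is an eigenvector `α v + β w` with eigenvalue `π^μ`, where `F v = π^(μ + 1) v` and
`F w = w + c v`. -/
def HasEigenvector (σ : O ≃+* O) (π : O) (R : Subring (GammaImmAnCon p k O)) (μ : ℕ)
    (c : GammaImmAnCon p k O) : Prop :=
  ∃ β ∈ R, ∃ α ∈ R, β ≠ 0 ∧ frobAut σ β = immConst p k O π ^ μ * β ∧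
    α - immConst p k O π * frobAut σ α = c * β

variable {G : FrobeniusLattice p k σ π} {R : Subring (GammaImmAnCon p k O)} {μ : ℕ}
  {x y : GammaImmAnCon p k O}

namespace HasEigenvector

/-- As φ(β) = π^μ β, one has (b - π^(μ+1) φ(b)) β = b β - π φ(b β). The same β serves, with α
replaced by b β + α. -/
theorem coboundary_add (hx : x ∈ coboundaries σ R (immConst p k O π ^ (μ + 1)))
    (hy : HasEigenvector σ π R μ y) : HasEigenvector σ π R μ (x + y) := by
  obtain ⟨b, hb, rfl⟩ := hx
  obtain ⟨β, hβ, α, hα, h0, h1, h2⟩ := hy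
  refine ⟨β, hβ, b * β + α, add_mem (mul_mem hb hβ) hα, h0, h1, ?_⟩
  rw [map_add, map_mul, h1]
  linear_combination h2

theorem of_mul (hR : IsAnalyticHull G R) (hπ : Irreducible π) (hπσ : σ π = π)
    (h : HasEigenvector σ π R μ (immConst p k O π * x)) : HasEigenvector σ π R μ x := by
  obtain ⟨β, hβ, α, hα, h0, h1, h2⟩ := h
  have hinv : ImmAnCon.const (algebraMap O (CoeffField p k O) π)⁻¹ * immConst p k O π = 1 := by
    change ImmAnCon.const _ * ImmAnCon.const _ = 1
    rw [← map_mul, inv_mul_cancel₀ (CoeffField.algebraMap_ne_zero hπ), map_one]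
  have hfrob : frobAut σ (ImmAnCon.const (algebraMap O (CoeffField p k O) π)⁻¹) =
      ImmAnCon.const (algebraMap O (CoeffField p k O) π)⁻¹ := by
    rw [frobAut_const, map_inv₀, CoeffField.extAut_algebraMap, hπσ]
  refine ⟨β, hβ, _, mul_mem hR.const_inv hα, h0, h1, ?_⟩
  rw [map_mul, hfrob]
  linear_combination ImmAnCon.const (algebraMap O (CoeffField p k O) π)⁻¹ * h2 + x * β * hinv

theorem of_pow_mul (hR : IsAnalyticHull G R) (hπ : Irreducible π) (hπσ : σ π = π) {N : ℕ}
    (h : HasEigenvector σ π R μ (immConst p k O π ^ N * x)) : HasEigenvector σ π R μ x := by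
  induction N with
  | zero => simpa using h
  | succ N ih =>
    rw [pow_succ', mul_assoc] at h
    exact ih (h.of_mul hR hπ hπσ)

end HasEigenvector

namespace IsAnalyticHull

/-- A telescoping sum. It permits the replacement of each term of c β by one without negative powers
of π. -/
theorem sub_frobAut_pow_mem_coboundaries (hR : IsAnalyticHull G R) (hπσ : σ π = π) (hx : x ∈ R)
    (l : ℕ) : x - immConst p k O π ^ l * (frobAut σ ^ l) x ∈
      coboundaries σ R (immConst p k O π) := by
  induction l generalizing x with
  | zero => simp
  | succ l ih =>
    have h1 : x - immConst p k O π * frobAut σ x ∈ coboundaries σ R (immConst p k O π) :=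
      ⟨x, hx, rfl⟩
    have h2 := ih (mul_mem (hR.immConst_mem π) (hR.frob x hx))
    have h3 := add_mem h1 h2
    have h4 := frobAut_pow_immConst_pow (p := p) (k := k) hπσ l 1
    rw [pow_one] at h4
    rw [map_mul, h4, ← RingAut.mul_apply, ← pow_succ] at h3
    convert! h3 using 1
    ring

/-- For z and d from a zero of the obstruction, let B = ∑_{n ≥ 0} π^(-μ n) φ^n(z). Then B + d is an
eigenvector, and its product with the digit sum differs from the obstruction by coboundaries. -/
theorem hasEigenvector_digitSum (hR : IsAnalyticHull G R) (hπ : Irreducible π) (hπσ : σ π = π)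
    (hσ : ∀ a : O, IsLocalRing.residue O (σ a) = IsLocalRing.residue O a ^ p)
    (hμ : μ ≠ 0) {A θ : ℝ} (hA : 0 < A) (hθ : 1 < θ) (hθp : θ ^ (μ + 1) = p)
    {c : ℕ → GammaImmAnCon p k O} (hc : ∀ i < μ + 1, c i ∈ G.ring)
    (hv : ∀ i < μ + 1, VanishBelow (-A * θ ^ i) (c i).coeff) {e : ℚ} (he : (e : ℝ) = -A)
    (hce : ‖(c 0).coeff e‖ = 1) : HasEigenvector σ π R μ (digitSum π μ c) := by
  have p1 : (1 : ℝ) < p := IsAnCon.one_lt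
  have μ0 : (0 : ℝ) < μ := by exact_mod_cast Nat.pos_of_ne_zero hμ
  set δ : ℝ := A * (μ / (μ + 1) / p ^ 2) with hδdef
  have hδ : 0 < δ := by have := IsAnCon.p_pos (p := p); positivity
  -- J is so large that the exponents of φ^(J+1)(B), at least p^(J+1) δ, outweigh the poles of the
  -- digit sum. The tail then has positive exponents and is a coboundary.
  obtain ⟨J, hJ, hJδ⟩ : ∃ J : ℕ, 2 ≤ J ∧ A * θ ^ μ < p ^ (J + 1) * δ := by
    obtain ⟨J, hJ⟩ := pow_unbounded_of_one_lt (A * θ ^ μ / δ) p1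
    refine ⟨J + 2, by omega, ?_⟩
    rw [div_lt_iff₀ hδ] at hJ
    exact hJ.trans_le (mul_le_mul_of_nonneg_right (pow_le_pow_right₀ p1.le (by omega)) hδ.le)
  obtain ⟨z, hz, d, hd, hzv, hdv, hdz, hE, ν, hν, hzν⟩ :=
    G.exists_obstruction_eq_zero hπ hπσ hσ hμ hJ hA hθ hθp hc hv he hce
  set P := immConst p k O π
  set Q : GammaImmAnCon p k O := ImmAnCon.const (algebraMap O (CoeffField p k O) π)⁻¹ with hQdef
  have hQR : Q ∈ R := hR.const_inv
  have hPR : P ∈ R := hR.immConst_mem π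
  have hQP : Q * P = 1 := by
    change ImmAnCon.const _ * ImmAnCon.const _ = 1
    rw [← map_mul, inv_mul_cancel₀ (CoeffField.algebraMap_ne_zero hπ), map_one]
  have hQPn : ∀ n, Q ^ n * P ^ n = 1 := fun n => by rw [← mul_pow, hQP, one_pow]
  have hφQ : ∀ n, frobAut σ (Q ^ n) = Q ^ n := fun n => by
    rw [map_pow, hQdef, frobAut_const, map_inv₀, CoeffField.extAut_algebraMap, hπσ]
  have hφQl : ∀ l n, (frobAut σ ^ l) (Q ^ n) = Q ^ n := fun l n => by
    induction l with
    | zero => simp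
    | succ l ih => rw [pow_succ', RingAut.mul_apply, ih, hφQ]
  obtain ⟨B, hB, hBv, hBz⟩ := hR.exists_sub_mul_frob_eq
    (a := (algebraMap O (CoeffField p k O) π)⁻¹ ^ μ) (by rw [map_pow]; exact pow_mem hQR μ)
    (hR.le hz) hδ hzv
  -- ν < p δ, while the other terms of B have exponents at least p δ. So B has a unit coefficient at
  -- ν, which d, divisible by π, cannot cancel.
  have hBν : B.coeff ν = z.coeff ν := by
    have h1 := congrArg (fun x => x.coeff ν) hBz
    simp only [ImmAnCon.coeff_sub] at h1
    rw [ImmAnCon.vanishBelow_const_mul _ (vanishBelow_frobAut hBv) ν hν, sub_zero] at h1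
    exact h1
  rw [map_pow] at hBz
  change B - Q ^ μ * frobAut σ B = z at hBz
  have hBJ : ∀ K, B = ∑ j ∈ Finset.range K, Q ^ (μ * j) * (frobAut σ ^ j) z +
      Q ^ (μ * K) * (frobAut σ ^ K) B := fun K => by
    induction K with
    | zero => simp
    | succ K ih =>
      have h1 : (frobAut σ ^ K) B = (frobAut σ ^ K) z + Q ^ μ * (frobAut σ ^ (K + 1)) B := by
        conv_lhs => rw [sub_eq_iff_eq_add.1 hBz]
        rw [map_add, map_mul, hφQl, ← RingAut.mul_apply, ← pow_succ]
      rw [Finset.sum_range_succ]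
      conv_lhs => rw [ih, h1]
      ring
  set β := B + d
  have hβR : β ∈ R := add_mem hB (hR.le hd)
  have hβ : frobAut σ β = P ^ μ * β := by
    rw [map_add, hdz]
    linear_combination (-P ^ μ) * hBz - frobAut σ B * hQPn μ
  have hβ0 : β ≠ 0 := fun h => by
    have h1 := congrArg (fun x => x.coeff ν) h
    simp only [β, ImmAnCon.coeff_add, ImmAnCon.coeff_zero, hBν] at h1
    have h2 := G.norm_coeff_lt_one_of_frobAut_eq hπ hμ hz hd hdz ν
    rw [← norm_neg, ← eq_neg_of_add_eq_zero_left h1, hzν] at h2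
    exact lt_irrefl _ h2
  set x := digitSum π μ c
  have hxR : x ∈ R := hR.le (digitSum_mem hc)
  -- The contribution of the digit i = μ - r to the term of index j + 1 of the series B. Applying
  -- π^l φ^l with l = μ j + r cancels the negative power of π.
  set u : ℕ → ℕ → GammaImmAnCon p k O := fun j r =>
    Q ^ (μ * j + r) * c (μ - r) * (frobAut σ ^ (j + 1)) z
  have huR : ∀ j, ∀ r < μ + 1, u j r ∈ R := fun j r hr => mul_mem (mul_mem (pow_mem hQR _)
    (hR.le (hc _ (by omega)))) (hR.frob_pow (hR.le hz) _)
  have hxu : ∀ j, x * (Q ^ (μ * (j + 1)) * (frobAut σ ^ (j + 1)) z) =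
      ∑ r ∈ Finset.range (μ + 1), u j r := fun j => by
    have h1 : x = ∑ r ∈ Finset.range (μ + 1), P ^ (μ - r) * c (μ - r) :=
      (Finset.sum_range_reflect (fun i => P ^ i * c i) (μ + 1)).symm
    rw [h1, Finset.sum_mul]
    refine Finset.sum_congr rfl fun r hr => ?_
    have hr : r ≤ μ := Nat.lt_succ_iff.1 (Finset.mem_range.1 hr)
    have h2 : Q ^ (μ * (j + 1)) = Q ^ (μ * j + r) * Q ^ (μ - r) := by
      rw [← pow_add]; congr 1; rw [mul_add]; omega
    rw [h2]
    linear_combination (Q ^ (μ * j + r) * c (μ - r) * (frobAut σ ^ (j + 1)) z) * hQPn (μ - r)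
  have hφu : ∀ j, ∀ r < μ + 1, P ^ (μ * j + r) * (frobAut σ ^ (μ * j + r)) (u j r) =
      (frobAut σ ^ (μ * j + r)) (c (μ - r)) * (frobAut σ ^ ((μ + 1) * j + r + 1)) z := by
    intro j r hr
    simp only [u]
    rw [map_mul, map_mul, hφQl, ← RingAut.mul_apply, ← pow_add]
    have : μ * j + r + (j + 1) = (μ + 1) * j + r + 1 := by ring
    rw [this]
    linear_combination ((frobAut σ ^ (μ * j + r)) (c (μ - r)) *
      (frobAut σ ^ ((μ + 1) * j + r + 1)) z) * hQPn (μ * j + r)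
  have htail : x * (Q ^ (μ * (J + 1)) * (frobAut σ ^ (J + 1)) B) ∈ coboundaries σ R P := by
    refine hR.mem_coboundaries_of_pos (mul_mem hxR (mul_mem (pow_mem hQR _)
      (hR.frob_pow hB _))) (r := -A * θ ^ μ + p ^ (J + 1) * δ) (by linarith) ?_
    refine ImmAnCon.vanishBelow_mul (vanishBelow_digitSum hA.le hθ.le hv) ?_
    rw [hQdef, ← map_pow]
    exact ImmAnCon.vanishBelow_const_mul _ (vanishBelow_frobAut_pow hBv _)
  -- The terms π^l φ^l(u j r) together with x (z + d) form the obstruction, which is zero. Only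
  -- differences that are coboundaries and the tail remain.
  have hmain : x * β = ∑ j ∈ Finset.range J, ∑ r ∈ Finset.range (μ + 1),
      (u j r - P ^ (μ * j + r) * (frobAut σ ^ (μ * j + r)) (u j r)) +
      x * (Q ^ (μ * (J + 1)) * (frobAut σ ^ (J + 1)) B) := by
    have h1 : x * B = x * z + ∑ j ∈ Finset.range J, ∑ r ∈ Finset.range (μ + 1), u j r +
        x * (Q ^ (μ * (J + 1)) * (frobAut σ ^ (J + 1)) B) := by
      conv_lhs => rw [hBJ (J + 1), Finset.sum_range_succ', mul_add, mul_add, Finset.mul_sum]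
      simp only [hxu, mul_zero, pow_zero, one_mul, RingAut.one_apply]
      ring
    have h2 : x * (z + d) + ∑ j ∈ Finset.range J, ∑ r ∈ Finset.range (μ + 1),
        P ^ (μ * j + r) * (frobAut σ ^ (μ * j + r)) (u j r) = 0 := by
      rw [← hE, obstruction, sum_range_mul_eq_sum_sum]
      refine congrArg₂ _ rfl (Finset.sum_congr rfl fun j _ => Finset.sum_congr rfl fun r hr => ?_)
      have hr := Finset.mem_range.1 hr
      rw [hφu j r hr, reflectMod_mul_add _ _ _ hr, frobExponent_mul_add _ _ _ hr]
    simp only [Finset.sum_sub_distrib]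
    linear_combination h1 + h2
  have hmem : x * β ∈ coboundaries σ R P := by
    rw [hmain]
    exact add_mem (sum_mem fun j _ => sum_mem fun r hr =>
      hR.sub_frobAut_pow_mem_coboundaries hπσ (huR j r (Finset.mem_range.1 hr)) _) htail
  obtain ⟨α, hα, h⟩ := hmem
  exact ⟨β, hβR, α, hα, hβ0, hβ, h⟩

end IsAnalyticHull
end

/-! ### Reduction to bounded poles, and series with arbitrarily small poles -/

section
variable {p : ℕ} [Fact p.Prime] {k : Type*} [Field k] [IsAlgClosed k] [CharP k p]
  {O : Type*} [CommRing O] [IsDomain O] [IsDiscreteValuationRing O]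
  [Algebra (WittVector p k) O] [Module.Finite (WittVector p k) O] [FaithfulSMul (WittVector p k) O]
  {σ : O ≃+* O} {π : O}

open GammaImmAnCon

/-- The coefficients at very negative exponents are divisible by high powers of `π`. -/
theorem GammaImmAnCon.exists_forall_norm_coeff_le_pow (hπ : Irreducible π)
    {x : GammaImmAnCon p k O} (hx : x ∈ integers p k O) (h : ℕ) :
    ∃ C : ℝ, 0 < C ∧ ∀ (I : ℕ) (n : ℚ), (n : ℝ) < -C * I →
      ‖x.coeff n‖ ≤ ‖algebraMap O (CoeffField p k O) π‖ ^ (h * I) := by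
  have q0 := CoeffField.norm_pos (p := p) (k := k) hπ
  have q1 := CoeffField.norm_lt_one (p := p) (k := k) hπ
  set q := ‖algebraMap O (CoeffField p k O) π‖
  have p1 : (1 : ℝ) < p := IsAnCon.one_lt
  have p0 : (0 : ℝ) < p := IsAnCon.p_pos
  set e : ℝ := -Real.logb p q
  have hqe : ∀ K : ℕ, q ^ K = (p : ℝ) ^ (-e * K) := fun K => by
    rw [Real.rpow_mul p0.le, neg_neg, Real.rpow_logb p0 p1.ne' q0, Real.rpow_natCast]
  obtain ⟨c, hc, hneg⟩ := x.isAnCon.neg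
  obtain ⟨N, hN⟩ := Filter.eventually_atBot.1 hneg
  -- The bound -N makes the decay p^(c n) available for n < -C I with I ≥ 1, and e h / c makes this
  -- decay beat |π|^(h I) = p^(-e h I).
  set C : ℝ := max 1 (max (-N) (e * h / c))
  have hC : 0 < C := lt_max_of_lt_left one_pos
  refine ⟨C, hC, fun I n hn => ?_⟩
  rcases Nat.eq_zero_or_pos I with rfl | hI
  · simpa using hx n
  have hI : (1 : ℝ) ≤ I := by exact_mod_cast hI
  have h1 : -(N : ℝ) ≤ C := (le_max_left _ _).trans (le_max_right _ _)
  have h2 : e * h ≤ C * c := (div_le_iff₀ hc).1 ((le_max_right _ _).trans (le_max_right _ _))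
  have h3 : (n : ℝ) ≤ N := by nlinarith
  refine (hN n (by exact_mod_cast h3)).le.trans ?_
  rw [hqe]
  refine Real.rpow_le_rpow_of_exponent_le p1.le ?_
  push_cast
  nlinarith

namespace FrobeniusLattice
variable (G : FrobeniusLattice p k σ π)

/-- The witness is b = ∑_{1 ≤ j ≤ I} π^(m (I - j)) φ^(-j)(u). Trading π^(m I) u for φ^(-I)(u)
divides the poles by p^I. -/
theorem exists_sub_eq_frobAut_inv_sub (hπσ : σ π = π) {u : GammaImmAnCon p k O} (hu : u ∈ G.ring)
    {r : ℝ} (hr : r ≤ 0) (huv : VanishBelow r u.coeff) (m I : ℕ) :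
    ∃ b ∈ G.ring, VanishBelow r b.coeff ∧ b - immConst p k O π ^ m * frobAut σ b =
      ((frobAut σ)⁻¹ ^ I) u - immConst p k O π ^ (m * I) * u := by
  have p1 : (1 : ℝ) < p := IsAnCon.one_lt
  induction I with
  | zero => exact ⟨0, zero_mem _, ImmAnCon.vanishBelow_zero, by simp⟩
  | succ I ih =>
    obtain ⟨b, hb, hbv, h⟩ := ih
    refine ⟨((frobAut σ)⁻¹ ^ (I + 1)) u + immConst p k O π ^ m * b,
      add_mem (G.frob_inv_pow hu _) (G.const_pow_mul hb m),
      ImmAnCon.vanishBelow_add ((vanishBelow_frobAut_inv_pow huv (I + 1)).mono ?_)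
        (vanishBelow_immConst_pow_mul m hbv), ?_⟩
    · rw [le_div_iff₀ (by positivity)]
      exact mul_le_of_one_le_right hr (one_le_pow₀ p1.le)
    · have h1 : frobAut σ (((frobAut σ)⁻¹ ^ (I + 1)) u) = ((frobAut σ)⁻¹ ^ I) u := by
        rw [pow_succ', RingAut.mul_apply, frobAut_apply_inv]
      rw [map_add, map_mul, map_pow, frobAut_immConst hπσ, h1]
      linear_combination immConst p k O π ^ m * h

/-- Every element is congruent to one whose exponents are bounded below. -/
theorem exists_vanishBelow_sub_eq (hπ : Irreducible π) (hπσ : σ π = π) {m : ℕ} (hm : m ≠ 0)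
    {c : GammaImmAnCon p k O} (hc : c ∈ G.ring) : ∃ C : ℝ, 0 < C ∧ ∃ c' ∈ G.ring,
      VanishBelow (-C) c'.coeff ∧ ∃ b ∈ G.ring,
        c' - c = b - immConst p k O π ^ m * frobAut σ b := by
  have p1 : (1 : ℝ) < p := IsAnCon.one_lt
  have p2 : 2 ≤ p := (Fact.out : p.Prime).two_le
  -- Twice the power is requested: one factor π^(m I) is spent on passing to φ^(-I), the other keeps
  -- the resulting series convergent.
  obtain ⟨C, hC, hCn⟩ := exists_forall_norm_coeff_le_pow hπ (G.le_integers hc) (2 * m)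
  set P := immConst p k O π
  have hP : frobAut σ P = P := frobAut_immConst hπσ
  have htrim : ∀ I : ℕ, ∃ t ∈ G.ring, VanishBelow (-C * I) (c - P ^ (2 * m * I) * t).coeff ∧
      (I = 0 → t = c) := fun I => by
    rcases eq_or_ne I 0 with rfl | hI
    · exact ⟨c, hc, by simpa using ImmAnCon.vanishBelow_zero, fun _ => rfl⟩
    · obtain ⟨t, ht, htv⟩ := G.exists_trim hπ hc (2 * m * I) (-C * I) (hCn I)
      exact ⟨t, ht, htv, fun h => absurd h hI⟩
  choose t ht htv ht0 using htrim
  -- The sum of the π^(2 m I) u I telescopes to c because t 0 = c, and u I has poles of order at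
  -- most C (I + 1).
  set u : ℕ → GammaImmAnCon p k O := fun I => t I - P ^ (2 * m) * t (I + 1)
  have hu : ∀ I, u I ∈ G.ring := fun I => sub_mem (ht I) (G.const_pow_mul (ht _) _)
  have huv : ∀ I : ℕ, VanishBelow (-C * (I + 1)) (u I).coeff := fun I => by
    refine vanishBelow_of_immConst_pow_mul hπ (h := 2 * m * I) ?_
    have h1 := htv (I + 1)
    push_cast at h1
    have h2 := ImmAnCon.vanishBelow_sub h1 ((htv I).mono (by linarith :
      -C * ((I : ℝ) + 1) ≤ -C * I))
    convert! h2 using 2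
    simp only [u, P]
    ring
  have hsum : ∀ K, ∑ I ∈ Finset.range K, P ^ (m * I) * (P ^ (m * I) * u I) =
      c - P ^ (2 * m * K) * t K := fun K => by
    induction K with
    | zero => simp [ht0]
    | succ K ih =>
      rw [Finset.sum_range_succ, ih]
      simp only [u]
      ring
  have hneg : ∀ I : ℕ, -C * ((I : ℝ) + 1) ≤ 0 := fun I => by
    have : (0 : ℝ) ≤ I := Nat.cast_nonneg I
    nlinarith
  choose b hb hbv hbe using fun I => G.exists_sub_eq_frobAut_inv_sub hπσ (hu I) (hneg I) (huv I) m I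
  -- Linear growth of the poles is overcome by the contraction: I + 1 ≤ p^I.
  have hxv : ∀ I : ℕ, VanishBelow (-C) (((frobAut σ)⁻¹ ^ I) (u I)).coeff := fun I => by
    refine (vanishBelow_frobAut_inv_pow (huv I) I).mono ?_
    rw [le_div_iff₀ (by positivity)]
    have h1 : I + 1 ≤ p ^ I := (Nat.lt_two_pow_self (n := I)).trans_le (Nat.pow_le_pow_left p2 I)
    have h2 : (I : ℝ) + 1 ≤ p ^ I := by exact_mod_cast h1
    nlinarith
  obtain ⟨c', hc', hcK⟩ := G.exists_sum hπ hm (fun I => G.frob_inv_pow (hu I) I) (C := C)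
    fun I => (hxv I).mono (by have : (0 : ℝ) ≤ I := Nat.cast_nonneg I; nlinarith)
  obtain ⟨s, hs, hsK⟩ := G.exists_sum hπ hm hb hbv
  refine ⟨C, hC, c', hc', ?_, s, hs,
    sub_eq_zero.1 (G.eq_zero_of_forall_dvd hπ hm fun K => ?_)⟩
  · obtain ⟨y, -, hy, hyv⟩ := hcK 0
    have : c' = y := by simpa using hy
    rw [this]; exact hyv _ hxv
  · obtain ⟨y, hy, hcy, -⟩ := hcK K
    obtain ⟨y', hy', hsy, -⟩ := hsK K
    refine ⟨y - (y' - P ^ m * frobAut σ y') - P ^ (m * K) * t K,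
      sub_mem (sub_mem hy (sub_mem hy' (G.const_pow_mul (G.frob _ hy') m)))
        (G.const_pow_mul (ht K) _), ?_⟩
    have h1 : ∑ I ∈ Finset.range K, P ^ (m * I) * b I -
        P ^ m * frobAut σ (∑ I ∈ Finset.range K, P ^ (m * I) * b I) =
        ∑ I ∈ Finset.range K, P ^ (m * I) * ((frobAut σ)⁻¹ ^ I) (u I) -
          ∑ I ∈ Finset.range K, P ^ (m * I) * (P ^ (m * I) * u I) := by
      rw [map_sum, Finset.mul_sum, ← Finset.sum_sub_distrib, ← Finset.sum_sub_distrib]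
      refine Finset.sum_congr rfl fun I _ => ?_
      rw [map_mul, map_pow, hP]
      linear_combination P ^ (m * I) * hbe I
    rw [hsum] at h1
    rw [hcy, hsy, map_add, map_mul, map_pow, hP]
    linear_combination -h1

/-- The equation shows e = π^m e' with e' = φ(e) + π^(m (K - 1)) w for K ≥ 1. This e' satisfies the
same equation with K - 1 in place of K, after cancelling π^m. -/
theorem exists_eq_pow_mul_of_sub_eq (hπ : Irreducible π) (hπσ : σ π = π) {m K : ℕ}
    {e w : GammaImmAnCon p k O} (he : e ∈ G.ring) (hw : w ∈ G.ring)
    (h : e - immConst p k O π ^ m * frobAut σ e = immConst p k O π ^ (m * K) * w) :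
    ∃ y ∈ G.ring, e = immConst p k O π ^ (m * K) * y := by
  induction K generalizing e with
  | zero => exact ⟨e, he, by simp⟩
  | succ K ih =>
    set P := immConst p k O π
    have hP : frobAut σ P = P := frobAut_immConst hπσ
    have h1 : e = P ^ m * (frobAut σ e + P ^ (m * K) * w) := by
      linear_combination h
    obtain ⟨y, hy, hye⟩ := ih (e := frobAut σ e + P ^ (m * K) * w)
      (add_mem (G.frob _ he) (G.const_pow_mul hw _)) (by
        refine immConst_pow_mul_injective hπ m ?_
        change P ^ m * _ = P ^ m * _
        have h2 := congrArg (frobAut σ) h1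
        simp only [map_mul, map_pow, hP] at h2
        linear_combination h - h1 + P ^ m * h2)
    exact ⟨y, hy, by rw [h1, hye]; ring⟩

/-- An element that is congruent to elements with arbitrarily small poles is a coboundary. -/
theorem exists_eq_sub_of_forall (hπ : Irreducible π) (hπσ : σ π = π) {m : ℕ} (hm : m ≠ 0)
    {x : GammaImmAnCon p k O} {S : ℝ} (hx : ∀ ε : ℝ, 0 < ε → ∃ y ∈ G.ring, ∃ b ∈ G.ring,
      VanishBelow (-ε) y.coeff ∧ VanishBelow (-S) b.coeff ∧
      x = y + (b - immConst p k O π ^ m * frobAut σ b)) :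
    ∃ b ∈ G.ring, x = b - immConst p k O π ^ m * frobAut σ b := by
  have p1 : (1 : ℝ) < p := IsAnCon.one_lt
  have p0 : (0 : ℝ) < p := IsAnCon.p_pos
  set P := immConst p k O π
  have hP : frobAut σ P = P := frobAut_immConst hπσ
  set T := max S 1
  -- If y has poles of order at most p^(-K), then ∑_{j < K} π^(m j) φ^j(y) still has poles of order
  -- at most 1 and solves the equation for y modulo π^(m K). So the approximate solutions Y K have
  -- uniformly bounded poles.
  have hK : ∀ K : ℕ, ∃ Y ∈ G.ring, ∃ g ∈ G.ring, VanishBelow (-T) Y.coeff ∧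
      Y - P ^ m * frobAut σ Y = x - P ^ (m * K) * g := fun K => by
    obtain ⟨y, hy, b, hb, hyv, hbv, hxy⟩ := hx (((p : ℝ) ^ K)⁻¹) (by positivity)
    refine ⟨∑ j ∈ Finset.range K, P ^ (m * j) * (frobAut σ ^ j) y + b,
      add_mem (sum_mem fun j _ => G.const_pow_mul (G.frob_pow hy j) _) hb,
      (frobAut σ ^ K) y, G.frob_pow hy K, ImmAnCon.vanishBelow_add
        (ImmAnCon.vanishBelow_sum fun j hj => vanishBelow_immConst_pow_mul _
          ((vanishBelow_frobAut_pow hyv j).mono ?_))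
        (hbv.mono (neg_le_neg (le_max_left _ _))), ?_⟩
    · have h1 : (p : ℝ) ^ j * ((p : ℝ) ^ K)⁻¹ ≤ 1 := by
        rw [← div_eq_mul_inv, div_le_one (by positivity)]
        exact pow_le_pow_right₀ p1.le (Finset.mem_range.1 hj).le
      have h2 : 1 ≤ T := le_max_right _ _
      linarith
    · have h1 : ∀ n, ∑ j ∈ Finset.range n, P ^ (m * j) * (frobAut σ ^ j) y -
          P ^ m * frobAut σ (∑ j ∈ Finset.range n, P ^ (m * j) * (frobAut σ ^ j) y) =
          y - P ^ (m * n) * (frobAut σ ^ n) y := fun n => by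
        induction n with
        | zero => simp
        | succ n ih =>
          rw [Finset.sum_range_succ, map_add, map_mul, map_pow, hP, pow_succ' _ n,
            RingAut.mul_apply]
          linear_combination ih
      rw [map_add, hxy]
      linear_combination h1 K
  choose Y hY g hg hYv hYe using hK
  -- Approximate solutions are unique modulo π^(m K), so the Y K form a Cauchy sequence. The common
  -- bound on the poles makes the limit overconvergent.
  have he : ∀ K, ∃ y ∈ G.ring, Y (K + 1) - Y K = P ^ (m * K) * y := fun K => by
    refine G.exists_eq_pow_mul_of_sub_eq hπ hπσ (sub_mem (hY _) (hY _))
      (sub_mem (hg K) (G.const_pow_mul (hg (K + 1)) m)) ?_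
    rw [map_sub]
    linear_combination hYe (K + 1) - hYe K
  choose h hh hhe using he
  have hhv : ∀ K, VanishBelow (-T) (h K).coeff := fun K => by
    refine vanishBelow_of_immConst_pow_mul hπ (h := m * K) ?_
    change VanishBelow _ (P ^ (m * K) * h K).coeff
    rw [← hhe]
    exact ImmAnCon.vanishBelow_sub (hYv _) (hYv _)
  obtain ⟨s, hs, hsK⟩ := G.exists_sum hπ hm hh (C := T) (fun K => (hhv K).mono (by
    have h1 : 1 ≤ T := le_max_right _ _
    have h2 : (0 : ℝ) ≤ K := Nat.cast_nonneg K
    nlinarith))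
  have hsum : ∀ K, ∑ j ∈ Finset.range K, P ^ (m * j) * h j = Y K - Y 0 := fun K => by
    induction K with
    | zero => simp
    | succ K ih => rw [Finset.sum_range_succ, ih, ← hhe]; ring
  refine ⟨s + Y 0, add_mem hs (hY 0), sub_eq_zero.1 (G.eq_zero_of_forall_dvd hπ hm fun K => ?_)⟩
  obtain ⟨y, hy, hsy, -⟩ := hsK K
  rw [hsum] at hsy
  refine ⟨g K - (y - P ^ m * frobAut σ y),
    sub_mem (hg K) (sub_mem hy (G.const_pow_mul (G.frob _ hy) m)), ?_⟩
  have h1 : s + Y 0 = Y K + P ^ (m * K) * y := by rw [hsy]; ring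
  rw [h1, map_add, map_mul, map_pow, hP]
  linear_combination -hYe K

end FrobeniusLattice
end

/-! ### Digits: carrying, rotation, and the dichotomy -/

section
variable {p : ℕ} [Fact p.Prime] {k : Type*} [Field k] [IsAlgClosed k] [CharP k p]
  {O : Type*} [CommRing O] [IsDomain O] [IsDiscreteValuationRing O]
  [Algebra (WittVector p k) O] [Module.Finite (WittVector p k) O] [FaithfulSMul (WittVector p k) O]
  {σ : O ≃+* O} {π : O}

open GammaImmAnCon

/-- The sequences of elements of the lattice with poles of order at most `S θ^i`. -/
structure IsDigits (G : FrobeniusLattice p k σ π) (μ : ℕ) (θ S : ℝ)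
    (c : ℕ → GammaImmAnCon p k O) : Prop where
  mem : ∀ i < μ + 1, c i ∈ G.ring
  vanishBelow : ∀ i < μ + 1, VanishBelow (-S * θ ^ i) (c i).coeff

namespace IsDigits
variable {G : FrobeniusLattice p k σ π} {R : Subring (GammaImmAnCon p k O)} {μ : ℕ} {θ S : ℝ}
  {c : ℕ → GammaImmAnCon p k O}

/-- Replacement of the digits by lifts of their reductions. -/
theorem exists_step (hπ : Irreducible π) (hθ : 1 < θ) (hθp : θ ^ (μ + 1) = p)
    (hS : 0 < S) (hc : IsDigits G μ θ S c) : ∃ c', ∃ b ∈ G.ring, VanishBelow (-S) b.coeff ∧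
      digitSum π μ c = digitSum π μ c' + (b - immConst p k O π ^ (μ + 1) * frobAut σ b) ∧
      (IsDigits G μ θ (S / θ) c' ∨ ∃ A, 0 < A ∧ IsDigits G μ θ A c' ∧ ∃ s < μ + 1, ∃ e : ℚ,
        (e : ℝ) = -A * θ ^ s ∧ ‖(c' s).coeff e‖ = 1) := by
  classical
  have θ0 : 0 < θ := zero_lt_one.trans hθ
  have hdec : ∀ i, ∃ f t d, i < μ + 1 → t ∈ G.ring ∧ d ∈ G.ring ∧
      c i = t + immConst p k O π * d ∧ IsReduction t f ∧ VanishBelow (-S * θ ^ i) d.coeff ∧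
      ∀ r, VanishBelow r f.coeff → VanishBelow r t.coeff := fun i => by
    by_cases hi : i < μ + 1
    · obtain ⟨f, hf⟩ := IsReduction.exists_of_mem (G.le_integers (hc.mem i hi))
      obtain ⟨t, ht, d, hd, hcd, htf, htv⟩ := G.exists_eq_lift_add hπ (hc.mem i hi) hf
      refine ⟨f, t, d, fun _ => ⟨ht, hd, hcd, htf, ?_, htv⟩⟩
      refine vanishBelow_of_immConst_pow_mul hπ (h := 1) ?_
      have h1 : immConst p k O π ^ 1 * d = c i - t := by rw [hcd]; ring
      rw [h1]
      exact ImmAnCon.vanishBelow_sub (hc.vanishBelow i hi)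
        (htv _ (hf.vanishBelow (hc.vanishBelow i hi)))
    · exact ⟨0, 0, 0, fun h => absurd h hi⟩
  choose f t d h using hdec
  set P := immConst p k O π
  -- The carries: d i moves to digit i + 1, and π^(μ+1) d μ is replaced by φ⁻¹(d μ) in digit 0. Both
  -- satisfy the bound with S / θ, the latter because θ^μ / p = θ⁻¹.
  set w : ℕ → GammaImmAnCon p k O := fun i => Nat.casesOn i ((frobAut σ)⁻¹ (d μ)) d
  have hw0 : w 0 = (frobAut σ)⁻¹ (d μ) := rfl
  have hw1 : ∀ i, w (i + 1) = d i := fun _ => rfl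
  have hμ := Nat.lt_succ_self μ
  have hb : VanishBelow (-(S / θ)) ((frobAut σ)⁻¹ (d μ)).coeff := by
    refine (vanishBelow_frobAut_inv (h μ hμ).2.2.2.2.1).mono (le_of_eq ?_)
    rw [← hθp, pow_succ]
    field_simp
  have hwR : ∀ i < μ + 1, w i ∈ G.ring := fun i hi => by
    cases i with
    | zero => exact G.frob_inv _ (h μ hμ).2.1
    | succ i => exact (h i (by omega)).2.1
  have hwv : ∀ i < μ + 1, VanishBelow (-(S / θ) * θ ^ i) (w i).coeff := fun i hi => by
    cases i with
    | zero => rw [pow_zero, mul_one]; exact hb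
    | succ i =>
      refine (h i (by omega)).2.2.2.2.1.mono (le_of_eq ?_)
      rw [pow_succ]
      field_simp
  refine ⟨fun i => t i + w i, -(frobAut σ)⁻¹ (d μ), neg_mem (G.frob_inv _ (h μ hμ).2.1),
    ImmAnCon.vanishBelow_neg (hb.mono (neg_le_neg (div_le_self hS.le hθ.le))), ?_, ?_⟩
  · rw [map_neg, frobAut_apply_inv]
    have h1 : digitSum π μ c = ∑ i ∈ Finset.range (μ + 1), P ^ i * t i +
        ∑ i ∈ Finset.range (μ + 1), P ^ (i + 1) * d i := by
      rw [← Finset.sum_add_distrib]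
      refine Finset.sum_congr rfl fun i hi => ?_
      rw [(h i (Finset.mem_range.1 hi)).2.2.1]
      ring
    rw [h1, Finset.sum_range_succ (fun i => P ^ (i + 1) * d i)]
    simp only [digitSum, mul_add, Finset.sum_add_distrib]
    rw [Finset.sum_range_succ' (fun i => immConst p k O π ^ i * w i)]
    simp only [hw1, hw0, P]
    ring
  · by_cases hall : ∀ i < μ + 1, VanishBelow (-(S / θ) * θ ^ i) (f i).coeff
    · exact Or.inl ⟨fun i hi => add_mem (h i hi).1 (hwR i hi), fun i hi =>
        ImmAnCon.vanishBelow_add ((h i hi).2.2.2.2.2 _ (hall i hi)) (hwv i hi)⟩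
    right
    push Not at hall
    obtain ⟨i₀, hi₀, hfi₀⟩ := hall
    -- The order of the pole of the i-th reduction in units of θ^i. If a reduction exceeds the
    -- smaller bound S / θ, the largest g i is the exact bound A for the new digits.
    set g : ℕ → ℝ := fun i => -((f i).order : ℝ) / θ ^ i
    have hS0 : 0 < S / θ := div_pos hS θ0
    have hlt : ∀ i, f i ≠ 0 → ¬ VanishBelow (-(S / θ) * θ ^ i) (f i).coeff → S / θ < g i := by
      intro i h0 hi
      by_contra! hle
      rw [div_le_iff₀ (by positivity)] at hle
      exact hi ((HahnSeries.vanishBelow_order (f i)).mono (by linarith))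
    have hne : f i₀ ≠ 0 := fun h0 => hfi₀ (by rw [h0]; exact VanishBelow.zero)
    obtain ⟨s, hs, hmax⟩ := Finset.exists_max_image
      ((Finset.range (μ + 1)).filter fun i => f i ≠ 0) g
      ⟨i₀, Finset.mem_filter.2 ⟨Finset.mem_range.2 hi₀, hne⟩⟩
    rw [Finset.mem_filter, Finset.mem_range] at hs
    have hgs : S / θ < g s := (hlt i₀ hne hfi₀).trans_le
      (hmax i₀ (Finset.mem_filter.2 ⟨Finset.mem_range.2 hi₀, hne⟩))
    have hord : ((f s).order : ℝ) = -g s * θ ^ s := by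
      simp only [g]; field_simp
    have hwlt : ∀ i < μ + 1, VanishBelow (-g s * θ ^ i) (w i).coeff := fun i hi =>
      (hwv i hi).mono (mul_le_mul_of_nonneg_right (neg_le_neg hgs.le) (by positivity))
    refine ⟨g s, hS0.trans hgs, ⟨fun i hi => add_mem (h i hi).1 (hwR i hi), fun i hi =>
      ImmAnCon.vanishBelow_add ((h i hi).2.2.2.2.2 _ ?_) (hwlt i hi)⟩, s, hs.1, (f s).order,
      hord, ?_⟩
    · by_cases h0 : f i = 0
      · rw [h0]; exact VanishBelow.zero
      · have h1 := hmax i (Finset.mem_filter.2 ⟨Finset.mem_range.2 hi, h0⟩)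
        refine (HahnSeries.vanishBelow_order (f i)).mono ?_
        have h2 : -((f i).order : ℝ) ≤ g s * θ ^ i := (div_le_iff₀ (by positivity)).1 h1
        linarith
    -- The carried part cannot disturb the extremal coefficient: its poles stay below S / θ < g s in
    -- these units.
    · have h1 : (w s).coeff (f s).order = 0 := hwv s hs.1 _ (by
        rw [hord]
        exact mul_lt_mul_of_pos_right (neg_lt_neg hgs) (by positivity))
      rw [ImmAnCon.coeff_add, h1, add_zero]
      have h2 := (h s hs.1).2.2.2.1
      refine le_antisymm (h2.integral _) (not_lt.1 fun hn => ?_)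
      rw [← h2.coeff_eq_zero_iff] at hn
      exact hs.2 (HahnSeries.coeff_order_eq_zero.1 hn)

/-- The digits of `π x` up to a coboundary. -/
theorem rotate (hθ : 1 < θ) (hθp : θ ^ (μ + 1) = p) (hc : IsDigits G μ θ S c) :
    IsDigits G μ θ (S / θ) (fun i => Nat.casesOn i ((frobAut σ)⁻¹ (c μ)) c) := by
  have θ0 : 0 < θ := zero_lt_one.trans hθ
  refine ⟨fun i hi => ?_, fun i hi => ?_⟩
  · cases i with
    | zero => exact G.frob_inv _ (hc.mem μ (Nat.lt_succ_self μ))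
    | succ i => exact hc.mem i (by omega)
  · cases i with
    | zero =>
      refine (vanishBelow_frobAut_inv (hc.vanishBelow μ (Nat.lt_succ_self μ))).mono (le_of_eq ?_)
      rw [← hθp, pow_succ]
      field_simp
    | succ i =>
      refine (hc.vanishBelow i (by omega)).mono (le_of_eq ?_)
      rw [pow_succ]
      field_simp

theorem immConst_mul_digitSum (c : ℕ → GammaImmAnCon p k O) :
    immConst p k O π * digitSum π μ c =
      -((frobAut σ)⁻¹ (c μ) - immConst p k O π ^ (μ + 1) * frobAut σ ((frobAut σ)⁻¹ (c μ))) +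
      digitSum π μ (fun i => Nat.casesOn i ((frobAut σ)⁻¹ (c μ)) c) := by
  have h : digitSum π μ (fun i => Nat.casesOn i ((frobAut σ)⁻¹ (c μ)) c) =
      ∑ i ∈ Finset.range μ, immConst p k O π ^ (i + 1) * c i + (frobAut σ)⁻¹ (c μ) := by
    rw [digitSum, Finset.sum_range_succ', pow_zero, one_mul]
    rfl
  rw [frobAut_apply_inv, h, digitSum, Finset.sum_range_succ, mul_add, Finset.mul_sum]
  simp only [pow_succ', mul_assoc]
  ring

/-- Multiplication by π moves each digit up by one position and the last one, through φ⁻¹, to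
position 0. After μ + 1 - s rotations the extremal unit coefficient is in digit 0, where
`IsAnalyticHull.hasEigenvector_digitSum` applies. -/
theorem hasEigenvector (hR : IsAnalyticHull G R) (hπ : Irreducible π) (hπσ : σ π = π)
    (hσ : ∀ a : O, IsLocalRing.residue O (σ a) = IsLocalRing.residue O a ^ p)
    (hμ : μ ≠ 0) (hθ : 1 < θ) (hθp : θ ^ (μ + 1) = p) (hS : 0 < S) (hc : IsDigits G μ θ S c)
    {s : ℕ} (hs : s < μ + 1) {e : ℚ} (he : (e : ℝ) = -S * θ ^ s) (hce : ‖(c s).coeff e‖ = 1) :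
    HasEigenvector σ π R μ (digitSum π μ c) := by
  have θ0 : 0 < θ := zero_lt_one.trans hθ
  have h0 : ∀ {S : ℝ} {c : ℕ → GammaImmAnCon p k O} {e : ℚ}, 0 < S → IsDigits G μ θ S c → (e : ℝ) = -S → ‖(c 0).coeff e‖ = 1 →
      HasEigenvector σ π R μ (digitSum π μ c) := fun hS hc he hce =>
    hR.hasEigenvector_digitSum hπ hπσ hσ hμ hS hθ hθp hc.mem hc.vanishBelow he hce
  have hrot : ∀ {c : ℕ → GammaImmAnCon p k O}, c μ ∈ G.ring → HasEigenvector σ π R μ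
      (digitSum π μ (fun i => Nat.casesOn i ((frobAut σ)⁻¹ (c μ)) c)) →
      HasEigenvector σ π R μ (digitSum π μ c) := fun {c} hcμ h => by
    refine HasEigenvector.of_mul hR hπ hπσ ?_
    rw [immConst_mul_digitSum (σ := σ)]
    exact HasEigenvector.coboundary_add
      (neg_mem ⟨_, hR.le (G.frob_inv _ hcμ), rfl⟩) h
  obtain ⟨n, hn⟩ := Nat.exists_eq_add_of_le (Nat.lt_succ_iff.1 hs)
  induction n generalizing s c S with
  | zero =>
    obtain rfl : s = μ := hn.symm
    refine hrot (hc.mem s hs) (h0 (e := e / p) (div_pos hS θ0) (hc.rotate hθ hθp) ?_ ?_)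
    · push_cast
      rw [he, ← hθp, pow_succ]
      field_simp
    · have p0 : (p : ℚ) ≠ 0 := by exact_mod_cast (Fact.out : p.Prime).ne_zero
      change ‖((frobAut σ)⁻¹ (c s)).coeff _‖ = 1
      rw [norm_coeff_frobAut_inv, div_mul_cancel₀ _ p0, hce]
  | succ n ih =>
    refine hrot (hc.mem μ (Nat.lt_succ_self μ)) (ih (div_pos hS θ0) (hc.rotate hθ hθp)
      (s := s + 1) (by omega) ?_ hce (by omega))
    rw [he, pow_succ]
    field_simp

end IsDigits

/-- An element of R is replaced by one of the lattice with bounded poles. The carrying process then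
either reaches an extremal unit coefficient or shows that this element is of the form b - π^(μ+1)
φ(b). -/
theorem IsAnalyticHull.hasEigenvector {G : FrobeniusLattice p k σ π}
    {R : Subring (GammaImmAnCon p k O)} (hR : IsAnalyticHull G R) (hπ : Irreducible π)
    (hπσ : σ π = π) (hσ : ∀ a : O, IsLocalRing.residue O (σ a) = IsLocalRing.residue O a ^ p)
    {μ : ℕ} (hμ : μ ≠ 0) {x : GammaImmAnCon p k O} (hx : x ∈ R) : HasEigenvector σ π R μ x := by
  have p1 : (1 : ℝ) < p := IsAnCon.one_lt
  have p0 : (0 : ℝ) < p := IsAnCon.p_pos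
  set P := immConst p k O π
  set θ : ℝ := (p : ℝ) ^ ((μ + 1 : ℕ) : ℝ)⁻¹
  have hθp : θ ^ (μ + 1) = p := Real.rpow_inv_natCast_pow p0.le (Nat.succ_ne_zero μ)
  have hθ : 1 < θ := Real.one_lt_rpow p1 (by positivity)
  have θ0 : 0 < θ := zero_lt_one.trans hθ
  have hdigit : ∀ {S : ℝ} {y : GammaImmAnCon p k O}, y ∈ G.ring → VanishBelow (-S) y.coeff →
      IsDigits G μ θ S (fun i => if i = 0 then y else 0) := fun hy hyv =>
    ⟨fun i _ => by split_ifs; exacts [hy, zero_mem _], fun i _ => by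
      split_ifs with h
      · subst h; simpa using hyv
      · exact ImmAnCon.vanishBelow_zero⟩
  have hdsum : ∀ y : GammaImmAnCon p k O, digitSum π μ (fun i => if i = 0 then y else 0) = y :=
    fun y => by
      rw [digitSum, Finset.sum_range_succ']
      simp
  -- For c = 0 only some nonzero β is needed. It is borrowed from the case of a lift of t⁻¹, which
  -- has a unit coefficient at its extremal exponent.
  have hzero : HasEigenvector σ π R μ 0 := by
    obtain ⟨t, ht, htf, htv⟩ := G.lift _ G.single_mem
    have h1 := (hdigit (S := 1) ht (htv _ (by
      simpa using HahnSeries.vanishBelow_single (r := (-1 : ℚ))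
        (a := (1 : IsLocalRing.ResidueField O))))).hasEigenvector hR hπ hπσ hσ hμ hθ hθp one_pos
      (Nat.succ_pos μ) (e := -1) (by simp) (by
        simp only [if_true]
        refine le_antisymm (htf.integral _) (not_lt.1 fun hn => ?_)
        rw [← htf.coeff_eq_zero_iff] at hn
        simp at hn)
    obtain ⟨β, hβ, -, -, h0, hφ, -⟩ := h1
    exact ⟨β, hβ, 0, zero_mem R, h0, hφ, by simp⟩
  have hlat : ∀ {S : ℝ} {y : GammaImmAnCon p k O}, 0 < S → y ∈ G.ring →
      VanishBelow (-S) y.coeff → HasEigenvector σ π R μ y := by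
    intro S y hS hy hyv
    by_contra hcon
    have hstep : ∀ n : ℕ, ∃ c, IsDigits G μ θ (S / θ ^ n) c ∧ ∃ b ∈ G.ring,
        VanishBelow (-S) b.coeff ∧
        y = digitSum π μ c + (b - P ^ (μ + 1) * frobAut σ b) := fun n => by
      induction n with
      | zero => exact ⟨_, by simpa using hdigit hy hyv, 0, zero_mem _,
          ImmAnCon.vanishBelow_zero, by rw [hdsum]; simp⟩
      | succ n ih =>
        obtain ⟨c, hc, b, hb, hbv, hyc⟩ := ih
        obtain ⟨c', b', hb', hbv', hcc, h⟩ := hc.exists_step hπ hθ hθp (by positivity)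
        have hyc' : y = digitSum π μ c' + (b + b' - P ^ (μ + 1) * frobAut σ (b + b')) := by
          rw [hyc, hcc, map_add]; ring
        rcases h with h | ⟨A, hA, hcA, s, hs, e, he, hce⟩
        · refine ⟨c', by rwa [pow_succ, ← div_div], b + b', add_mem hb hb',
            ImmAnCon.vanishBelow_add hbv (hbv'.mono (neg_le_neg ?_)), hyc'⟩
          exact div_le_self hS.le (one_le_pow₀ hθ.le)
        · refine absurd ?_ hcon
          rw [hyc', add_comm]
          exact HasEigenvector.coboundary_add ⟨_, hR.le (add_mem hb hb'), rfl⟩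
            (hcA.hasEigenvector hR hπ hπσ hσ hμ hθ hθp hA hs he hce)
    -- If no eigenvector existed, the carrying would never stop. The poles would tend to 0 while the
    -- accumulated b keep poles of order at most S, which makes y a coboundary after all.
    obtain ⟨b, hb, hyb⟩ := G.exists_eq_sub_of_forall hπ hπσ (Nat.succ_ne_zero μ) (x := y) (S := S)
      fun ε hε => by
        obtain ⟨n, hn⟩ := pow_unbounded_of_one_lt (S * θ ^ μ / ε) hθ
        obtain ⟨c, hc, b, hb, hbv, hyc⟩ := hstep n
        refine ⟨_, digitSum_mem hc.mem, b, hb, (vanishBelow_digitSum (A := S / θ ^ n)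
          (by positivity) hθ.le hc.vanishBelow).mono ?_, hbv, hyc⟩
        rw [div_lt_iff₀ hε] at hn
        have h1 : S / θ ^ n * θ ^ μ ≤ ε := by
          rw [div_mul_eq_mul_div, div_le_iff₀ (by positivity)]
          linarith
        linarith
    refine hcon ?_
    rw [← add_zero y]
    exact HasEigenvector.coboundary_add ⟨b, hR.le hb, hyb.symm⟩ hzero
  obtain ⟨N, y, hy, hxy⟩ := hR.exists_approx x hx
  refine HasEigenvector.of_pow_mul hR hπ hπσ (N := N) ?_
  obtain ⟨S, hS, y', hy', hyv', b, hb, hyb⟩ :=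
    G.exists_vanishBelow_sub_eq hπ hπσ (Nat.succ_ne_zero μ) hy
  have h1 : P ^ N * x - y ∈ coboundaries σ R (P ^ (μ + 1)) := by
    rw [← map_pow]
    exact hR.mem_coboundaries_of_pos (sub_mem (mul_mem (pow_mem (hR.immConst_mem π) N) hx)
      (hR.le hy)) one_pos hxy
  have h2 : y' - y ∈ coboundaries σ R (P ^ (μ + 1)) := ⟨b, hR.le hb, hyb.symm⟩
  have h3 := HasEigenvector.coboundary_add (sub_mem h1 h2) (hlat hS hy' hyv')
  rwa [show P ^ N * x - y - (y' - y) + y' = P ^ N * x by ring] at h3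
end

/-! ### The local description of the analytic ring is stable under products -/

section
variable {p : ℕ} [Fact p.Prime] {k : Type*} [Field k] [IsAlgClosed k] [CharP k p]
  {O : Type*} [CommRing O] [IsDomain O] [IsDiscreteValuationRing O]
  [Algebra (WittVector p k) O] [Module.Finite (WittVector p k) O] [FaithfulSMul (WittVector p k) O]
  {σ : O ≃+* O} {π : O}

open GammaImmAnCon

theorem GammaImmAnCon.norm_coeff_mul_le_weight {x y : GammaImmAnCon p k O} {A B d : ℝ}
    (hA : 0 ≤ A) (hB : 0 ≤ B) (hx : ∀ n : ℚ, ‖x.coeff n‖ ≤ A * (p : ℝ) ^ (d * n))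
    (hy : ∀ n : ℚ, ‖y.coeff n‖ ≤ B * (p : ℝ) ^ (d * n)) (n : ℚ) :
    ‖(x * y).coeff n‖ ≤ A * B * (p : ℝ) ^ (d * n) := by
  rw [ImmAnCon.coeff_mul]
  have hw := IsAnCon.weight_pos (p := p) d
  refine IsUltrametricDist.norm_tsum_le_of_forall_le_of_nonneg
    (mul_nonneg (mul_nonneg hA hB) (hw n).le) fun i => ?_
  rw [norm_mul, IsAnCon.weight_sub d n i]
  calc _ ≤ (A * (p : ℝ) ^ (d * i)) * (B * (p : ℝ) ^ (d * ((n - i : ℚ) : ℝ))) :=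
        mul_le_mul (hx _) (hy _) (norm_nonneg _) (mul_nonneg hA (hw i).le)
    _ = _ := by ring

/-- The constant `π⁻¹`. -/
noncomputable def invConst (p : ℕ) [Fact p.Prime] (k : Type*) [Field k] [IsAlgClosed k] [CharP k p]
    [Algebra (WittVector p k) O] [Module.Finite (WittVector p k) O]
    [FaithfulSMul (WittVector p k) O] (π : O) : GammaImmAnCon p k O :=
  ImmAnCon.const (algebraMap O (CoeffField p k O) π)⁻¹

theorem invConst_pow_mul (hπ : Irreducible π) (n : ℕ) :
    invConst p k π ^ n * immConst p k O π ^ n = 1 := by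
  rw [← mul_pow]
  change (ImmAnCon.const _ * ImmAnCon.const _) ^ n = 1
  rw [← map_mul, inv_mul_cancel₀ (CoeffField.algebraMap_ne_zero hπ), map_one, one_pow]

namespace FrobeniusLattice
variable (G : FrobeniusLattice p k σ π)

/-- The ring obtained by inverting `π`. -/
noncomputable def localization : Subring (GammaImmAnCon p k O) where
  carrier := {x | ∃ M : ℕ, immConst p k O π ^ M * x ∈ G.ring}
  zero_mem' := ⟨0, by simp⟩
  one_mem' := ⟨0, by simp⟩
  neg_mem' := by
    rintro x ⟨M, hM⟩
    exact ⟨M, by rw [mul_neg]; exact neg_mem hM⟩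
  add_mem' := by
    rintro x y ⟨M, hM⟩ ⟨N, hN⟩
    refine ⟨M + N, ?_⟩
    rw [show immConst p k O π ^ (M + N) * (x + y) =
      immConst p k O π ^ N * (immConst p k O π ^ M * x) +
      immConst p k O π ^ M * (immConst p k O π ^ N * y) by ring]
    exact add_mem (G.const_pow_mul hM N) (G.const_pow_mul hN M)
  mul_mem' := by
    rintro x y ⟨M, hM⟩ ⟨N, hN⟩
    refine ⟨M + N, ?_⟩
    rw [show immConst p k O π ^ (M + N) * (x * y) =
      (immConst p k O π ^ M * x) * (immConst p k O π ^ N * y) by ring]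
    exact mul_mem hM hN

theorem le_localization : G.ring ≤ G.localization := fun x hx => ⟨0, by simpa using hx⟩

theorem invConst_mem_localization (hπ : Irreducible π) : invConst p k π ∈ G.localization := by
  refine ⟨1, ?_⟩
  have := invConst_pow_mul (p := p) (k := k) hπ 1
  rw [pow_one, pow_one] at this
  rw [pow_one, mul_comm, this]
  exact one_mem _

theorem frobAut_mem_localization (hπσ : σ π = π) {x : GammaImmAnCon p k O}
    (hx : x ∈ G.localization) : frobAut σ x ∈ G.localization := by
  obtain ⟨M, hM⟩ := hx
  refine ⟨M, ?_⟩
  have := G.frob _ hM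
  rwa [map_mul, map_pow, frobAut_immConst hπσ] at this

theorem exists_trim_localization (hπ : Irreducible π) {y : GammaImmAnCon p k O}
    (hy : y ∈ G.localization) {a b : ℕ} {J : ℝ} (h : ∀ n : ℚ, (n : ℝ) < J →
      ‖algebraMap O (CoeffField p k O) π‖ ^ a * ‖y.coeff n‖ ≤
        ‖algebraMap O (CoeffField p k O) π‖ ^ b) :
    ∃ w ∈ G.ring, VanishBelow J (immConst p k O π ^ a * y - immConst p k O π ^ b * w).coeff := by
  obtain ⟨M, hM⟩ := hy
  obtain ⟨w, hw, hwJ⟩ := G.exists_trim hπ (G.const_pow_mul hM a) (M + b) J fun n hn => by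
    rw [norm_coeff_immConst_pow_mul, norm_coeff_immConst_pow_mul, mul_left_comm, pow_add]
    exact mul_le_mul_of_nonneg_left (h n hn) (by positivity)
  refine ⟨w, hw, vanishBelow_of_immConst_pow_mul hπ (h := M) ?_⟩
  convert! hwJ using 2
  ring

/-- The elements that agree on each initial segment of the exponents with an element of the
localization. -/
def IsLocal (x : GammaImmAnCon p k O) : Prop :=
  ∀ j : ℚ, ∃ y ∈ G.localization, ∀ i < j, x.coeff i = y.coeff i

/-- The elements of the closure of the localization for the Gauss norms of small positive slope. -/
def IsGaussLimit (x : GammaImmAnCon p k O) : Prop :=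
  ∃ c : ℝ, 0 < c ∧ ∀ d : ℝ, 0 < d → d ≤ c → ∀ ε : ℝ, 0 < ε →
    ∃ y ∈ G.localization, ∀ n : ℚ, ‖(x - y).coeff n‖ ≤ ε * (p : ℝ) ^ (d * n)

variable {G}

/-- Below some j the series agrees with an element of the localization. From j on both are to be
small against p^(d n). For x this follows from its growth of rate d / 2, and for the approximation
from a replacement with controlled coefficients beyond j. -/
theorem IsLocal.isGaussLimit (hπ : Irreducible π) {x : GammaImmAnCon p k O} (hx : G.IsLocal x) :
    G.IsGaussLimit x := by
  have q0 := CoeffField.norm_pos (p := p) (k := k) hπ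
  have q1 := CoeffField.norm_lt_one (p := p) (k := k) hπ
  set q := ‖algebraMap O (CoeffField p k O) π‖ with hq
  have p1 : (1 : ℝ) < p := IsAnCon.one_lt
  have p0 : (0 : ℝ) < p := IsAnCon.p_pos
  obtain ⟨c, hc, hbd⟩ := x.isAnCon.bound
  refine ⟨c, hc, fun d hd hdc ε hε => ?_⟩
  obtain ⟨C, hC, hxC⟩ := hbd (d / 2) (half_pos hd) (by linarith)
  have hw : ∀ n : ℚ, (0 : ℝ) < (p : ℝ) ^ (d / 2 * n) := fun n => Real.rpow_pos_of_pos p0 _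
  obtain ⟨j, hj⟩ := Filter.eventually_atTop.1
    (IsAnCon.eventually_lt_rpow (p := p) (C / q / ε) (half_pos hd))
  have hjn : ∀ n : ℚ, j ≤ n → C / q * (p : ℝ) ^ (d / 2 * n) ≤ ε * (p : ℝ) ^ (d * n) := by
    intro n hn
    have h1 := (hj n hn).le
    rw [div_le_iff₀ hε] at h1
    have h2 : (p : ℝ) ^ (d * n) = (p : ℝ) ^ (d / 2 * n) * (p : ℝ) ^ (d / 2 * n) := by
      rw [← Real.rpow_add p0]; congr 1; ring
    rw [h2]
    nlinarith [hw n]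
  obtain ⟨y, hy, hxy⟩ := hx j
  set v := C * (p : ℝ) ^ (d / 2 * j)
  have hv : 0 < v := mul_pos hC (hw j)
  obtain ⟨a, ha⟩ := exists_pow_lt_of_lt_one (inv_pos.2 hv) q1
  have ha' : q ^ a * v ≤ 1 := by
    rw [← le_div_iff₀ hv, one_div]; exact ha.le
  -- π^b is the power nearest to the bound v for the coefficients below j, after scaling by π^a.
  -- Trimming gives z with the same coefficients below j and norm at most v / |π| everywhere, whence
  -- the constant C / q in the choice of j.
  obtain ⟨b, hb1, hb2⟩ := exists_nat_pow_near_of_lt_one (mul_pos (pow_pos q0 a) hv) ha' q0 q1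
  have hyv : ∀ n : ℚ, (n : ℝ) < j → q ^ a * ‖y.coeff n‖ ≤ q ^ b := fun n hn => by
    refine le_trans (mul_le_mul_of_nonneg_left ?_ (by positivity)) hb2
    rw [← hxy n (by exact_mod_cast hn)]
    refine (hxC n).trans (mul_le_mul_of_nonneg_left ?_ hC.le)
    exact Real.rpow_le_rpow_of_exponent_le p1.le (by nlinarith)
  obtain ⟨w, hw', hwJ⟩ := G.exists_trim_localization hπ hy hyv
  have hinv := invConst_pow_mul (p := p) (k := k) hπ a
  set z := invConst p k π ^ a * (immConst p k O π ^ b * w)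
  have hz : immConst p k O π ^ a * z = immConst p k O π ^ b * w := by
    linear_combination (immConst p k O π ^ b * w) * hinv
  refine ⟨z, mul_mem (pow_mem (G.invConst_mem_localization hπ) a)
    (G.le_localization (G.const_pow_mul hw' b)), fun n => ?_⟩
  have hyz : VanishBelow j (y - z).coeff := by
    refine vanishBelow_of_immConst_pow_mul hπ (h := a) ?_
    rwa [mul_sub, hz]
  rcases lt_or_ge n j with hn | hn
  · have h1 := hyz n (by exact_mod_cast hn)
    rw [ImmAnCon.coeff_sub, ← hxy n hn, ← ImmAnCon.coeff_sub] at h1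
    rw [h1, norm_zero]
    exact mul_nonneg hε.le (Real.rpow_pos_of_pos p0 _).le
  · refine le_trans ?_ (hjn n hn)
    rw [ImmAnCon.coeff_sub, sub_eq_add_neg]
    refine (IsUltrametricDist.norm_add_le_max _ _).trans (max_le ?_ ?_)
    · refine (hxC n).trans (mul_le_mul_of_nonneg_right ?_ (hw n).le)
      exact le_div_self hC.le q0 q1.le
    · rw [norm_neg]
      have h1 : q ^ a * ‖z.coeff n‖ ≤ q ^ b := by
        rw [hq, ← norm_coeff_immConst_pow_mul, hz]
        exact G.norm_coeff_immConst_pow_mul_le hw' b n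
      have h2 : q ^ b * q < q ^ a * v := by rw [← pow_succ]; exact hb1
      have h3 : ‖z.coeff n‖ ≤ v / q := by
        rw [le_div_iff₀ q0]
        refine le_of_mul_le_mul_left ?_ (pow_pos q0 a)
        calc q ^ a * (‖z.coeff n‖ * q) = q ^ a * ‖z.coeff n‖ * q := by ring
          _ ≤ q ^ b * q := mul_le_mul_of_nonneg_right h1 q0.le
          _ ≤ _ := h2.le
      refine h3.trans ?_
      rw [div_mul_eq_mul_div]
      refine div_le_div_of_nonneg_right (mul_le_mul_of_nonneg_left ?_ hC.le) q0.le
      have hn' : (j : ℝ) ≤ n := by exact_mod_cast hn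
      exact Real.rpow_le_rpow_of_exponent_le p1.le (by nlinarith)

/-- The reason for Gauss norms: a coefficient of a product involves arbitrarily large exponents of
one factor, so agreement on initial segments is not visibly multiplicative, whereas approximation in
a submultiplicative norm is. -/
theorem IsGaussLimit.mul {x y : GammaImmAnCon p k O} (hx : G.IsGaussLimit x)
    (hy : G.IsGaussLimit y) : G.IsGaussLimit (x * y) := by
  have p0 : (0 : ℝ) < p := IsAnCon.p_pos
  obtain ⟨c₁, hc₁, h₁⟩ := hx
  obtain ⟨c₂, hc₂, h₂⟩ := hy
  obtain ⟨c₃, hc₃, h₃⟩ := IsAnCon.exists_common x.isAnCon y.isAnCon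
  refine ⟨min c₁ (min c₂ c₃), lt_min hc₁ (lt_min hc₂ hc₃), fun d hd hdc ε hε => ?_⟩
  simp only [le_min_iff] at hdc
  obtain ⟨⟨A, hA, hxA⟩, B, hB, hyB⟩ := h₃ d hd hdc.2.2
  obtain ⟨x', hx', hxx⟩ := h₁ d hd hdc.1 (min 1 (ε / B)) (by positivity)
  obtain ⟨y', hy', hyy⟩ := h₂ d hd hdc.2.1 (ε / (A + 1)) (by positivity)
  refine ⟨x' * y', mul_mem hx' hy', fun n => ?_⟩
  have hw : ∀ n : ℚ, (0 : ℝ) < (p : ℝ) ^ (d * n) := fun n => Real.rpow_pos_of_pos p0 _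
  have hx'A : ∀ n : ℚ, ‖x'.coeff n‖ ≤ (A + 1) * (p : ℝ) ^ (d * n) := fun n => by
    rw [show x' = x + -(x - x') by ring, ImmAnCon.coeff_add]
    refine (norm_add_le _ _).trans ?_
    rw [ImmAnCon.coeff_neg, norm_neg, add_mul]
    exact add_le_add (hxA n)
      ((hxx n).trans (mul_le_mul_of_nonneg_right (min_le_left _ _) (hw n).le))
  rw [show x * y - x' * y' = (x - x') * y + x' * (y - y') by ring, ImmAnCon.coeff_add]
  refine (IsUltrametricDist.norm_add_le_max _ _).trans (max_le ?_ ?_)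
  · refine (norm_coeff_mul_le_weight (by positivity) hB.le (fun n => (hxx n).trans
      (mul_le_mul_of_nonneg_right (min_le_right _ _) (hw n).le)) hyB n).trans (le_of_eq ?_)
    field_simp
  · refine (norm_coeff_mul_le_weight (by positivity) (by positivity) hx'A hyy n).trans
      (le_of_eq ?_)
    field_simp

/-- Below j the consecutive differences of the approximations tend to 0 uniformly, so up to a fixed
power of π they are π^K times lattice elements w K. The sum of these elements recovers x below j. -/
theorem IsGaussLimit.isLocal (hπ : Irreducible π) {x : GammaImmAnCon p k O}
    (hx : G.IsGaussLimit x) : G.IsLocal x := by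
  have q0 := CoeffField.norm_pos (p := p) (k := k) hπ
  have q1 := CoeffField.norm_lt_one (p := p) (k := k) hπ
  set q := ‖algebraMap O (CoeffField p k O) π‖ with hq
  have p1 : (1 : ℝ) < p := IsAnCon.one_lt
  have p0 : (0 : ℝ) < p := IsAnCon.p_pos
  obtain ⟨d, hd, h⟩ := hx
  intro j
  choose y hy hxy using fun K : ℕ => h d hd le_rfl (q ^ K) (pow_pos q0 K)
  obtain ⟨a, ha⟩ := exists_pow_lt_of_lt_one
    (inv_pos.2 (Real.rpow_pos_of_pos p0 (d * (j : ℝ)))) q1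
  have ha' : q ^ a * (p : ℝ) ^ (d * j) ≤ 1 := by
    rw [← le_div_iff₀ (Real.rpow_pos_of_pos p0 _), one_div]; exact ha.le
  have hmono : ∀ n : ℚ, (n : ℝ) < j → (p : ℝ) ^ (d * n) ≤ (p : ℝ) ^ (d * j) := fun n hn =>
    Real.rpow_le_rpow_of_exponent_le p1.le (by nlinarith)
  have hdiff : ∀ (K : ℕ) (n : ℚ), ‖(y (K + 1) - y K).coeff n‖ ≤ q ^ K * (p : ℝ) ^ (d * n) := by
    intro K n
    have hw := Real.rpow_pos_of_pos p0 (d * (n : ℝ))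
    rw [show y (K + 1) - y K = (x - y K) + -(x - y (K + 1)) by ring, ImmAnCon.coeff_add]
    refine (IsUltrametricDist.norm_add_le_max _ _).trans (max_le (hxy K n) ?_)
    rw [ImmAnCon.coeff_neg, norm_neg]
    exact (hxy (K + 1) n).trans (mul_le_mul_of_nonneg_right
      (pow_le_pow_of_le_one q0.le q1.le (Nat.le_succ K)) hw.le)
  choose w hw hwJ using fun K : ℕ => G.exists_trim_localization hπ
    (sub_mem (hy (K + 1)) (hy K)) (a := a) (b := K) (J := j) fun n hn => by
      calc q ^ a * ‖(y (K + 1) - y K).coeff n‖ ≤ q ^ a * (q ^ K * (p : ℝ) ^ (d * j)) :=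
            mul_le_mul_of_nonneg_left ((hdiff K n).trans
              (mul_le_mul_of_nonneg_left (hmono n hn) (by positivity))) (by positivity)
        _ = q ^ K * (q ^ a * (p : ℝ) ^ (d * j)) := by ring
        _ ≤ q ^ K := mul_le_of_le_one_right (by positivity) ha'
  have hpart : ∀ (K : ℕ) (n : ℚ), (n : ℝ) < j → ∑ i ∈ Finset.range K,
      (immConst p k O π ^ (1 * i) * w i).coeff n =
      (immConst p k O π ^ a * (y K - y 0)).coeff n := fun K n hn => by
    induction K with
    | zero => simp [ImmAnCon.coeff_zero]
    | succ K ih =>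
      have h1 := hwJ K n hn
      rw [ImmAnCon.coeff_sub, sub_eq_zero] at h1
      rw [Finset.sum_range_succ, ih, one_mul, ← h1, ← ImmAnCon.coeff_add]
      congr 1
      ring
  have htsum : ∀ n : ℚ, (n : ℝ) < j → ∑' i, (immConst p k O π ^ (1 * i) * w i).coeff n =
      (immConst p k O π ^ a * (x - y 0)).coeff n := fun n hn => by
    refine tendsto_nhds_unique (G.summable_coeff hπ one_ne_zero hw n).hasSum.tendsto_sum_nat ?_
    simp only [hpart _ n hn]
    rw [tendsto_iff_norm_sub_tendsto_zero]
    have hlim : Filter.Tendsto (fun K : ℕ => q ^ K * (p : ℝ) ^ (d * n)) Filter.atTop (nhds 0) := by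
      simpa using (tendsto_pow_atTop_nhds_zero_of_lt_one q0.le q1).mul_const _
    refine squeeze_zero (fun _ => norm_nonneg _) (fun K => ?_) hlim
    rw [← ImmAnCon.coeff_sub, show immConst p k O π ^ a * (y K - y 0) -
      immConst p k O π ^ a * (x - y 0) = -(immConst p k O π ^ a * (x - y K)) by ring,
      ImmAnCon.coeff_neg, norm_neg, norm_coeff_immConst_pow_mul]
    exact (mul_le_of_le_one_left (norm_nonneg _) (pow_le_one₀ q0.le q1.le)).trans (hxy K n)
  -- The w K have no common bound on their poles. The decay at negative exponents is inherited from
  -- x - y 0, with which the sum agrees there up to the factor π^a.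
  obtain ⟨s, hs, hsn, -⟩ := G.exists_coeff_eq_tsum hπ one_ne_zero hw (by
    obtain ⟨c, hc, hneg⟩ := (immConst p k O π ^ a * (x - y 0)).isAnCon.neg
    refine ⟨c, hc, ?_⟩
    filter_upwards [hneg, Filter.eventually_lt_atBot j] with n hn hnj
    rw [htsum n (by exact_mod_cast hnj)]
    exact hn)
  have hinv := invConst_pow_mul (p := p) (k := k) hπ a
  refine ⟨y 0 + invConst p k π ^ a * s, add_mem (hy 0) (mul_mem
    (pow_mem (G.invConst_mem_localization hπ) a) (G.le_localization hs)), fun i hi => ?_⟩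
  have h1 : VanishBelow j (x - (y 0 + invConst p k π ^ a * s)).coeff := by
    refine vanishBelow_of_immConst_pow_mul hπ (h := a) ?_
    rw [show immConst p k O π ^ a * (x - (y 0 + invConst p k π ^ a * s)) =
      immConst p k O π ^ a * (x - y 0) - s by linear_combination -s * hinv]
    intro n hn
    rw [ImmAnCon.coeff_sub, ← htsum n hn, hsn, sub_self]
  have h2 := h1 i (by exact_mod_cast hi)
  rwa [ImmAnCon.coeff_sub, sub_eq_zero] at h2

variable (G)

/-- The ring of the elements that agree on each initial segment of the exponents with an element of
the localization. -/
noncomputable def hull (hπ : Irreducible π) : Subring (GammaImmAnCon p k O) where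
  carrier := {x | G.IsLocal x}
  zero_mem' j := ⟨0, zero_mem _, fun _ _ => rfl⟩
  one_mem' j := ⟨1, one_mem _, fun _ _ => rfl⟩
  neg_mem' := by
    intro x hx j
    obtain ⟨y, hy, h⟩ := hx j
    exact ⟨-y, neg_mem hy, fun i hi => by rw [ImmAnCon.coeff_neg, ImmAnCon.coeff_neg, h i hi]⟩
  add_mem' := by
    intro x x' hx hx' j
    obtain ⟨y, hy, h⟩ := hx j
    obtain ⟨y', hy', h'⟩ := hx' j
    exact ⟨y + y', add_mem hy hy', fun i hi => by
      rw [ImmAnCon.coeff_add, ImmAnCon.coeff_add, h i hi, h' i hi]⟩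
  mul_mem' hx hx' := ((hx.isGaussLimit hπ).mul (hx'.isGaussLimit hπ)).isLocal hπ

theorem localization_le_hull (hπ : Irreducible π) : G.localization ≤ G.hull hπ :=
  fun x hx _ => ⟨x, hx, fun _ _ => rfl⟩

theorem isAnalyticHull_hull (hπ : Irreducible π) (hπσ : σ π = π) :
    IsAnalyticHull G (G.hull hπ) where
  le := G.le_localization.trans (G.localization_le_hull hπ)
  const_inv := G.localization_le_hull hπ (G.invConst_mem_localization hπ)
  frob x hx j := by
    have p0 : (0 : ℚ) < p := by exact_mod_cast (Fact.out : p.Prime).pos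
    obtain ⟨y, hy, h⟩ := hx (j / p)
    exact ⟨frobAut σ y, G.frobAut_mem_localization hπσ hy, fun i hi =>
      congrArg (CoeffField.extAut σ) (h (i / p) (div_lt_div_of_pos_right hi p0))⟩
  mem_of_local x hx j := by
    obtain ⟨y, hy, h⟩ := hx j
    obtain ⟨z, hz, h'⟩ := hy j
    exact ⟨z, hz, fun i hi => (h i hi).trans (h' i hi)⟩
  exists_approx x hx := by
    obtain ⟨y, ⟨M, hM⟩, h⟩ := hx 1
    refine ⟨M, _, hM, fun n hn => ?_⟩
    rw [← mul_sub, ← map_pow, coeff_immConst_mul, ImmAnCon.coeff_sub, h n (by exact_mod_cast hn),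
      sub_self, mul_zero]

end FrobeniusLattice
end

/-! ### Integral elements, Teichmüller lifts and the lattice of all integral series -/

section
variable {K F : Type*} [Field K] [Field F]

/-- P need not be monic: z is algebraic over the integral closure of K, hence over K, and K is a
field. -/
theorem RingHom.isIntegralElem_of_eval_eq_zero (f : K →+* F) {P : Polynomial F} (hP : P ≠ 0)
    (hf : ∀ n, f.IsIntegralElem (P.coeff n)) {z : F} (hz : P.eval z = 0) : f.IsIntegralElem z := by
  let := f.toAlgebra
  obtain ⟨Q, hQ⟩ := (Polynomial.mem_lifts P).1 ((Polynomial.lifts_iff_coeff_lifts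
    (f := algebraMap (integralClosure K F) F) P).2 fun n => ⟨⟨P.coeff n, hf n⟩, rfl⟩)
  have h1 : IsAlgebraic (integralClosure K F) z := by
    refine ⟨Q, fun h => hP (by rw [← hQ, h, Polynomial.map_zero]), ?_⟩
    rw [Polynomial.aeval_def, ← Polynomial.eval_map, hQ, hz]
  exact (h1.restrictScalars K).isIntegral

theorem RingHom.IsIntegralElem.of_pow_eq (f : K →+* F) {x : F} {n : ℕ} (hn : 0 < n)
    (hx : f.IsIntegralElem (x ^ n)) : f.IsIntegralElem x := by
  let := f.toAlgebra
  exact IsIntegral.of_pow hn hx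

end

theorem ImmAnCon.vanishBelow_pow {p : ℕ} [Fact p.Prime] {L : Type*} [NormedField L]
    [IsUltrametricDist L] [CompleteSpace L] {x : ImmAnCon p L} {r : ℝ}
    (hx : VanishBelow r x.coeff) (n : ℕ) : VanishBelow ((n + 1) * r) (x ^ (n + 1)).coeff := by
  induction n with
  | zero => simpa using hx
  | succ n ih =>
    rw [pow_succ]
    refine (vanishBelow_mul ih hx).mono (le_of_eq ?_)
    push_cast
    ring

section
variable {p : ℕ} [Fact p.Prime] {k : Type*} [Field k] [IsAlgClosed k] [CharP k p]
  {O : Type*} [CommRing O] [IsDomain O] [IsDiscreteValuationRing O]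
  [Algebra (WittVector p k) O] [Module.Finite (WittVector p k) O] [FaithfulSMul (WittVector p k) O]
  {σ : O ≃+* O} {π : O}

open GammaImmAnCon

theorem IsReduction.exists_lift (f : HahnSeries ℚ (IsLocalRing.ResidueField O)) :
    ∃ x : GammaImmAnCon p k O, IsReduction x f ∧
      ∀ r, VanishBelow r f.coeff → VanishBelow r x.coeff := by
  have h : ∀ n, ∃ a : O, IsLocalRing.residue O a = f.coeff n ∧ (f.coeff n = 0 → a = 0) := by
    intro n
    by_cases h0 : f.coeff n = 0
    · exact ⟨0, by rw [h0, map_zero], fun _ => rfl⟩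
    · obtain ⟨a, ha⟩ := IsLocalRing.residue_surjective (f.coeff n)
      exact ⟨a, ha, fun h => absurd h h0⟩
  choose a ha ha0 using h
  have hv : ∀ r, VanishBelow r f.coeff →
      VanishBelow r fun n => algebraMap O (CoeffField p k O) (a n) := fun r hr n hn => by
    change algebraMap O (CoeffField p k O) (a n) = 0
    rw [ha0 n (hr n hn), map_zero]
  have hcon : IsAnCon p fun n => algebraMap O (CoeffField p k O) (a n) := by
    refine IsAnCon.of_vanishBelow (hv _ (HahnSeries.vanishBelow_order f)) (fun r => ?_)
      fun n => CoeffField.norm_coe_le_one (a n)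
    refine (f.isPWO_support.mono fun n hn h0 => ?_).isWF
    have hn : (p : ℝ) ^ r < ‖algebraMap O (CoeffField p k O) (a n)‖ := hn
    rw [ha0 n h0, map_zero, norm_zero] at hn
    exact (Real.rpow_pos_of_pos IsAnCon.p_pos r).not_gt hn
  exact ⟨⟨_, hcon⟩, fun n => ⟨a n, rfl, ha n⟩, hv⟩

variable (p k σ) in
/-- The ring of all series with coefficients in `O`, with its residue field. -/
noncomputable def immLattice (hπ : Irreducible π) : FrobeniusLattice p k σ π where
  ring := integers p k O
  res := Set.univ
  le_integers := le_rfl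
  closed _ hx _ := hx
  frob x hx n := by rw [norm_coeff_frobAut]; exact hx _
  frob_inv x hx n := by rw [norm_coeff_frobAut_inv]; exact hx _
  const a n := norm_coeff_const_le (CoeffField.norm_coe_le_one a) n
  div x _ h := by
    obtain ⟨y, hy, hxy⟩ := exists_eq_immConst_pow_mul hπ 1 (by simpa using h)
    exact ⟨y, hy, by simpa using hxy⟩
  single_mem := Set.mem_univ _
  res_mem _ _ _ _ := Set.mem_univ _
  lift f _ := by
    obtain ⟨x, hx, hv⟩ := IsReduction.exists_lift (p := p) (k := k) f
    exact ⟨x, hx.integral, hx, hv⟩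
  root _ _ _ _ _ _ := Set.mem_univ _

/-- The truncation of a series at j has bounded coefficients, so a power of π brings them into O. -/
theorem immLattice_hull (hπ : Irreducible π) : (immLattice p k σ hπ).hull hπ = ⊤ := by
  have q0 := CoeffField.norm_pos (p := p) (k := k) hπ
  have q1 := CoeffField.norm_lt_one (p := p) (k := k) hπ
  refine eq_top_iff.2 fun x _ j => ?_
  have h0 : ∀ n, ‖if n < j then x.coeff n else 0‖ ≤ ‖x.coeff n‖ := fun n => by
    split_ifs
    · exact le_rfl
    · rw [norm_zero]; exact norm_nonneg _
  obtain ⟨C, hC⟩ := x.isAnCon.bdd j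
  have hcon : IsAnCon p fun n => if n < j then x.coeff n else 0 := by
    refine ⟨fun r => (x.isAnCon.wo r).mono fun n hn => lt_of_lt_of_le hn (h0 n), fun i => ?_, ?_,
      fun d hd => ?_⟩
    · obtain ⟨D, hD⟩ := x.isAnCon.bdd i
      exact ⟨D, fun n hn => (h0 n).trans (hD n hn)⟩
    · obtain ⟨c, hc, h⟩ := x.isAnCon.neg
      exact ⟨c, hc, h.mono fun n hn => (h0 n).trans_lt hn⟩
    · exact (x.isAnCon.pos d hd).mono fun n hn => (h0 n).trans_lt hn
  obtain ⟨M, hM⟩ := exists_pow_lt_of_lt_one (inv_pos.2 (lt_max_of_lt_right one_pos :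
    (0 : ℝ) < max C 1)) q1
  refine ⟨⟨_, hcon⟩, ⟨M, fun n => ?_⟩, fun i hi => (if_pos hi).symm⟩
  rw [norm_coeff_immConst_pow_mul]
  change _ * ‖if n < j then x.coeff n else 0‖ ≤ 1
  split_ifs with hn
  · have hC1 : (0 : ℝ) < max C 1 := lt_max_of_lt_right one_pos
    calc _ ≤ (max C 1)⁻¹ * max C 1 := mul_le_mul hM.le ((hC n hn).trans (le_max_left _ _))
          (norm_nonneg _) (by positivity)
      _ = 1 := inv_mul_cancel₀ hC1.ne'
  · rw [norm_zero, mul_zero]; exact zero_le_one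

theorem exists_add_pow_prime_eq_immConst (hπ : Irreducible π) {A : Subring (GammaImmAnCon p k O)}
    (hA : ∀ a, immConst p k O a ∈ A) {x y : GammaImmAnCon p k O} (hx : x ∈ A) (hy : y ∈ A) :
    ∃ r ∈ A, (x + y) ^ p = x ^ p + y ^ p + immConst p k O π * (y * r) := by
  obtain ⟨e, u, he, hp⟩ := CoeffField.exists_norm_natCast_prime p k hπ
  obtain ⟨e, rfl⟩ := Nat.exists_eq_succ_of_ne_zero he
  obtain ⟨r, hr⟩ := exists_add_pow_prime_eq (Fact.out : p.Prime) (⟨x, hx⟩ : A) ⟨y, hy⟩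
  have hr := congrArg Subtype.val hr
  have hp' : (p : GammaImmAnCon p k O) = immConst p k O (u * π ^ e) * immConst p k O π := by
    rw [← map_mul, mul_assoc, ← pow_succ, ← hp, map_natCast]
  refine ⟨immConst p k O (u * π ^ e) * x * r, mul_mem (mul_mem (hA _) hx) r.2, ?_⟩
  push_cast at hr
  rw [hr]
  linear_combination (x * y * r) * hp'

/-- Teichmüller lifts. -/
theorem exists_teichmuller (hπ : Irreducible π) (hπσ : σ π = π)
    (hσ : ∀ a : O, IsLocalRing.residue O (σ a) = IsLocalRing.residue O a ^ p)
    (f : HahnSeries ℚ (IsLocalRing.ResidueField O)) :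
    ∃ y : GammaImmAnCon p k O, IsReduction y f ∧ frobAut σ y = y ^ p ∧
      ∀ r, VanishBelow r f.coeff → VanishBelow r y.coeff := by
  have hcp := charP_residueField p k O
  obtain ⟨x₀, hx₀, hx₀v⟩ := IsReduction.exists_lift (p := p) (k := k) f
  set P := immConst p k O π
  set G := immLattice p k σ hπ
  have p2 : 2 ≤ p := (Fact.out : p.Prime).two_le
  have p0 : (0 : ℝ) < p := IsAnCon.p_pos
  -- The Teichmüller lift is the fixed point of T in its residue class, reached by iteration: p is
  -- divisible by π, so T improves congruences modulo π^(n+1) to congruences modulo π^(n+2).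
  set T : GammaImmAnCon p k O → GammaImmAnCon p k O := fun x => ((frobAut σ)⁻¹ x) ^ p
  have hPinv : (frobAut σ)⁻¹ P = P := frobAut_inv_immConst hπσ
  have hTadd : ∀ {x v}, x ∈ G.ring → v ∈ G.ring → ∀ n : ℕ,
      ∃ w ∈ G.ring, T (x + P ^ (n + 1) * v) = T x + P ^ (n + 2) * w := by
    intro x v hx hv n
    obtain ⟨r, hr, h⟩ := exists_add_pow_prime_eq_immConst hπ G.const (G.frob_inv _ hx)
      (G.frob_inv _ (G.const_pow_mul hv (n + 1)))
    obtain ⟨t, ht⟩ : ∃ t, (n + 1) * p = n + 2 + t := Nat.exists_eq_add_of_le (by nlinarith)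
    refine ⟨P ^ t * ((frobAut σ)⁻¹ v) ^ p + (frobAut σ)⁻¹ v * r,
      add_mem (G.const_pow_mul (pow_mem (G.frob_inv _ hv) p) t) (mul_mem (G.frob_inv _ hv) hr), ?_⟩
    simp only [T]
    rw [map_add, h, map_mul, map_pow, hPinv, mul_pow, ← pow_mul, ht]
    change _ + _ + P * _ = _
    ring
  set X : ℕ → GammaImmAnCon p k O := fun n => T^[n] x₀
  have hXs : ∀ n, X (n + 1) = T (X n) := fun n => Function.iterate_succ_apply' _ _ _
  have hX : ∀ n, X n ∈ G.ring := fun n => by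
    induction n with
    | zero => exact hx₀.integral
    | succ n ih => rw [hXs]; exact pow_mem (G.frob_inv _ ih) p
  -- φ⁻¹ divides the exponents by p and the p-th power multiplies the lower bound by p, so the bound
  -- is preserved.
  have hXv : ∀ r, VanishBelow r f.coeff → ∀ n, VanishBelow r (X n).coeff := fun r hr n => by
    induction n with
    | zero => exact hx₀v r hr
    | succ n ih =>
      rw [hXs]
      obtain ⟨m, hm⟩ := Nat.exists_eq_succ_of_ne_zero (Fact.out : p.Prime).ne_zero
      have h1 := ImmAnCon.vanishBelow_pow (vanishBelow_frobAut_inv (σ := σ) ih) m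
      have h2 : ((m : ℝ) + 1) = p := by rw [hm]; push_cast; rfl
      rw [h2, mul_div_cancel₀ _ p0.ne', ← Nat.succ_eq_add_one, ← hm] at h1
      exact h1
  have hdiff : ∀ n, ∃ w ∈ G.ring, X (n + 1) - X n = P ^ (n + 1) * w := fun n => by
    induction n with
    | zero =>
      obtain ⟨g, hg, hgf⟩ := IsReduction.frobAut_inv hσ hx₀
      have h1 : IsReduction (X 1 - X 0) 0 := by
        have := (hg.pow p).sub hx₀
        rwa [hgf, sub_self] at this
      obtain ⟨w, hw, h⟩ := G.div _ (sub_mem (hX 1) (hX 0)) (h1.norm_le hπ)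
      exact ⟨w, hw, by rw [h, zero_add, pow_one]⟩
    | succ n ih =>
      obtain ⟨w, hw, h⟩ := ih
      obtain ⟨w', hw', h'⟩ := hTadd (hX n) hw n
      refine ⟨w', hw', ?_⟩
      rw [hXs (n + 1), show X (n + 1) = X n + P ^ (n + 1) * w by linear_combination h, h', ← hXs n]
      linear_combination h
  choose w hw hXw using hdiff
  have hwv : ∀ r, VanishBelow r f.coeff → ∀ n, VanishBelow r (w n).coeff := fun r hr n => by
    refine vanishBelow_of_immConst_pow_mul hπ (h := n + 1) ?_
    change VanishBelow r (P ^ (n + 1) * w n).coeff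
    rw [← hXw]
    exact ImmAnCon.vanishBelow_sub (hXv r hr _) (hXv r hr _)
  obtain ⟨s, hs, hsK⟩ := G.exists_sum hπ one_ne_zero hw (C := |(f.order : ℝ)|) fun j =>
    (hwv _ (HahnSeries.vanishBelow_order f) j).mono (by
      have h1 := neg_abs_le (f.order : ℝ)
      have h2 := abs_nonneg (f.order : ℝ)
      have h3 : (0 : ℝ) ≤ j := Nat.cast_nonneg j
      nlinarith)
  simp only [one_mul] at hsK
  have hsum : ∀ K, x₀ + P * ∑ j ∈ Finset.range K, P ^ j * w j = X K := fun K => by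
    induction K with
    | zero => simp [X]
    | succ K ih => rw [Finset.sum_range_succ, mul_add, ← add_assoc, ih]; linear_combination -hXw K
  have hy : x₀ + P * s ∈ G.ring := add_mem hx₀.integral (mul_mem (G.const π) hs)
  have hTy : x₀ + P * s - T (x₀ + P * s) = 0 := by
    refine G.eq_zero_of_forall_dvd hπ one_ne_zero fun K => ?_
    obtain ⟨v, hv, hsv, -⟩ := hsK K
    have h1 : x₀ + P * s = X K + P ^ (K + 1) * v := by
      rw [← hsum K, hsv]; ring
    obtain ⟨v', hv', h2⟩ := hTadd (hX K) hv K
    refine ⟨P * (v - w K - P * v'), mul_mem (G.const π)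
      (sub_mem (sub_mem hv (hw K)) (mul_mem (G.const π) hv')), ?_⟩
    rw [h1, h2, ← hXs, one_mul]
    linear_combination -hXw K
  refine ⟨x₀ + P * s, ?_, ?_, fun r hr => ?_⟩
  · rw [← add_zero f]
    exact hx₀.add (IsReduction.immConst_mul hπ hs)
  · conv_lhs => rw [sub_eq_zero.1 hTy]
    simp only [T]
    rw [map_pow, frobAut_apply_inv]
  · obtain ⟨v, -, hv, hvr⟩ := hsK 0
    have hsv : s = v := by simpa using hv
    exact ImmAnCon.vanishBelow_add (hx₀v r hr) (vanishBelow_immConst_mul π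
      (hsv ▸ hvr r (hwv r hr)))

end

/-! ### The lattice of algebraic overconvergent series -/

section
variable {p : ℕ} [Fact p.Prime] {k : Type*} [Field k] [IsAlgClosed k] [CharP k p]
  {O : Type*} [CommRing O] [IsDomain O] [IsDiscreteValuationRing O]
  [Algebra (WittVector p k) O] [Module.Finite (WittVector p k) O] [FaithfulSMul (WittVector p k) O]
  {σ : O ≃+* O} {π : O}

open GammaImmAnCon

theorem frobAut_inv_immConst_eq (a : O) : (frobAut σ)⁻¹ (immConst p k O a) =
    immConst p k O (σ.symm a) := by
  have h : frobAut σ (immConst p k O (σ.symm a)) = immConst p k O a := by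
    change frobAut σ (ImmAnCon.const _) = ImmAnCon.const _
    rw [frobAut_const, CoeffField.extAut_algebraMap, σ.apply_symm_apply]
  rw [← h, frobAut_inv_apply_self]

theorem immConst_mem_algDense (a : O) : immConst p k O a ∈ algDense σ :=
  Subring.subset_closure (Or.inl ⟨a, rfl⟩)

theorem algDense_le_integers : algDense (p := p) (k := k) σ ≤ integers p k O := by
  refine Subring.closure_le.2 ?_
  rintro _ (⟨a, rfl⟩ | ⟨-, f, hf, -⟩)
  · exact norm_coeff_const_le (CoeffField.norm_coe_le_one a)
  · exact hf.integral

theorem algDense_le_algCon : algDense (p := p) (k := k) σ ≤ algCon σ := fun x hx =>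
  ⟨algDense_le_integers hx, fun N => ⟨x, hx, fun n => by simp [ImmAnCon.coeff_zero]⟩⟩

theorem frobAut_inv_mem_algDense
    (hσ : ∀ a : O, IsLocalRing.residue O (σ a) = IsLocalRing.residue O a ^ p)
    {x : GammaImmAnCon p k O} (hx : x ∈ algDense σ) : (frobAut σ)⁻¹ x ∈ algDense σ := by
  suffices h : algDense σ ≤ (algDense σ).comap
    (RingEquiv.toRingHom ((frobAut (p := p) (k := k) σ)⁻¹)) from h hx
  refine Subring.closure_le.2 ?_
  rintro _ (⟨a, rfl⟩ | ⟨hy, f, hf, hfi⟩)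
  · change (frobAut σ)⁻¹ _ ∈ algDense σ
    rw [frobAut_inv_immConst_eq]
    exact immConst_mem_algDense _
  · obtain ⟨g, hg, rfl⟩ := IsReduction.frobAut_inv hσ hf
    refine Subring.subset_closure (Or.inr ⟨?_, g, hg, ?_⟩)
    · change frobAut σ ((frobAut σ)⁻¹ _) = ((frobAut σ)⁻¹ _) ^ p
      rw [frobAut_apply_inv, ← map_pow, ← hy]
      exact (frobAut_inv_apply_self _).symm
    · exact RingHom.IsIntegralElem.of_pow_eq _ (Fact.out : p.Prime).pos hfi

theorem exists_isReduction_of_mem_algDense {x : GammaImmAnCon p k O} (hx : x ∈ algDense σ) :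
    ∃ f, IsReduction x f ∧ (laurentToHahn (IsLocalRing.ResidueField O)).IsIntegralElem f := by
  refine Subring.closure_induction (p := fun x _ => ∃ f, IsReduction x f ∧
    (laurentToHahn (IsLocalRing.ResidueField O)).IsIntegralElem f) ?_ ?_ ?_ ?_ ?_ ?_ hx
  · rintro _ (⟨a, rfl⟩ | ⟨-, f, hf, hfi⟩)
    · refine ⟨_, IsReduction.const a, ?_⟩
      have h := (laurentToHahn (IsLocalRing.ResidueField O)).isIntegralElem_map
        (x := HahnSeries.C (IsLocalRing.residue O a))
      have h1 : laurentToHahn (IsLocalRing.ResidueField O)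
          (HahnSeries.C (IsLocalRing.residue O a)) = HahnSeries.C (IsLocalRing.residue O a) := by
        change HahnSeries.embDomain _ (HahnSeries.single 0 _) = HahnSeries.single 0 _
        rw [HahnSeries.embDomain_single]
        simp
      rwa [h1] at h
    · exact ⟨f, hf, hfi⟩
  · exact ⟨0, IsReduction.zero, RingHom.isIntegralElem_zero _⟩
  · exact ⟨1, IsReduction.one, RingHom.isIntegralElem_one _⟩
  · rintro x y - - ⟨f, hf, hfi⟩ ⟨g, hg, hgi⟩
    exact ⟨f + g, hf.add hg, hfi.add _ hgi⟩
  · rintro x - ⟨f, hf, hfi⟩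
    exact ⟨-f, hf.neg, hfi.neg⟩
  · rintro x y - - ⟨f, hf, hfi⟩ ⟨g, hg, hgi⟩
    exact ⟨f * g, hf.mul hg, hfi.mul _ hgi⟩

theorem exists_pow_le_inv_pow (p : ℕ) [Fact p.Prime] (k : Type*) [Field k] [IsAlgClosed k]
    [CharP k p] [Algebra (WittVector p k) O] [Module.Finite (WittVector p k) O]
    [FaithfulSMul (WittVector p k) O] (hπ : Irreducible π) (N : ℕ) :
    ∃ M : ℕ, ‖algebraMap O (CoeffField p k O) π‖ ^ M ≤ ((p : ℝ)⁻¹) ^ N := by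
  have p0 : (0 : ℝ) < p := IsAnCon.p_pos
  obtain ⟨M, hM⟩ := exists_pow_lt_of_lt_one (show (0 : ℝ) < ((p : ℝ)⁻¹) ^ N by positivity)
    (CoeffField.norm_lt_one (p := p) (k := k) hπ)
  exact ⟨M, hM.le⟩

theorem mem_algCon_of_forall (hπ : Irreducible π) {x : GammaImmAnCon p k O}
    (hx : x ∈ integers p k O) (h : ∀ N : ℕ, ∃ z ∈ algCon σ, ∀ n,
      ‖(x - z).coeff n‖ ≤ ‖algebraMap O (CoeffField p k O) π‖ ^ N) : x ∈ algCon σ := by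
  refine ⟨hx, fun N => ?_⟩
  obtain ⟨M, hM⟩ := exists_pow_le_inv_pow p k hπ N
  obtain ⟨z, hz, hxz⟩ := h M
  obtain ⟨w, hw, hzw⟩ := hz.2 N
  refine ⟨w, hw, fun n => ?_⟩
  rw [show x - w = (x - z) + (z - w) by ring]
  exact norm_coeff_add_le (fun n => (hxz n).trans hM) hzw n

theorem immConst_mem_algCon (a : O) : immConst p k O a ∈ algCon σ :=
  algDense_le_algCon (immConst_mem_algDense a)

theorem frobAut_inv_mem_algCon
    (hσ : ∀ a : O, IsLocalRing.residue O (σ a) = IsLocalRing.residue O a ^ p)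
    {x : GammaImmAnCon p k O} (hx : x ∈ algCon σ) : (frobAut σ)⁻¹ x ∈ algCon σ := by
  refine ⟨fun i => by rw [norm_coeff_frobAut_inv]; exact hx.1 _, fun N => ?_⟩
  obtain ⟨z, hz, hzx⟩ := hx.2 N
  refine ⟨(frobAut σ)⁻¹ z, frobAut_inv_mem_algDense hσ hz, fun i => ?_⟩
  rw [← map_sub, norm_coeff_frobAut_inv]
  exact hzx _

/-- The elements of `algDense` are fixed modulo `π` by `x ↦ φ⁻¹(x)^p`. -/
theorem exists_sub_frobAut_inv_pow_eq (hπ : Irreducible π)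
    (hσ : ∀ a : O, IsLocalRing.residue O (σ a) = IsLocalRing.residue O a ^ p)
    {x : GammaImmAnCon p k O} (hx : x ∈ algDense σ) :
    ∃ y ∈ algDense σ, x - ((frobAut σ)⁻¹ x) ^ p = immConst p k O π * y := by
  have hconst : ∀ a : O, ∃ y ∈ algDense σ, immConst p k O a -
      ((frobAut σ)⁻¹ (immConst p k O a)) ^ p = immConst p k O π * y := fun a => by
    have h : IsLocalRing.residue O (a - σ.symm a ^ p) = 0 := by
      rw [map_sub, map_pow, ← hσ, σ.apply_symm_apply, sub_self]
    rw [IsLocalRing.residue_eq_zero_iff, hπ.maximalIdeal_eq, Ideal.mem_span_singleton] at h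
    obtain ⟨b, hb⟩ := h
    refine ⟨immConst p k O b, immConst_mem_algDense b, ?_⟩
    rw [frobAut_inv_immConst_eq, ← map_pow, ← map_sub, hb, map_mul]
  have hmul : ∀ x y : GammaImmAnCon p k O, x ∈ algDense σ → y ∈ algDense σ →
      (∃ z ∈ algDense σ, x - ((frobAut σ)⁻¹ x) ^ p = immConst p k O π * z) →
      (∃ z ∈ algDense σ, y - ((frobAut σ)⁻¹ y) ^ p = immConst p k O π * z) →
      ∃ z ∈ algDense σ, x * y - ((frobAut σ)⁻¹ (x * y)) ^ p = immConst p k O π * z := by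
    rintro x y hx hy ⟨z, hz, h⟩ ⟨w, hw, h'⟩
    refine ⟨z * y + ((frobAut σ)⁻¹ x) ^ p * w, add_mem (mul_mem hz hy)
      (mul_mem (pow_mem (frobAut_inv_mem_algDense hσ hx) p) hw), ?_⟩
    rw [map_mul, mul_pow]
    linear_combination y * h + ((frobAut σ)⁻¹ x) ^ p * h'
  refine Subring.closure_induction (p := fun x _ => ∃ y ∈ algDense σ,
    x - ((frobAut σ)⁻¹ x) ^ p = immConst p k O π * y) ?_ ?_ ?_ ?_ ?_ ?_ hx
  · rintro _ (⟨a, rfl⟩ | ⟨hy, -⟩)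
    · exact hconst a
    · refine ⟨0, zero_mem _, ?_⟩
      rw [← map_pow, ← hy, ← frobAut_apply, frobAut_inv_apply_self]
      ring
  · simpa using hconst 0
  · simpa using hconst 1
  · rintro x y hx hy ⟨z, hz, h⟩ ⟨w, hw, h'⟩
    obtain ⟨r, hr, hrr⟩ := exists_add_pow_prime_eq_immConst hπ (A := algDense σ)
      immConst_mem_algDense (frobAut_inv_mem_algDense hσ hx) (frobAut_inv_mem_algDense hσ hy)
    refine ⟨z + w - (frobAut σ)⁻¹ y * r,
      sub_mem (add_mem hz hw) (mul_mem (frobAut_inv_mem_algDense hσ hy) hr), ?_⟩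
    rw [map_add, hrr]
    linear_combination h + h'
  · intro x hx h
    have := hmul _ _ (immConst_mem_algDense (-1)) hx (hconst (-1)) h
    simpa using this
  · exact hmul

/-- Saturation of `Γ^alg_con`. -/
theorem exists_mem_algCon_eq_mul (hπ : Irreducible π)
    (hσ : ∀ a : O, IsLocalRing.residue O (σ a) = IsLocalRing.residue O a ^ p)
    {x : GammaImmAnCon p k O} (hx : x ∈ algCon σ)
    (hxn : ∀ n, ‖x.coeff n‖ ≤ ‖algebraMap O (CoeffField p k O) π‖) :
    ∃ y ∈ algCon σ, x = immConst p k O π * y := by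
  have q0 := CoeffField.norm_pos (p := p) (k := k) hπ
  have q1 := CoeffField.norm_lt_one (p := p) (k := k) hπ
  set q := ‖algebraMap O (CoeffField p k O) π‖ with hq
  have key : ∀ {x y : GammaImmAnCon p k O} (N : ℕ),
      (∀ n, ‖(x - immConst p k O π * y).coeff n‖ ≤ q ^ (N + 1)) → ∀ z, x = immConst p k O π * z →
      ∀ n, ‖(z - y).coeff n‖ ≤ q ^ N := by
    intro x y N h z hz n
    have h1 := h n
    rw [hz, ← mul_sub, ← pow_one (immConst p k O π), norm_coeff_immConst_pow_mul, pow_one,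
      pow_succ'] at h1
    exact le_of_mul_le_mul_left h1 q0
  have hex : ∀ {x : GammaImmAnCon p k O}, (∀ n, ‖x.coeff n‖ ≤ q) →
      ∃ z ∈ integers p k O, x = immConst p k O π * z := fun h => by
    obtain ⟨z, hz, h⟩ := exists_eq_immConst_pow_mul hπ 1 (by simpa using h)
    exact ⟨z, hz, by simpa using h⟩
  have hdense : ∀ x ∈ algDense σ, (∀ n, ‖x.coeff n‖ ≤ q) →
      ∃ y ∈ algCon (p := p) (k := k) σ, x = immConst p k O π * y := by
    intro x hx hxn
    obtain ⟨z, hz, hxz⟩ := hex hxn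
    refine ⟨z, mem_algCon_of_forall hπ hz fun N => ?_, hxz⟩
    -- Iteration of x ≡ φ⁻¹(x)^p modulo π. If π divides x coefficientwise, it also divides
    -- φ^(-N)(x), so the power is divisible by π^(p^N). Thus x is arbitrarily close to π times an
    -- element of `algDense`.
    have hpow : ∀ N : ℕ, ∃ y ∈ algDense σ,
        x = (((frobAut σ)⁻¹ ^ N) x) ^ p ^ N + immConst p k O π * y := fun N => by
      induction N with
      | zero => exact ⟨0, zero_mem _, by simp⟩
      | succ N ih =>
        obtain ⟨y, hy, h⟩ := ih
        have hw : ∀ N : ℕ, ((frobAut σ)⁻¹ ^ N) x ∈ algDense (p := p) (k := k) σ := fun N => by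
          induction N with
          | zero => simpa using hx
          | succ N ih => rw [pow_succ', RingAut.mul_apply]; exact frobAut_inv_mem_algDense hσ ih
        obtain ⟨w, hw', h'⟩ := exists_sub_frobAut_inv_pow_eq hπ hσ (hw N)
        rw [← RingAut.mul_apply, ← pow_succ'] at h'
        have hpw := pow_mem (hw (N + 1)) p
        obtain ⟨r, hr⟩ := sub_dvd_pow_sub_pow (⟨_, hw N⟩ : algDense (p := p) (k := k) σ)
          ⟨_, hpw⟩ (p ^ N)
        have hr := congrArg Subtype.val hr
        push_cast at hr
        refine ⟨y + w * r, add_mem hy (mul_mem hw' r.2), ?_⟩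
        rw [pow_succ' p, pow_mul]
        linear_combination h + hr + (r : GammaImmAnCon p k O) * h'
    obtain ⟨y, hy, h⟩ := hpow (N + 1)
    refine ⟨y, algDense_le_algCon hy, key N (fun n => ?_) z hxz⟩
    obtain ⟨v, hv, hxv⟩ := hex (x := ((frobAut σ)⁻¹ ^ (N + 1)) x)
      (fun n => by rw [norm_coeff_frobAut_inv_pow]; exact hxn _)
    rw [sub_eq_iff_eq_add.2 h, hxv, mul_pow, norm_coeff_immConst_pow_mul]
    refine (mul_le_of_le_one_right (by positivity) (pow_mem hv _ n)).trans ?_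
    exact pow_le_pow_of_le_one q0.le q1.le
      (Nat.lt_pow_self (Fact.out : p.Prime).one_lt).le
  obtain ⟨z, hz, hxz⟩ := hex hxn
  refine ⟨z, mem_algCon_of_forall hπ hz fun N => ?_, hxz⟩
  -- For general x an element w of `algDense` close enough to x is again divisible by π
  -- coefficientwise, and its quotient approximates x / π.
  obtain ⟨M, hM⟩ := exists_pow_lt_of_lt_one (pow_pos q0 (N + 1))
    (inv_lt_one_of_one_lt₀ (IsAnCon.one_lt (p := p)))
  obtain ⟨w, hw, hxw⟩ := hx.2 M
  have hxw' : ∀ n, ‖(x - w).coeff n‖ ≤ q ^ (N + 1) := fun n => (hxw n).trans hM.le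
  obtain ⟨y, hy, hwy⟩ := hdense w hw fun n => by
    rw [show w = x + -(x - w) by ring]
    refine norm_coeff_add_le hxn (fun n => ?_) n
    rw [ImmAnCon.coeff_neg, norm_neg]
    exact (hxw' n).trans (pow_le_of_le_one q0.le q1.le (Nat.succ_ne_zero N))
  exact ⟨y, hy, key N (by rwa [← hwy]) z hxz⟩

theorem isIntegralElem_single_neg_one (κ : Type*) [Field κ] :
    (laurentToHahn κ).IsIntegralElem (HahnSeries.single (-1) 1) := by
  have h := (laurentToHahn κ).isIntegralElem_map (x := HahnSeries.single (-1) 1)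
  have h1 : laurentToHahn κ (HahnSeries.single (-1) 1) = HahnSeries.single (-1) 1 := by
    change HahnSeries.embDomain _ _ = _
    rw [HahnSeries.embDomain_single]
    simp
  rwa [h1] at h

variable (p k) in
/-- The lattice `Γ^alg_con`. -/
noncomputable def algLattice (hπ : Irreducible π) (hπσ : σ π = π)
    (hσ : ∀ a : O, IsLocalRing.residue O (σ a) = IsLocalRing.residue O a ^ p) :
    FrobeniusLattice p k σ π where
  ring := algCon σ
  res := {f | (laurentToHahn (IsLocalRing.ResidueField O)).IsIntegralElem f}
  le_integers _ hx := hx.1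
  closed _ := mem_algCon_of_forall hπ
  frob _ := immFrob_mem_algCon σ
  frob_inv _ := frobAut_inv_mem_algCon hσ
  const := immConst_mem_algCon
  div _ := exists_mem_algCon_eq_mul hπ hσ
  single_mem := isIntegralElem_single_neg_one _
  res_mem x hx f hf := by
    obtain ⟨z, hz, hxz⟩ := hx.2 1
    obtain ⟨g, hg, hgi⟩ := exists_isReduction_of_mem_algDense hz
    have h0 : IsReduction (x - z) 0 := IsReduction.of_norm_lt_one fun n => (hxz n).trans_lt (by
      rw [pow_one]; exact inv_lt_one_of_one_lt₀ (IsAnCon.one_lt (p := p)))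
    have h1 := h0.add hg
    rw [sub_add_cancel, zero_add] at h1
    rwa [hf.unique h1]
  lift f hf := by
    obtain ⟨y, hy, hφ, hv⟩ := exists_teichmuller (p := p) (k := k) hπ hπσ hσ f
    exact ⟨y, algDense_le_algCon (Subring.subset_closure (Or.inr ⟨hφ, f, hy, hf⟩)), hy, hv⟩
  root A N hA hA0 z hz := by
    have p1 := (Fact.out : p.Prime).one_lt
    -- z is a root of this polynomial, whose coefficients are algebraic. It is not zero because its
    -- coefficient at X is A 0.
    set P : Polynomial (HahnSeries ℚ (IsLocalRing.ResidueField O)) :=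
      (∑ n ∈ Finset.range (N + 1), Polynomial.monomial (p ^ n) (A n)) -
        Polynomial.C (HahnSeries.addPoly p A N z) with hP
    refine RingHom.isIntegralElem_of_eval_eq_zero _ (P := P) (fun h0 => hA0 ?_) (fun n => ?_) ?_
    · have h1 := congrArg (fun Q => Polynomial.coeff Q 1) h0
      simp only [hP, Polynomial.coeff_sub, Polynomial.finsetSum_coeff, Polynomial.coeff_monomial,
        Polynomial.coeff_C_of_ne_zero one_ne_zero, sub_zero, Polynomial.coeff_zero] at h1
      rw [Finset.sum_eq_single 0] at h1
      · simpa using h1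
      · intro n _ hn
        rw [if_neg (Nat.one_lt_pow hn p1).ne']
      · intro h; exact absurd (Finset.mem_range.2 (Nat.succ_pos N)) h
    · rw [hP, Polynomial.coeff_sub, Polynomial.finsetSum_coeff]
      refine RingHom.IsIntegralElem.sub _ ?_ ?_
      · refine Finset.sum_induction _ (fun f =>
          (laurentToHahn (IsLocalRing.ResidueField O)).IsIntegralElem f)
          (fun a b ha hb => ha.add _ hb) (RingHom.isIntegralElem_zero _) fun n hn => ?_
        rw [Polynomial.coeff_monomial]
        split_ifs
        · exact hA n (Nat.lt_succ_iff.1 (Finset.mem_range.1 hn))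
        · exact RingHom.isIntegralElem_zero _
      · rw [Polynomial.coeff_C]
        split_ifs
        · exact hz
        · exact RingHom.isIntegralElem_zero _
    · rw [hP, Polynomial.eval_sub, Polynomial.eval_finsetSum, Polynomial.eval_C]
      simp [HahnSeries.addPoly]

theorem algConInv_eq_localization (hπ : Irreducible π) (hπσ : σ π = π)
    (hσ : ∀ a : O, IsLocalRing.residue O (σ a) = IsLocalRing.residue O a ^ p) :
    algConInv σ = (algLattice p k hπ hπσ hσ).localization := by
  obtain ⟨e, u, he, hp⟩ := CoeffField.exists_norm_natCast_prime p k hπ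
  have hp' : (p : GammaImmAnCon p k O) = immConst p k O u * immConst p k O π ^ e := by
    rw [← map_pow, ← map_mul, ← hp, map_natCast]
  ext x
  constructor
  · rintro ⟨n, hn⟩
    refine ⟨e * n, ?_⟩
    have hu : immConst p k O ↑u⁻¹ * immConst p k O u = 1 := by
      rw [← map_mul, Units.inv_mul, map_one]
    have h1 : immConst p k O π ^ (e * n) * x =
        immConst p k O ↑u⁻¹ ^ n * ((p : GammaImmAnCon p k O) ^ n * x) := by
      rw [hp', mul_pow, ← mul_assoc, ← mul_assoc, ← mul_pow, hu, one_pow, one_mul, pow_mul]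
    rw [h1]
    exact mul_mem (pow_mem (immConst_mem_algCon _) n) hn
  · rintro ⟨M, hM⟩
    refine ⟨M, ?_⟩
    obtain ⟨t, ht⟩ := Nat.exists_eq_add_of_le (Nat.le_mul_of_pos_left M (Nat.pos_of_ne_zero he))
    have h1 : (p : GammaImmAnCon p k O) ^ M * x = immConst p k O u ^ M * immConst p k O π ^ t *
        (immConst p k O π ^ M * x) := by
      rw [hp', mul_pow, ← pow_mul, ht]
      ring
    rw [h1]
    exact mul_mem (mul_mem (pow_mem (immConst_mem_algCon _) M)
      (pow_mem (immConst_mem_algCon π) t)) hM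

/-- The elements that are locally in the localization already form a subring,
`FrobeniusLattice.hull`, so the closure in `algAnCon` adds nothing. -/
theorem algAnCon_eq_hull (hπ : Irreducible π) (hπσ : σ π = π)
    (hσ : ∀ a : O, IsLocalRing.residue O (σ a) = IsLocalRing.residue O a ^ p) :
    algAnCon σ = (algLattice p k hπ hπσ hσ).hull hπ := by
  rw [algAnCon, algConInv_eq_localization hπ hπσ hσ]
  exact Subring.closure_eq ((algLattice p k hπ hπσ hσ).hull hπ)

end

/-! ### The two analytic rings and the eigenvector in the module -/

section
variable {p : ℕ} [Fact p.Prime] {k : Type*} [Field k] [IsAlgClosed k] [CharP k p]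
  {O : Type*} [CommRing O] [IsDomain O] [IsDiscreteValuationRing O]
  [Algebra (WittVector p k) O] [Module.Finite (WittVector p k) O] [FaithfulSMul (WittVector p k) O]
  {σ : O ≃+* O} {π : O}

open GammaImmAnCon

theorem isAnalyticHull_top (hπ : Irreducible π) (hπσ : σ π = π) :
    IsAnalyticHull (immLattice p k σ hπ) ⊤ := by
  have h := (immLattice p k σ hπ).isAnalyticHull_hull hπ hπσ
  rwa [immLattice_hull] at h

theorem isAnalyticHull_algAnCon (hπ : Irreducible π) (hπσ : σ π = π)
    (hσ : ∀ a : O, IsLocalRing.residue O (σ a) = IsLocalRing.residue O a ^ p) :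
    IsAnalyticHull (algLattice p k hπ hπσ hσ) (algAnCon σ) := by
  have h := (algLattice p k hπ hπσ hσ).isAnalyticHull_hull hπ hπσ
  rwa [← algAnCon_eq_hull] at h

end

/-- An eigenvector in a module of rank two, from the equations for its coordinates. -/
theorem Module.Basis.exists_semilinear_eigenvector {R : Type*} [CommRing R] {φ : R →+* R}
    {M : Type*} [AddCommGroup M] [Module R M] (F : M →ₛₗ[φ] M) (b : Module.Basis (Fin 2) R M)
    {c ϖ α β : R} {μ : ℕ} (h0 : F (b 0) = ϖ ^ (μ + 1) • b 0) (h1 : F (b 1) = b 1 + c • b 0)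
    (hβ0 : β ≠ 0) (hβ : φ β = ϖ ^ μ * β) (hα : α - ϖ * φ α = c * β) :
    ∃ x : M, x ≠ 0 ∧ F x = ϖ ^ μ • x := by
  refine ⟨α • b 0 + β • b 1, fun h => hβ0 ?_, ?_⟩
  · have h2 := congrArg (b.coord 1) h
    simpa using h2
  · have h2 : φ α * ϖ ^ (μ + 1) + φ β * c = ϖ ^ μ * α := by
      rw [hβ]
      linear_combination -ϖ ^ μ * hα
    rw [map_add, map_smulₛₗ, map_smulₛₗ, h0, h1, smul_add, smul_add, smul_smul, smul_smul,
      smul_smul, smul_smul, ← h2, add_smul, ← hβ]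
    abel

theorem mainTheorem8 (p : ℕ) [Fact p.Prime]
    -- the algebraically closed field `k` of characteristic `p`
    (k : Type*) [Field k] [IsAlgClosed k] [CharP k p]
    -- the finite extension `O` of the Witt ring of `k`
    (O : Type*) [CommRing O] [IsDomain O] [IsDiscreteValuationRing O]
    [Algebra (WittVector p k) O] [Module.Finite (WittVector p k) O] [FaithfulSMul (WittVector p k) O]
    -- the automorphism of `O` lifting the absolute Frobenius
    (σ : O ≃+* O) (hσ : ∀ a : O, IsLocalRing.residue O (σ a) = IsLocalRing.residue O a ^ p)
    -- the uniformizer fixed by `σ`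
    (π : O) (hπ : Irreducible π) (hπσ : σ π = π)
    (m : ℕ) (hm : 2 ≤ m) :
    -- over `Γ^alg_{an,con}`
    (∀ (M : Type*) [AddCommGroup M] [Module (GammaAlgAnCon p k σ) M]
      (F : M →ₛₗ[algFrob p k σ] M) (_ : IsFCrystal F)
      (b : Module.Basis (Fin 2) (GammaAlgAnCon p k σ) M)
      (c : GammaAlgAnCon p k σ),
      F (b 0) = algConst p k σ (π ^ m) • b 0 → F (b 1) = b 1 + c • b 0 →
      ∃ x : M, x ≠ 0 ∧ F x = algConst p k σ (π ^ (m - 1)) • x) ∧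
    -- over `Γ^imm_{an,con}`
    (∀ (M : Type*) [AddCommGroup M] [Module (GammaImmAnCon p k O) M]
      (F : M →ₛₗ[immFrob (p := p) (k := k) σ] M) (_ : IsFCrystal F)
      (b : Module.Basis (Fin 2) (GammaImmAnCon p k O) M) (c : GammaImmAnCon p k O),
      F (b 0) = immConst p k O (π ^ m) • b 0 → F (b 1) = b 1 + c • b 0 →
      ∃ x : M, x ≠ 0 ∧ F x = immConst p k O (π ^ (m - 1)) • x) := by
  -- With m = μ + 1 the hypothesis m ≥ 2 becomes μ ≠ 0. This is needed for d to converge and to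
  -- vanish modulo π, and for the curve of the Newton polygon to be strictly convex.
  obtain ⟨μ, rfl⟩ := Nat.exists_eq_add_of_le' (one_le_two.trans hm)
  have hμ : μ ≠ 0 := by omega
  simp only [Nat.add_sub_cancel, map_pow]
  refine ⟨fun M _ _ F _ b c h0 h1 => ?_, fun M _ _ F _ b c h0 h1 => ?_⟩
  · obtain ⟨β, hβR, α, hαR, hβ0, hβ, hα⟩ :=
      (isAnalyticHull_algAnCon hπ hπσ hσ).hasEigenvector hπ hπσ hσ hμ c.2
    exact b.exists_semilinear_eigenvector (α := ⟨α, hαR⟩) (β := ⟨β, hβR⟩) F h0 h1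
      (fun h => hβ0 (congrArg Subtype.val h)) (Subtype.ext hβ) (Subtype.ext hα)
  · obtain ⟨β, -, α, -, hβ0, hβ, hα⟩ :=
      (isAnalyticHull_top hπ hπσ).hasEigenvector hπ hπσ hσ hμ (Subring.mem_top c)
    exact b.exists_semilinear_eigenvector F h0 h1 hβ0 hβ hα
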